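/- A cell of $\mathbb{Z}^2$ is a unit square with integer corners. For a finite set $\mathcal S$ of cells, $V(\mathcal S)$ is the set of all corners of its cells and $\mathrm{rank}\,\mathcal S$ is its number of cells. A polyomino is a non-empty finite set of cells any two of which are joined, inside the set, by a walk of cells in which consecutive cells share an edge; it is simple if any two cells outside it are likewise joined by a walk outside it. Let $K$ be a field. $K[\mathcal S]$ denotes the quotient of $K[x_v \mid v\in V(\mathcal S)]$ by the ideal generated by all binomials $x_ax_b-x_cx_d$ where $a,b$ are the diagonal corners and $c,d$ the anti-diagonal corners of a lattice rectangle all of whose cells belong to $\mathcal S$. $\mathrm{HP}_{K[\mathcal S]}(t)=\sum_{k\ge 0}\dim_K K[\mathcal S]_k\,t^k$ is its Hilbert–Poincaré series, and $h_{K[\mathcal S]}(t)\in\mathbb Z[t]$ is the polynomial with $h_{K[\mathcal S]}(1)\ne 0$ and $\mathrm{HP}_{K[\mathcal S]}(t)=h_{K[\mathcal S]}(t)/(1-t)^{d}$, where $d$ is the Krull dimension of $K[\mathcal S]$. A closed path is a polyomino whose cells can be listed cyclically as distinct cells $A_1,\dots,A_n$, $n>5$ (indices modulo $n$), such that $A_i\cap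 A_{i+1}$ is a common edge for all $i$, and $V(A_i)\cap V(A_j)=\emptyset$ whenever $j\notin\{i-2,i-1,i,i+1,i+2\}$. An $L$-configuration of $\mathcal P$ is a path $C_1,\dots,C_5$ of five distinct cells of $\mathcal P$, consecutive ones sharing an edge, such that $C_1,C_2,C_3$ and $C_3,C_4,C_5$ each go straight, in two orthogonal directions. A block of $\mathcal P$ is a horizontal or vertical row of at least two consecutive cells of $\mathcal P$; it is maximal if no other block contains it. A ladder of $n$ steps in $\mathcal P$ is a sequence $\mathcal B_1,\dots,\mathcal B_n$ of maximal blocks, all horizontal or all vertical, such that $V(\mathcal B_i)\cap V(\mathcal B_{i+1})=\{a_i,b_i\}$ with $a_i\neq b_i$ for $1\le i\le n-1$, and such that for $1\le i\le n-2$ the segments $[a_i,b_i]$ and $[a_{i+1},b_{i+1}]$ do not lie on a common edge interval of $\mathcal P$ (a horizontal or vertical lattice segment all of whose unit pieces are edges of cells of $\mathcal P$). Theorem. Let $\mathcal P$ be a closed path with no $L$-configuration, and let $\mathcal B_1,\mathcal B_2,\mathcal B_3$ be the first three blocks of a ladder of at least three steps in $\mathcal P$. Assume that there is no maximal block $\mathcal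 K\ne\mathcal B_2,\mathcal B_3$ of $\mathcal P$ such that $\mathcal K,\mathcal B_1,\mathcal B_2$ is a ladder of three steps, and that $\mathcal B_1$ and $\mathcal B_2$ both have at least three cells. Let $A\in\mathcal B_2$ and $B\in\mathcal B_1$ be the cells that share an edge, let $A'$ be the cell of $\mathcal B_2$ adjacent to $A$, and let $B'$ be the cell of $\mathcal B_1$ adjacent to $B$. Put $$\mathcal K_1=\mathcal P\setminus\mathcal B_1,\quad \mathcal K_2=\mathcal P\setminus(\mathcal B_2\cup\{B,B'\}),\quad \mathcal K_3=\mathcal P\setminus(\mathcal B_1\cup\{A\}),\quad \mathcal K_4=\mathcal P\setminus\{A,B,A',B'\}.$$ Then $\mathcal K_1,\mathcal K_2,\mathcal K_3,\mathcal K_4$ are simple polyominoes, $\mathrm{rank}\,\mathcal P\le|V(\mathcal P)|$, and $$\mathrm{HP}_{K[\mathcal P]}(t)=\frac{h_{K[\mathcal K_4]}(t)+t\left[h_{K[\mathcal K_1]}(t)+2\,h_{K[\mathcal K_2]}(t)+h_{K[\mathcal K_3]}(t)\right]}{(1-t)^{|V(\mathcal P)|-\mathrm{rank}\,\mathcal P}}.$$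 In particular $K[\mathcal P]$ has Krull dimension $|V(\mathcal P)|-\mathrm{rank}\,\mathcal P$. -/

import Mathlib

open scoped Polynomial PowerSeries

namespace Polyomino

/-! ### Cells, polyominoes, blocks -/

/-- A unit cell of `ℤ²`, given by its lower left corner. -/
abbrev Cell : Type := ℤ × ℤ

/-- The four corners of a cell. -/
def cellVertices (C : Cell) : Finset (ℤ × ℤ) :=
  {(C.1, C.2), (C.1 + 1, C.2), (C.1, C.2 + 1), (C.1 + 1, C.2 + 1)}

/-- The four edges of a cell, each one as the pair of its end points. -/
def cellEdges (C : Cell) : Finset (Finset (ℤ × ℤ)) :=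
  {{(C.1, C.2), (C.1, C.2 + 1)}, {(C.1, C.2 + 1), (C.1 + 1, C.2 + 1)},
    {(C.1 + 1, C.2), (C.1 + 1, C.2 + 1)}, {(C.1, C.2), (C.1 + 1, C.2)}}

/-- `V(S)`. -/
def vertices (S : Finset Cell) : Finset (ℤ × ℤ) := S.biUnion cellVertices

/-- `E(S)`. -/
def edges (S : Finset Cell) : Finset (Finset (ℤ × ℤ)) := S.biUnion cellEdges

/-- The rank of a finite collection of cells: the number of its cells. -/
def rank (S : Finset Cell) : ℕ := S.card

/-- `C ∩ D` is a common edge of `C` and `D`. -/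
def Adj (C D : Cell) : Prop :=
  cellVertices C ∩ cellVertices D ∈ cellEdges C ∧ cellVertices C ∩ cellVertices D ∈ cellEdges D

/-- Any two cells of `S` are joined by a walk of cells of `S`. -/
def CellConnected (S : Set Cell) : Prop :=
  ∀ C ∈ S, ∀ D ∈ S, Relation.ReflTransGen (fun X Y => Adj X Y ∧ Y ∈ S) C D

/-- A polyomino: a non-empty finite collection of cells, any two of which are connected in it. -/
def IsPolyomino (P : Finset Cell) : Prop := P.Nonempty ∧ CellConnected (P : Set Cell)

/-- A simple polyomino: moreover any two cells outside it are connected outside it. -/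
def IsSimplePolyomino (P : Finset Cell) : Prop :=
  IsPolyomino P ∧ CellConnected ((P : Set Cell)ᶜ)

/-- `S` is the cell interval between two cells of `P` in horizontal position, it has more than
one cell, and it is contained in `P`. -/
def IsHorizontalBlock (P S : Finset Cell) : Prop :=
  ∃ A ∈ P, ∃ B ∈ P, A.1 ≤ B.1 ∧ A.2 = B.2 ∧ S = Finset.Icc A B ∧ 1 < S.card ∧ S ⊆ P

/-- `S` is the cell interval between two cells of `P` in vertical position, it has more than
one cell, and it is contained in `P`. -/
def IsVerticalBlock (P S : Finset Cell) : Prop :=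
  ∃ A ∈ P, ∃ B ∈ P, A.1 = B.1 ∧ A.2 ≤ B.2 ∧ S = Finset.Icc A B ∧ 1 < S.card ∧ S ⊆ P

def IsBlock (P S : Finset Cell) : Prop := IsHorizontalBlock P S ∨ IsVerticalBlock P S

/-- A maximal block: no block of `P` contains it properly. -/
def IsMaximalBlock (P S : Finset Cell) : Prop :=
  IsBlock P S ∧ ∀ T, IsBlock P T → S ⊆ T → S = T

/-- A horizontal or vertical edge interval of `P`, as the set of its lattice points. -/
def IsEdgeInterval (P : Finset Cell) (I : Finset (ℤ × ℤ)) : Prop :=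
  (∃ i k j : ℤ, i < k ∧ I = Finset.Icc (i, j) (k, j) ∧
    ∀ l : ℤ, i ≤ l → l < k → {(l, j), (l + 1, j)} ∈ edges P) ∨
  (∃ i k j : ℤ, i < k ∧ I = Finset.Icc (j, i) (j, k) ∧
    ∀ l : ℤ, i ≤ l → l < k → {(j, l), (j, l + 1)} ∈ edges P)

/-! ### Closed paths, L-configurations, ladders -/

/-- A closed path: a polyomino whose cells form a cyclic sequence of `n > 5` distinct cells,
consecutive cells share an edge, and cells whose cyclic distance is greater than two have no
common vertex. -/
def IsClosedPath (P : Finset Cell) : Prop :=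
  IsPolyomino P ∧ ∃ n : ℕ, 5 < n ∧ ∃ A : ZMod n → Cell,
    Function.Injective A ∧
    (∀ C, C ∈ P ↔ ∃ i, A i = C) ∧
    (∀ i, Adj (A i) (A (i + 1))) ∧
    ∀ i j, j ≠ i - 2 → j ≠ i - 1 → j ≠ i → j ≠ i + 1 → j ≠ i + 2 →
      Disjoint (cellVertices (A i)) (cellVertices (A j))

/-- An L-configuration: a path of five distinct cells `C₁, …, C₅` of `P`, such that
`C₁, C₂, C₃` and `C₃, C₄, C₅` go straight, in two orthogonal directions. -/
def HasLConfiguration (P : Finset Cell) : Prop :=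
  ∃ C₁ ∈ P, ∃ C₂ ∈ P, ∃ C₃ ∈ P, ∃ C₄ ∈ P, ∃ C₅ ∈ P,
    [C₁, C₂, C₃, C₄, C₅].Nodup ∧
    Adj C₁ C₂ ∧ Adj C₂ C₃ ∧ Adj C₃ C₄ ∧ Adj C₄ C₅ ∧
    C₂ - C₁ = C₃ - C₂ ∧ C₄ - C₃ = C₅ - C₄ ∧
    (C₂ - C₁).1 * (C₄ - C₃).1 + (C₂ - C₁).2 * (C₄ - C₃).2 = 0

/-- The list `L = [B₁, …, Bₙ]` is a ladder of `n` steps in `P`: all `Bᵢ` are maximal horizontal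
blocks, or all are maximal vertical blocks; consecutive ones have exactly two common vertices
`aᵢ ≠ bᵢ`; and `[aᵢ, bᵢ]`, `[aᵢ₊₁, bᵢ₊₁]` never lie on the same edge interval of `P`. -/
def IsLadder (P : Finset Cell) (L : List (Finset Cell)) : Prop :=
  ((∀ B ∈ L, IsHorizontalBlock P B) ∨ (∀ B ∈ L, IsVerticalBlock P B)) ∧
  (∀ B ∈ L, IsMaximalBlock P B) ∧
  (∀ (i : ℕ) (h : i + 1 < L.length), (vertices L[i] ∩ vertices L[i + 1]).card = 2) ∧
  ∀ (i : ℕ) (h : i + 2 < L.length), ¬ ∃ I, IsEdgeInterval P I ∧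
    vertices L[i] ∩ vertices L[i + 1] ⊆ I ∧ vertices L[i + 1] ∩ vertices L[i + 2] ⊆ I

/-! ### The coordinate ring and its Hilbert–Poincaré series -/

/-- The proper interval with diagonal corners `a`, `b` is an inner interval of `P`: all its
cells, whose lower left corners run from `a` to `b - (1, 1)`, belong to `P`. -/
def IsInnerInterval (P : Finset Cell) (a b : ℤ × ℤ) : Prop :=
  a.1 < b.1 ∧ a.2 < b.2 ∧ Finset.Icc a (b - (1, 1)) ⊆ P

/-- The polynomial ring with one variable for each vertex of `P`. -/
abbrev vertexRing (K : Type*) [Field K] (P : Finset Cell) : Type _ :=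
  MvPolynomial (vertices P) K

/-- The polyomino ideal, generated by the inner 2-minors `x_a x_b - x_c x_d` of `P`. -/
noncomputable def polyominoIdeal (K : Type*) [Field K] (P : Finset Cell) : Ideal (vertexRing K P) :=
  Ideal.span {f | ∃ a b c d : vertices P,
    IsInnerInterval P a.1 b.1 ∧ c.1 = (a.1.1, b.1.2) ∧ d.1 = (b.1.1, a.1.2) ∧
    f = MvPolynomial.X a * MvPolynomial.X b - MvPolynomial.X c * MvPolynomial.X d}

/-- The coordinate ring `K[P]`. -/
abbrev coordinateRing (K : Type*) [Field K] (P : Finset Cell) : Type _ :=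
  vertexRing K P ⧸ polyominoIdeal K P

/-- The component of degree `k` of `K[P]`: the image of the forms of degree `k`. -/
noncomputable def gradedPiece (K : Type*) [Field K] (P : Finset Cell) (k : ℕ) :
    Submodule K (coordinateRing K P) :=
  (MvPolynomial.homogeneousSubmodule (vertices P) K k).map
    (Ideal.Quotient.mkₐ K (polyominoIdeal K P)).toLinearMap

/-- The Hilbert–Poincaré series of `K[P]`. -/
noncomputable def hilbertSeries (K : Type*) [Field K] (P : Finset Cell) : ℤ⟦X⟧ :=
  PowerSeries.mk fun k => (Module.finrank K (gradedPiece K P k) : ℤ)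

/-- `h` is the h-polynomial of `K[P]`: `h(1) ≠ 0` and the Hilbert–Poincaré series of `K[P]` is
`h(t) / (1 - t) ^ d`, where `d` is the Krull dimension of `K[P]`. -/
def IsHPolynomial (K : Type*) [Field K] (P : Finset Cell) (h : ℤ[X]) : Prop :=
  h.eval 1 ≠ 0 ∧ ∃ d : ℕ, ringKrullDim (coordinateRing K P) = d ∧
    (1 - PowerSeries.X) ^ d * hilbertSeries K P = (h : ℤ⟦X⟧)

/-- The h-polynomial is unique. -/
theorem IsHPolynomial.unique {K : Type*} [Field K] {P : Finset Cell} {h h' : ℤ[X]}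
    (H : IsHPolynomial K P h) (H' : IsHPolynomial K P h') : h = h' := by
  obtain ⟨-, d, hd, e⟩ := H
  obtain ⟨-, d', hd', e'⟩ := H'
  have hdd : d = d' := by
    have := hd.symm.trans hd'
    exact_mod_cast this
  subst hdd
  exact Polynomial.coe_injective ℤ (e.symm.trans e')

end Polyomino

namespace Polyomino

/-! ### Krull dimension and growth -/

/-! The polyomino ideal is generated by differences of two monomials, so $K[S]$ has a basis of
classes of monomials: two monomials are in one class when exchanges of diagonal for anti-diagonal
corners of inner intervals lead from one to the other (`Eqv`). The Hilbert function counts classes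
(`hilbertSeries_eq`), the field plays no role, and the work is combinatorial. Let
$r(S)=(1-t)^{|V(S)|-\mathrm{rank}\,S}\,\mathrm{HP}_{K[S]}(t)$ (`rookSeries`). The theorem is an
identity between such series, together with positivity at $t=1$.

The main tool is a Rees monoid (`IsRees`). Suppose that $S'$ arises from $S$ by adding cells with a
set $N$ of new vertices, and that each new variable $v$ behaves like $T$ times an old variable
$\omega(v)$. Then a class of $S'$ is a pair $(q,j)$, where $q$ is a class of $S$ lying in the $j$-th
power of the ideal $I$ generated by $\omega(N)$ (`IsRees.eqv_iff`). Hence cancellation passes from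
$S$ to $S'$, and exactly $\nu(q)+1$ classes lie over $q$, where $\nu$ is the order function of $I$
(`IsRees.coeff_monSeries`).

For a path of cells, $r(\text{path})=r(\text{path without its last cell})+t\,r(\text{path without
its last straight run})$ (`IsTail.rookSeries_eq`, `IsPath.step`). By induction $r$ is a polynomial
with positive value at $1$ (`IsPath.isGood`).

For the closed path, the hypotheses force a normal shape (`hasBend_normal`). $\mathcal B_2$ must be
left on the side away from $\mathcal B_1$, because $\mathcal B_3$ continues the ladder. At its far
end $\mathcal B_1$ turns and then goes on sideways, since there is no $L$-configuration; it turns to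
the side of $\mathcal B_2$, since otherwise the ladder could be prolonged backwards. So $\mathcal
B_1$, with $m$ cells, sits like a hat on the path $\mathcal K=\mathcal P\setminus\mathcal B_1$,
touching it at both ends. The order function of the hat is the sum of the order functions of its two
end cells and of the degrees in the free variables in between (`IsHat.inPower_iff`). As the count
$\nu+1$ is affine in $\nu$, this yields $r(\mathcal P)=r(\mathcal K\cup\text{left cell})+r(\mathcal
K\cup\text{right cell})-r(\mathcal K)+(m-2)\,t\,r(\mathcal K)$ (`IsHat.rookSeries_eq`). Everything
on the right is a path, and the path recursion at both ends turns this into the stated formula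
(`IsBend.rookSeries_eq`).

The Krull dimension is read off from the series: by Noether normalisation it is the degree of growth
of the degree filtration (`ringKrullDim_eq_natDegree`), which equals the exponent of $1-t$ once the
numerator does not vanish at $1$. -/

theorem ringKrullDim_eq_of_integral {R S : Type*} [CommRing R] [CommRing S] [Algebra R S]
    [Algebra.IsIntegral R S] (hinj : Function.Injective (algebraMap R S)) :
    ringKrullDim S = ringKrullDim R := by
  refine le_antisymm ?_ ?_
  · refine Order.krullDim_le_of_strictMono (PrimeSpectrum.comap (algebraMap R S)) ?_
    intro p q hpq
    exact Ideal.IsIntegral.comap_lt_comap (R := R) (I := p.asIdeal) (J := q.asIdeal) hpq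
  -- Going up: a chain of primes of `R` is lifted to one of the same length in `S`, one prime at a
  -- time.
  · have key : ∀ p : LTSeries (PrimeSpectrum R), ∃ q : LTSeries (PrimeSpectrum S),
        q.length = p.length ∧ PrimeSpectrum.comap (algebraMap R S) q.last = p.last := by
      intro p
      induction p using RelSeries.inductionOn' with
      | singleton x =>
        obtain ⟨Q, -, hQ, hQx⟩ := Ideal.exists_ideal_over_prime_of_isIntegral (S := S) x.asIdeal ⊥
          (by
            rw [← RingHom.ker_eq_comap_bot, (RingHom.injective_iff_ker_eq_bot _).1 hinj]
            exact bot_le)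
        exact ⟨RelSeries.singleton _ ⟨Q, hQ⟩, rfl, PrimeSpectrum.ext hQx⟩
      | snoc p x hx ih =>
        obtain ⟨q, hq, hl⟩ := ih
        have hx' : p.last < x := hx
        obtain ⟨Q, hle, hQ, hQx⟩ := Ideal.exists_ideal_over_prime_of_isIntegral (S := S) x.asIdeal
          q.last.asIdeal (by
            have : (PrimeSpectrum.comap (algebraMap R S) q.last).asIdeal ≤ x.asIdeal := by
              rw [hl]; exact hx'.le
            exact this)
        have hlt : q.last < (⟨Q, hQ⟩ : PrimeSpectrum S) := by
          refine lt_of_le_of_ne hle ?_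
          intro h
          rw [h] at hl
          have : PrimeSpectrum.comap (algebraMap R S) ⟨Q, hQ⟩ = x := PrimeSpectrum.ext hQx
          rw [this] at hl
          exact hx'.ne hl.symm
        refine ⟨q.snoc ⟨Q, hQ⟩ hlt, by simp [hq], ?_⟩
        rw [RelSeries.last_snoc, RelSeries.last_snoc]
        exact PrimeSpectrum.ext hQx
    refine iSup_le fun p => ?_
    obtain ⟨q, hq, -⟩ := key p
    rw [← hq]
    exact le_iSup (fun q : LTSeries (PrimeSpectrum S) => (q.length : WithBot ℕ∞)) q

/-! ### Growth of the degree filtration of an affine algebra -/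

section Growth

variable {K : Type*} [Field K]

instance restrictDegree_finite (d k : ℕ) :
    Module.Finite K (MvPolynomial.restrictDegree (Fin d) K k) := by
  have : Finite {n : Fin d →₀ ℕ | ∀ i, n i ≤ k} := by
    refine Set.Finite.subset (Set.finite_Iic (Finsupp.equivFunOnFinite.symm fun _ => k)) ?_
    intro n hn i
    simpa using hn i
  exact Module.Finite.of_basis (MvPolynomial.basisRestrictSupport K {n : Fin d →₀ ℕ | ∀ i, n i ≤ k})

theorem finrank_restrictDegree (d k : ℕ) :
    Module.finrank K (MvPolynomial.restrictDegree (Fin d) K k) = (k + 1) ^ d := by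
  have e : {n : Fin d →₀ ℕ | ∀ i, n i ≤ k} ≃ (Fin d → Fin (k + 1)) :=
    { toFun := fun n i => ⟨n.1 i, Nat.lt_succ_of_le (n.2 i)⟩
      invFun := fun f => ⟨Finsupp.equivFunOnFinite.symm fun i => (f i : ℕ),
        fun i => by simpa using Nat.le_of_lt_succ (f i).2⟩
      left_inv := fun n => by ext; simp
      right_inv := fun f => by ext; simp }
  rw [MvPolynomial.restrictDegree, Module.finrank_eq_nat_card_basis
    (MvPolynomial.basisRestrictSupport K {n : Fin d →₀ ℕ | ∀ i, n i ≤ k}), Nat.card_congr e]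
  simp

theorem restrictDegree_mono {d k l : ℕ} (h : k ≤ l) :
    MvPolynomial.restrictDegree (Fin d) K k ≤ MvPolynomial.restrictDegree (Fin d) K l := by
  intro p hp
  rw [MvPolynomial.mem_restrictDegree] at hp ⊢
  exact fun s hs i => (hp s hs i).trans h

theorem mul_mem_restrictDegree {d k l : ℕ} {p q : MvPolynomial (Fin d) K}
    (hp : p ∈ MvPolynomial.restrictDegree (Fin d) K k)
    (hq : q ∈ MvPolynomial.restrictDegree (Fin d) K l) :
    p * q ∈ MvPolynomial.restrictDegree (Fin d) K (k + l) := by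
  classical
  rw [MvPolynomial.mem_restrictDegree] at hp hq ⊢
  intro s hs i
  obtain ⟨a, ha, b, hb, rfl⟩ := Finset.mem_add.1 (MvPolynomial.support_mul p q hs)
  exact Nat.add_le_add (hp a ha i) (hq b hb i)

theorem exists_mem_restrictDegree {d : ℕ} (p : MvPolynomial (Fin d) K) :
    ∃ k, p ∈ MvPolynomial.restrictDegree (Fin d) K k := by
  refine ⟨p.totalDegree, ?_⟩
  rw [MvPolynomial.mem_restrictDegree]
  intro s hs i
  refine le_trans ?_ (MvPolynomial.le_totalDegree hs)
  by_cases h : s i = 0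
  · omega
  · exact Finset.single_le_sum (f := fun i => s i) (fun _ _ => Nat.zero_le _)
      (Finsupp.mem_support_iff.2 h)

variable {σ : Type*} {A : Type*} [CommRing A] [Algebra K A]

/-- The image of the polynomials of total degree at most `k`. -/
noncomputable def degreeFiltration (φ : MvPolynomial σ K →ₐ[K] A) (k : ℕ) : Submodule K A :=
  (MvPolynomial.restrictTotalDegree σ K k).map φ.toLinearMap

instance restrictTotalDegree_finite [Finite σ] (k : ℕ) :
    Module.Finite K (MvPolynomial.restrictTotalDegree σ K k) := by
  have : Finite {n : σ →₀ ℕ | (n.sum fun _ e => e) ≤ k} := by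
    refine Set.Finite.subset ((Set.Finite.pi (fun _ : σ => Set.finite_Iic k)).preimage
      (f := fun n : σ →₀ ℕ => (n : σ → ℕ)) DFunLike.coe_injective.injOn) ?_
    intro n hn i _
    have hn' : (n.sum fun _ e => e) ≤ k := hn
    refine le_trans (?_ : n i ≤ _) hn'
    by_cases h : n i = 0
    · simp [h]
    · exact Finset.single_le_sum (f := fun i => n i) (fun _ _ => Nat.zero_le _)
        (Finsupp.mem_support_iff.2 h)
  exact Module.Finite.of_basis
    (MvPolynomial.basisRestrictSupport K {n : σ →₀ ℕ | (n.sum fun _ e => e) ≤ k})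

instance degreeFiltration_finite [Finite σ] (φ : MvPolynomial σ K →ₐ[K] A) (k : ℕ) :
    Module.Finite K (degreeFiltration φ k) :=
  inferInstanceAs (Module.Finite K ((MvPolynomial.restrictTotalDegree σ K k).map φ.toLinearMap))

theorem mul_mem_degreeFiltration (φ : MvPolynomial σ K →ₐ[K] A) {k l : ℕ} {a b : A}
    (ha : a ∈ degreeFiltration φ k) (hb : b ∈ degreeFiltration φ l) :
    a * b ∈ degreeFiltration φ (k + l) := by
  obtain ⟨p, hp, rfl⟩ := ha
  obtain ⟨q, hq, rfl⟩ := hb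
  refine ⟨p * q, ?_, by simp⟩
  rw [SetLike.mem_coe, MvPolynomial.mem_restrictTotalDegree] at hp hq ⊢
  exact (MvPolynomial.totalDegree_mul p q).trans (Nat.add_le_add hp hq)

theorem degreeFiltration_mono (φ : MvPolynomial σ K →ₐ[K] A) {k l : ℕ} (h : k ≤ l) :
    degreeFiltration φ k ≤ degreeFiltration φ l := by
  rintro _ ⟨p, hp, rfl⟩
  refine ⟨p, ?_, rfl⟩
  rw [SetLike.mem_coe, MvPolynomial.mem_restrictTotalDegree] at hp ⊢
  exact hp.trans h

theorem pow_mem_degreeFiltration (φ : MvPolynomial σ K →ₐ[K] A) {m : ℕ} {a : A}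
    (ha : a ∈ degreeFiltration φ m) (e : ℕ) : a ^ e ∈ degreeFiltration φ (m * e) := by
  induction e with
  | zero => exact ⟨1, by simp [MvPolynomial.mem_restrictTotalDegree], by simp⟩
  | succ e ih =>
    rw [pow_succ, Nat.mul_succ]
    exact mul_mem_degreeFiltration φ ih ha

theorem exists_mem_degreeFiltration (φ : MvPolynomial σ K →ₐ[K] A)
    (hφ : Function.Surjective φ) (a : A) : ∃ m, a ∈ degreeFiltration φ m := by
  obtain ⟨p, rfl⟩ := hφ a
  exact ⟨p.totalDegree, p, by simp [MvPolynomial.mem_restrictTotalDegree], rfl⟩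

/-- If `g (X i)` has filtration degree `m i`, a monomial with all exponents at most `k` is sent into
degree `(∑ m i) * k`, and there are `(k + 1) ^ d` of them. -/
theorem growth_lower [Finite σ] (φ : MvPolynomial σ K →ₐ[K] A) (hφ : Function.Surjective φ) {d : ℕ}
    (g : MvPolynomial (Fin d) K →ₐ[K] A) (hg : Function.Injective g) :
    ∃ c, ∀ k, (k + 1) ^ d ≤ Module.finrank K (degreeFiltration φ (c * k)) := by
  choose m hm using fun i => exists_mem_degreeFiltration φ hφ (g (MvPolynomial.X i))
  refine ⟨∑ i, m i, fun k => ?_⟩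
  rw [← finrank_restrictDegree (K := K),
    (Submodule.equivMapOfInjective g.toLinearMap hg _).finrank_eq]
  refine Submodule.finrank_mono ?_
  rintro _ ⟨p, hp, rfl⟩
  rw [SetLike.mem_coe, MvPolynomial.mem_restrictDegree] at hp
  rw [MvPolynomial.as_sum p, map_sum]
  refine Submodule.sum_mem _ fun s hs => ?_
  have h1 : ∀ t : Finset (Fin d), ∏ i ∈ t, g (MvPolynomial.X i) ^ s i ∈
      degreeFiltration φ ((∑ i ∈ t, m i) * k) := by
    intro t
    induction t using Finset.induction_on with
    | empty => exact ⟨1, by simp [MvPolynomial.mem_restrictTotalDegree], by simp⟩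
    | insert i t hi ih =>
      rw [Finset.prod_insert hi, Finset.sum_insert hi, add_mul]
      exact mul_mem_degreeFiltration φ (degreeFiltration_mono φ
        (Nat.mul_le_mul_left _ (hp s hs i)) (pow_mem_degreeFiltration φ (hm i) _)) ih
  have h2 : g.toLinearMap (MvPolynomial.monomial s (MvPolynomial.coeff s p)) =
      MvPolynomial.coeff s p • ∏ i, g (MvPolynomial.X i) ^ s i := by
    rw [MvPolynomial.monomial_eq, Finsupp.prod_fintype _ _ (fun _ => pow_zero _)]
    simp [Algebra.smul_def]
  rw [h2]
  exact Submodule.smul_mem _ _ (h1 _)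

/-- The sums `∑ g (p j) * a j` with all exponents of `p j` at most `k`. -/
noncomputable def boxSpan {d N : ℕ} (g : MvPolynomial (Fin d) K →ₐ[K] A) (a : Fin N → A) (k : ℕ) :
    Submodule K A :=
  LinearMap.range (LinearMap.lsum K (fun _ : Fin N => MvPolynomial.restrictDegree (Fin d) K k) K
    fun j => (LinearMap.mulRight K (a j)).comp
      (g.toLinearMap.comp (MvPolynomial.restrictDegree (Fin d) K k).subtype))

theorem mem_boxSpan {d N : ℕ} {g : MvPolynomial (Fin d) K →ₐ[K] A} {a : Fin N → A} {k : ℕ}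
    {x : A} : x ∈ boxSpan g a k ↔ ∃ f : Fin N → MvPolynomial (Fin d) K,
      (∀ j, f j ∈ MvPolynomial.restrictDegree (Fin d) K k) ∧ ∑ j, g (f j) * a j = x := by
  constructor
  · rintro ⟨f, rfl⟩
    exact ⟨fun j => f j, fun j => (f j).2, by simp⟩
  · rintro ⟨f, hf, rfl⟩
    exact ⟨fun j => ⟨f j, hf j⟩, by simp⟩

theorem finrank_boxSpan_le {d N : ℕ} (g : MvPolynomial (Fin d) K →ₐ[K] A) (a : Fin N → A)
    (k : ℕ) : Module.finrank K (boxSpan g a k) ≤ N * (k + 1) ^ d := by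
  refine (LinearMap.finrank_range_le _).trans ?_
  rw [Module.finrank_pi_fintype]
  simp [finrank_restrictDegree]

instance boxSpan_finite {d N : ℕ} (g : MvPolynomial (Fin d) K →ₐ[K] A) (a : Fin N → A)
    (k : ℕ) : Module.Finite K (boxSpan g a k) := by
  unfold boxSpan
  infer_instance

theorem boxSpan_mono {d N : ℕ} (g : MvPolynomial (Fin d) K →ₐ[K] A) (a : Fin N → A)
    {k l : ℕ} (h : k ≤ l) : boxSpan g a k ≤ boxSpan g a l := by
  intro x hx
  rw [mem_boxSpan] at hx ⊢
  obtain ⟨f, hf, rfl⟩ := hx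
  exact ⟨f, fun j => restrictDegree_mono h (hf j), rfl⟩

/-- Multiplication by one variable enlarges the coefficients over a finite set of module generators
by a bounded box, so elements of degree `k` have coefficients in a box whose side is linear in `k`.
-/
theorem growth_upper [Finite σ] (φ : MvPolynomial σ K →ₐ[K] A) {d : ℕ}
    (g : MvPolynomial (Fin d) K →ₐ[K] A) (hg : g.Finite) :
    ∃ N c, ∀ k, Module.finrank K (degreeFiltration φ k) ≤ N * (c * (k + 1) + 1) ^ d := by
  let _ := g.toRingHom.toAlgebra
  have : Module.Finite (MvPolynomial (Fin d) K) A := hg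
  obtain ⟨N, a, ha⟩ := Module.Finite.exists_fin (R := MvPolynomial (Fin d) K) (M := A)
  have hex : ∀ x : A, ∃ k, x ∈ boxSpan g a k := by
    intro x
    have hx : x ∈ Submodule.span (MvPolynomial (Fin d) K) (Set.range a) := by
      rw [ha]; trivial
    obtain ⟨f, hf⟩ := (Submodule.mem_span_range_iff_exists_fun _).1 hx
    choose k hk using fun j => exists_mem_restrictDegree (f j)
    refine ⟨∑ j, k j, mem_boxSpan.2 ⟨f, fun j => restrictDegree_mono
      (Finset.single_le_sum (fun _ _ => Nat.zero_le _) (Finset.mem_univ j)) (hk j), ?_⟩⟩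
    rw [← hf]
    rfl
  choose m hm using hex
  have := Fintype.ofFinite σ
  -- `c` bounds the exponents needed to express `1` and all the products `φ (X i) * a j` through the
  -- generators `a`.
  set c := m 1 + ∑ i : σ, ∑ j, m (φ (MvPolynomial.X i) * a j) with hc
  have hc1 : (1 : A) ∈ boxSpan g a c := boxSpan_mono g a (Nat.le_add_right _ _) (hm 1)
  have hc2 : ∀ i j, φ (MvPolynomial.X i) * a j ∈ boxSpan g a c := by
    intro i j
    refine boxSpan_mono g a ?_ (hm _)
    refine le_trans ?_ (Nat.le_add_left _ _)
    refine le_trans ?_ (Finset.single_le_sum (fun _ _ => Nat.zero_le _) (Finset.mem_univ i))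
    exact Finset.single_le_sum (f := fun j => m (φ (MvPolynomial.X i) * a j))
      (fun _ _ => Nat.zero_le _) (Finset.mem_univ j)
  have hstep : ∀ i k x, x ∈ boxSpan g a k → φ (MvPolynomial.X i) * x ∈ boxSpan g a (k + c) := by
    intro i k x hx
    obtain ⟨f, hf, rfl⟩ := mem_boxSpan.1 hx
    rw [Finset.mul_sum]
    refine Submodule.sum_mem _ fun j _ => ?_
    obtain ⟨e, he, hej⟩ := mem_boxSpan.1 (hc2 i j)
    refine mem_boxSpan.2 ⟨fun l => f j * e l, fun l => mul_mem_restrictDegree (hf j) (he l), ?_⟩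
    rw [mul_left_comm, ← hej, Finset.mul_sum]
    simp [mul_assoc]
  have hmon : ∀ n : ℕ, ∀ s : σ →₀ ℕ, s.degree = n →
      φ (MvPolynomial.monomial s 1) ∈ boxSpan g a (c * (n + 1)) := by
    intro n
    induction n with
    | zero =>
      intro s hs
      rw [Finsupp.degree_eq_zero_iff] at hs
      subst hs
      simpa using hc1
    | succ n ih =>
      intro s hs
      have hs0 : s ≠ 0 := by rintro rfl; simp at hs
      obtain ⟨i, hi⟩ := Finsupp.support_nonempty_iff.2 hs0
      have hle : Finsupp.single i 1 ≤ s := by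
        rw [Finsupp.single_le_iff]
        exact Nat.one_le_iff_ne_zero.2 (Finsupp.mem_support_iff.1 hi)
      obtain ⟨t, rfl⟩ := exists_add_of_le hle
      have ht : t.degree = n := by
        rw [map_add, Finsupp.degree_single] at hs; omega
      have := hstep i _ _ (ih t ht)
      rw [← map_mul, MvPolynomial.X, MvPolynomial.monomial_mul, one_mul] at this
      rw [Nat.mul_succ]
      exact this
  refine ⟨N, c, fun k => ?_⟩
  refine le_trans (Submodule.finrank_mono ?_) (finrank_boxSpan_le g a (c * (k + 1)))
  rintro _ ⟨p, hp, rfl⟩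
  rw [SetLike.mem_coe, MvPolynomial.mem_restrictTotalDegree] at hp
  rw [MvPolynomial.as_sum p, map_sum]
  refine Submodule.sum_mem _ fun s hs => ?_
  have h2 : φ.toLinearMap (MvPolynomial.monomial s (MvPolynomial.coeff s p)) =
      MvPolynomial.coeff s p • φ (MvPolynomial.monomial s 1) := by
    rw [AlgHom.toLinearMap_apply, ← map_smul, MvPolynomial.smul_monomial, smul_eq_mul, mul_one]
  rw [h2]
  refine Submodule.smul_mem _ _ (boxSpan_mono g a ?_ (hmon _ s rfl))
  refine Nat.mul_le_mul_left _ (Nat.succ_le_succ (le_trans ?_ hp))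
  exact MvPolynomial.le_totalDegree hs

/-- The Krull dimension is the degree of the Hilbert polynomial of the degree filtration. -/
theorem ringKrullDim_eq_natDegree [Finite σ] [Nontrivial A] (φ : MvPolynomial σ K →ₐ[K] A)
    (hφ : Function.Surjective φ) (q : ℝ[X]) (n₀ : ℕ)
    (hq : ∀ k, n₀ ≤ k → (Module.finrank K (degreeFiltration φ k) : ℝ) = q.eval (k : ℝ)) :
    ringKrullDim A = (q.natDegree : ℕ) := by
  have : Algebra.FiniteType K A := Algebra.FiniteType.of_surjective φ hφ
  obtain ⟨d, g, hg, hgf⟩ := exists_finite_inj_algHom_of_fg K A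
  have hdim : ringKrullDim A = (d : ℕ) := by
    let _ := g.toRingHom.toAlgebra
    have : Module.Finite (MvPolynomial (Fin d) K) A := hgf
    rw [ringKrullDim_eq_of_integral (R := MvPolynomial (Fin d) K) (S := A) hg,
      MvPolynomial.ringKrullDim_of_isNoetherianRing, ringKrullDim_eq_zero_of_field]
    simp
  rw [hdim]
  obtain ⟨c, hc⟩ := growth_lower φ hφ g hg
  obtain ⟨N, C, hC⟩ := growth_upper φ g hgf
  have hcast : Filter.Tendsto (fun k : ℕ => (k : ℝ)) Filter.atTop Filter.atTop :=
    tendsto_natCast_atTop_atTop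
  -- If `q` had smaller degree than `d`, then `(k + 1) ^ d` would overtake `q ((c + 1) * k)`,
  -- against `growth_lower`. The factor is `c + 1` instead of `c` so that `(c + 1) * k ≥ k ≥ n₀`
  -- even when `c = 0`.
  have hle : d ≤ q.natDegree := by
    by_contra! hlt
    have h1 : ((Polynomial.X + 1 : ℝ[X]) ^ d).natDegree = d := by
      rw [Polynomial.natDegree_pow, ← Polynomial.C_1, Polynomial.natDegree_X_add_C, mul_one]
    have h2 : (q.comp (Polynomial.C ((c : ℝ) + 1) * Polynomial.X)).natDegree < d := by
      refine lt_of_le_of_lt Polynomial.natDegree_comp_le ?_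
      refine lt_of_le_of_lt (Nat.mul_le_mul_left _ ((Polynomial.natDegree_C_mul_le _ _).trans
        Polynomial.natDegree_X_le)) ?_
      omega
    have hmon : ((Polynomial.X + 1 : ℝ[X]) ^ d).Monic := by
      rw [← Polynomial.C_1]; exact (Polynomial.monic_X_add_C 1).pow d
    have h3 : (q.comp (Polynomial.C ((c : ℝ) + 1) * Polynomial.X)).degree <
        ((Polynomial.X + 1 : ℝ[X]) ^ d).degree :=
      Polynomial.degree_lt_degree (by rw [h1]; exact h2)
    have h4 := Polynomial.tendsto_atTop_of_leadingCoeff_nonneg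
      ((Polynomial.X + 1 : ℝ[X]) ^ d - q.comp (Polynomial.C ((c : ℝ) + 1) * Polynomial.X))
      (by
        rw [Polynomial.degree_sub_eq_left_of_degree_lt h3,
          Polynomial.degree_eq_natDegree hmon.ne_zero, h1]
        exact_mod_cast lt_of_le_of_lt (Nat.zero_le _) hlt)
      (by rw [Polynomial.leadingCoeff_sub_of_degree_lt h3, hmon.leadingCoeff]; exact zero_le_one)
    obtain ⟨k, hk, hk0⟩ := ((h4.comp hcast).eventually_gt_atTop 0 |>.and
      (Filter.eventually_ge_atTop n₀)).exists
    simp only [Function.comp, Polynomial.eval_sub, Polynomial.eval_pow, Polynomial.eval_add,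
      Polynomial.eval_X, Polynomial.eval_one, Polynomial.eval_comp, Polynomial.eval_mul,
      Polynomial.eval_C] at hk
    have h5 := hq ((c + 1) * k) (hk0.trans (Nat.le_mul_of_pos_left _ (Nat.succ_pos _)))
    have h6 : (k + 1) ^ d ≤ Module.finrank K (degreeFiltration φ ((c + 1) * k)) :=
      (hc k).trans (Submodule.finrank_mono (degreeFiltration_mono φ
        (Nat.mul_le_mul_right _ (Nat.le_succ c))))
    have h7 : ((k : ℝ) + 1) ^ d ≤ q.eval (((c : ℝ) + 1) * k) := by
      have : (((k + 1) ^ d : ℕ) : ℝ) ≤ q.eval ((((c + 1) * k : ℕ)) : ℝ) := by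
        rw [← h5]; exact_mod_cast h6
      simpa using this
    linarith
  -- Symmetrically, `q` would overtake the bound of `growth_upper`. Its leading coefficient is not
  -- negative because `q` takes dimensions as values.
  have hge : q.natDegree ≤ d := by
    by_contra! hlt
    have hq0 : q ≠ 0 := by rintro rfl; simp at hlt
    have hqd : 0 < q.degree := by
      rw [Polynomial.degree_eq_natDegree hq0]
      exact_mod_cast lt_of_le_of_lt (Nat.zero_le _) hlt
    have hlc : 0 ≤ q.leadingCoeff := by
      by_contra! hneg
      have h4 := Polynomial.tendsto_atTop_of_leadingCoeff_nonneg (-q)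
        (by rwa [Polynomial.degree_neg]) (by rw [Polynomial.leadingCoeff_neg]; linarith)
      obtain ⟨k, hk, hk0⟩ := ((h4.comp hcast).eventually_gt_atTop 0 |>.and
        (Filter.eventually_ge_atTop n₀)).exists
      have h5 := hq k hk0
      simp only [Function.comp, Polynomial.eval_neg] at hk
      have : (0 : ℝ) ≤ Module.finrank K (degreeFiltration φ k) := Nat.cast_nonneg _
      linarith
    set r : ℝ[X] := Polynomial.C (N : ℝ) *
      (Polynomial.C (C : ℝ) * Polynomial.X + Polynomial.C ((C : ℝ) + 1)) ^ d with hr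
    have h1 : r.natDegree ≤ d := by
      refine (Polynomial.natDegree_C_mul_le _ _).trans ?_
      refine Polynomial.natDegree_pow_le.trans ?_
      refine (Nat.mul_le_mul_left d (Polynomial.natDegree_linear_le)).trans ?_
      omega
    have h3 : r.degree < q.degree := Polynomial.degree_lt_degree (lt_of_le_of_lt h1 hlt)
    have h4 := Polynomial.tendsto_atTop_of_leadingCoeff_nonneg (q - r)
      (by rwa [Polynomial.degree_sub_eq_left_of_degree_lt h3])
      (by rwa [Polynomial.leadingCoeff_sub_of_degree_lt h3])
    obtain ⟨k, hk, hk0⟩ := ((h4.comp hcast).eventually_gt_atTop 0 |>.and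
      (Filter.eventually_ge_atTop n₀)).exists
    simp only [Function.comp, Polynomial.eval_sub] at hk
    have h5 := hq k hk0
    have h6 : (Module.finrank K (degreeFiltration φ k) : ℝ) ≤ r.eval (k : ℝ) := by
      have : (Module.finrank K (degreeFiltration φ k) : ℝ) ≤
          ((N * (C * (k + 1) + 1) ^ d : ℕ) : ℝ) := by exact_mod_cast hC k
      refine this.trans (le_of_eq ?_)
      simp only [hr, Polynomial.eval_mul, Polynomial.eval_pow, Polynomial.eval_add,
        Polynomial.eval_X, Polynomial.eval_C]
      push_cast
      ring
    linarith
  rw [le_antisymm hle hge]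

end Growth

end Polyomino

namespace Polyomino

/-! ### Counting classes -/

section Count

variable {α β : Type*}

/-- The number of classes met by `X`. -/
noncomputable def classCount (r : Setoid α) (X : Set α) : ℕ := (Quotient.mk r '' X).ncard

/-- The generating function of the classes met by `X`, graded by `d`. -/
noncomputable def classSeries (r : Setoid α) (d : α → ℕ) (X : Set α) : ℤ⟦X⟧ :=
  PowerSeries.mk fun k => (classCount r (X ∩ {x | d x = k}) : ℤ)

/-- `f` induces a bijection between the classes met by `X` and those met by `Y`; it has to reach
every class of `Y`, not every element. -/
theorem classCount_congr {r : Setoid α} {r' : Setoid β} {X : Set α} {Y : Set β} (f : α → β)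
    (hf : ∀ x ∈ X, f x ∈ Y) (hr : ∀ x ∈ X, ∀ y ∈ X, r x y ↔ r' (f x) (f y))
    (hs : ∀ y ∈ Y, ∃ x ∈ X, r' (f x) y) : classCount r X = classCount r' Y := by
  unfold classCount
  have hrel : ∀ q ∈ Quotient.mk r '' X, ∃ x ∈ X, Quotient.mk r x = q := fun q hq => hq
  have hrel' : ∀ q : Quotient r, ∃ x : α, q ∈ Quotient.mk r '' X → x ∈ X ∧ Quotient.mk r x = q := by
    intro q
    by_cases hq : q ∈ Quotient.mk r '' X
    · obtain ⟨x, hx⟩ := hrel q hq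
      exact ⟨x, fun _ => hx⟩
    · exact ⟨q.out, fun h => absurd h hq⟩
  choose g hg0 using hrel'
  have hgX := fun q hq => (hg0 q hq).1
  have hg := fun q hq => (hg0 q hq).2
  refine Set.ncard_congr (fun q _ => Quotient.mk r' (f (g q))) ?_ ?_ ?_
  · intro q hq
    exact ⟨_, hf _ (hgX q hq), rfl⟩
  · intro q q' hq hq' h
    have := (hr _ (hgX q hq) _ (hgX q' hq')).2 (Quotient.exact h)
    rw [← hg q hq, ← hg q' hq']
    exact Quotient.sound this
  · rintro _ ⟨y, hy, rfl⟩
    obtain ⟨x, hx, hxy⟩ := hs y hy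
    have hq : Quotient.mk r x ∈ Quotient.mk r '' X := ⟨x, hx, rfl⟩
    refine ⟨_, hq, Quotient.sound ?_⟩
    have h1 := (hr _ (hgX _ hq) _ hx).1 (Quotient.exact (hg _ hq))
    exact r'.trans' h1 hxy

theorem classCount_union {r : Setoid α} {X Y : Set α} (hX : X.Finite) (hY : Y.Finite)
    (h : ∀ x ∈ X, ∀ y ∈ Y, ¬ r x y) : classCount r (X ∪ Y) = classCount r X + classCount r Y := by
  unfold classCount
  rw [Set.image_union, Set.ncard_union_eq ?_ (hX.image _) (hY.image _)]
  rw [Set.disjoint_left]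
  rintro _ ⟨x, hx, rfl⟩ ⟨y, hy, hxy⟩
  exact h x hx y hy (Quotient.exact hxy.symm)

/-- The graded form. In the applications `f` multiplies by a variable (`s = 1`) or is an inclusion
or a symmetry (`s = 0`). The last condition mentions the degree because `r'` is not assumed to
preserve it. -/
theorem classSeries_congr {r : Setoid α} {r' : Setoid β} {d : α → ℕ} {d' : β → ℕ} {X : Set α}
    {Y : Set β} (f : α → β) (s : ℕ) (hd : ∀ x ∈ X, d' (f x) = d x + s) (hf : ∀ x ∈ X, f x ∈ Y)
    (hr : ∀ x ∈ X, ∀ y ∈ X, r x y ↔ r' (f x) (f y))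
    (hs : ∀ y ∈ Y, ∃ x ∈ X, r' (f x) y ∧ d' (f x) = d' y) :
    classSeries r' d' Y = PowerSeries.X ^ s * classSeries r d X := by
  ext k
  rw [PowerSeries.coeff_X_pow_mul', classSeries, classSeries, PowerSeries.coeff_mk,
    PowerSeries.coeff_mk]
  split_ifs with hk
  · congr 1
    symm
    refine classCount_congr f ?_ ?_ ?_
    · rintro x ⟨hx, hxk⟩
      refine ⟨hf x hx, ?_⟩
      simp only [Set.mem_ofPred_eq] at hxk ⊢
      rw [hd x hx]; omega
    · exact fun x hx y hy => hr x hx.1 y hy.1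
    · rintro y ⟨hy, hyk⟩
      obtain ⟨x, hx, hxy, hxd⟩ := hs y hy
      refine ⟨x, ⟨hx, ?_⟩, hxy⟩
      simp only [Set.mem_ofPred_eq] at hyk ⊢
      rw [hd x hx] at hxd; omega
  · have : Y ∩ {x | d' x = k} = ∅ := by
      rw [Set.eq_empty_iff_forall_notMem]
      rintro y ⟨hy, hyk⟩
      obtain ⟨x, hx, -, hxd⟩ := hs y hy
      simp only [Set.mem_ofPred_eq] at hyk
      rw [hd x hx] at hxd; omega
    rw [this]
    simp [classCount]

theorem classSeries_union {r : Setoid α} {d : α → ℕ} {X Y : Set α}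
    (hX : ∀ k, (X ∩ {x | d x = k}).Finite) (hY : ∀ k, (Y ∩ {x | d x = k}).Finite)
    (h : ∀ x ∈ X, ∀ y ∈ Y, ¬ r x y) :
    classSeries r d (X ∪ Y) = classSeries r d X + classSeries r d Y := by
  ext k
  simp only [classSeries, map_add, PowerSeries.coeff_mk]
  rw [Set.union_inter_distrib_right, classCount_union (hX k) (hY k)
    fun x hx y hy => h x hx.1 y hy.1]
  push_cast
  rfl

/-- Allows classes to be counted on a set of normal forms. -/
theorem classSeries_eq_of_cover {r : Setoid α} {d : α → ℕ} {X Y : Set α} (hYX : Y ⊆ X)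
    (h : ∀ x ∈ X, ∃ y ∈ Y, r y x ∧ d y = d x) : classSeries r d X = classSeries r d Y := by
  have := classSeries_congr (r := r) (r' := r) (d := d) (d' := d) (X := Y) (Y := X) id 0
    (fun _ _ => rfl) (fun x hx => hYX hx) (fun _ _ _ _ => Iff.rfl) h
  rwa [pow_zero, one_mul] at this

end Count

/-! ### Monomials and the moves given by the inner intervals -/

/-- Monomials, as multisets of lattice points. -/
abbrev Mon : Type := Multiset (ℤ × ℤ)

/-- The monomials supported on `U`. -/
def monOn (U : Finset (ℤ × ℤ)) : Set Mon := {x | ∀ v ∈ x, v ∈ U}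

/-- `y` arises from `x` by exchanging diagonal for anti-diagonal corners of an inner interval. -/
def Move (S : Finset Cell) (x y : Mon) : Prop :=
  ∃ a b z, IsInnerInterval S a b ∧ x = a ::ₘ b ::ₘ z ∧ y = (a.1, b.2) ::ₘ (b.1, a.2) ::ₘ z

/-- The congruence generated by the moves. -/
def Eqv (S : Finset Cell) : Mon → Mon → Prop :=
  Relation.ReflTransGen fun x y => Move S x y ∨ Move S y x

variable {S S' : Finset Cell} {x y z : Mon}

theorem Eqv.refl (S : Finset Cell) (x : Mon) : Eqv S x x := Relation.ReflTransGen.refl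

theorem Eqv.symm (h : Eqv S x y) : Eqv S y x := by
  induction h with
  | refl => exact Eqv.refl S x
  | tail _ h ih => exact Relation.ReflTransGen.head h.symm ih

theorem Eqv.trans (h : Eqv S x y) (h' : Eqv S y z) : Eqv S x z := Relation.ReflTransGen.trans h h'

theorem Move.add (h : Move S x y) (z : Mon) : Move S (x + z) (y + z) := by
  obtain ⟨a, b, w, hab, rfl, rfl⟩ := h
  exact ⟨a, b, w + z, hab, by simp, by simp⟩

theorem Eqv.add_right (h : Eqv S x y) (z : Mon) : Eqv S (x + z) (y + z) := by
  induction h with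
  | refl => exact Eqv.refl S _
  | tail _ h ih => exact ih.tail (h.imp (fun h => h.add z) fun h => h.add z)

theorem Eqv.add_left (h : Eqv S x y) (z : Mon) : Eqv S (z + x) (z + y) := by
  rw [add_comm z, add_comm z]
  exact h.add_right z

theorem Eqv.cons (h : Eqv S x y) (v : ℤ × ℤ) : Eqv S (v ::ₘ x) (v ::ₘ y) := by
  rw [← Multiset.singleton_add, ← Multiset.singleton_add]
  exact h.add_left _

theorem IsInnerInterval.mono (hS : S ⊆ S') {a b : ℤ × ℤ} (h : IsInnerInterval S a b) :
    IsInnerInterval S' a b := ⟨h.1, h.2.1, h.2.2.trans hS⟩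

theorem Move.mono (hS : S ⊆ S') (h : Move S x y) : Move S' x y := by
  obtain ⟨a, b, z, hab, hx, hy⟩ := h
  exact ⟨a, b, z, hab.mono hS, hx, hy⟩

theorem Eqv.mono (hS : S ⊆ S') (h : Eqv S x y) : Eqv S' x y := by
  induction h with
  | refl => exact Eqv.refl _ _
  | tail _ h ih => exact ih.tail (h.imp (Move.mono hS) (Move.mono hS))

theorem Eqv.of_interval {a b : ℤ × ℤ} (h : IsInnerInterval S a b) (z : Mon) :
    Eqv S (a ::ₘ b ::ₘ z) ((a.1, b.2) ::ₘ (b.1, a.2) ::ₘ z) :=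
  Relation.ReflTransGen.single (Or.inl ⟨a, b, z, h, rfl, rfl⟩)

/-- The congruence as a setoid. -/
def eqvSetoid (S : Finset Cell) : Setoid Mon where
  r := Eqv S
  iseqv := ⟨Eqv.refl S, Eqv.symm, Eqv.trans⟩

theorem Move.card_eq (h : Move S x y) : x.card = y.card := by
  obtain ⟨a, b, z, -, rfl, rfl⟩ := h
  simp

/-- Functions that every move preserves are invariants of the classes. -/
theorem Eqv.invariant {γ : Type*} (f : Mon → γ) (hf : ∀ x y, Move S x y → f x = f y)
    (h : Eqv S x y) : f x = f y := by
  induction h with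
  | refl => rfl
  | tail _ h ih => exact ih.trans (h.elim (hf _ _) fun h => (hf _ _ h).symm)

theorem Eqv.card_eq (h : Eqv S x y) : x.card = y.card :=
  h.invariant _ fun _ _ => Move.card_eq

theorem corner_mem_vertices {a b : ℤ × ℤ} (h : IsInnerInterval S a b) :
    a ∈ vertices S ∧ b ∈ vertices S ∧ (a.1, b.2) ∈ vertices S ∧ (b.1, a.2) ∈ vertices S := by
  obtain ⟨h1, h2, h3⟩ := h
  have key : ∀ c : Cell, a.1 ≤ c.1 → a.2 ≤ c.2 → c.1 < b.1 → c.2 < b.2 → c ∈ S := by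
    intro c h4 h5 h6 h7
    refine h3 (Finset.mem_Icc.2 ⟨⟨h4, h5⟩, ⟨?_, ?_⟩⟩)
    · simp only [Prod.fst_sub]; omega
    · simp only [Prod.snd_sub]; omega
  simp only [vertices, Finset.mem_biUnion, cellVertices]
  refine ⟨⟨a, key a le_rfl le_rfl h1 h2, by simp⟩,
    ⟨(b.1 - 1, b.2 - 1), key _ ?_ ?_ ?_ ?_, by simp⟩,
    ⟨(a.1, b.2 - 1), key _ ?_ ?_ ?_ ?_, by simp⟩,
    ⟨(b.1 - 1, a.2), key _ ?_ ?_ ?_ ?_, by simp⟩⟩ <;> simp only <;> omega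

theorem Eqv.mem_monOn {U : Finset (ℤ × ℤ)} (hU : vertices S ⊆ U) (h : Eqv S x y) :
    x ∈ monOn U ↔ y ∈ monOn U := by
  have := h.invariant (fun x => x ∈ monOn U) (by
    rintro x y ⟨a, b, z, hab, rfl, rfl⟩
    obtain ⟨h1, h2, h3, h4⟩ := corner_mem_vertices hab
    have e1 := hU h1
    have e2 := hU h2
    have e3 := hU h3
    have e4 := hU h4
    simp only [monOn, Set.mem_ofPred_eq, Multiset.forall_mem_cons, e1, e2, e3, e4, true_and])
  rw [this]

theorem finite_monOn (U : Finset (ℤ × ℤ)) (k : ℕ) : (monOn U ∩ {x | x.card = k}).Finite := by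
  refine Set.Finite.subset (Set.finite_Iic (k • U.val)) ?_
  rintro x ⟨hx, hk⟩
  simp only [Set.mem_ofPred_eq] at hk
  rw [Set.mem_Iic, Multiset.le_iff_count]
  intro v
  by_cases hv : v ∈ x
  · have h1 : Multiset.count v U.val = 1 := Multiset.count_eq_one_of_mem U.nodup (hx v hv)
    rw [Multiset.count_nsmul, h1, mul_one, ← hk]
    exact Multiset.count_le_card v x
  · rw [Multiset.count_eq_zero_of_notMem hv]; exact Nat.zero_le _

/-- The generating function of the classes of monomials supported on `U`. -/
noncomputable def monSeries (S : Finset Cell) (U : Finset (ℤ × ℤ)) : ℤ⟦X⟧ :=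
  classSeries (eqvSetoid S) Multiset.card (monOn U)

/-! ### The coordinate ring has a basis of classes of monomials -/

section Ring

variable (K : Type*) [Field K] (P : Finset Cell)

/-- The exponent vector of a monomial as a multiset of lattice points. -/
noncomputable def expMon (s : vertices P →₀ ℕ) : Mon :=
  (Finsupp.toMultiset s).map Subtype.val

theorem expMon_add (s t : vertices P →₀ ℕ) : expMon P (s + t) = expMon P s + expMon P t := by
  simp [expMon]

theorem expMon_single (v : vertices P) : expMon P (Finsupp.single v 1) = {v.1} := by
  simp [expMon]

theorem expMon_mem (s : vertices P →₀ ℕ) : expMon P s ∈ monOn (vertices P) := by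
  intro v hv
  obtain ⟨w, -, rfl⟩ := Multiset.mem_map.1 hv
  exact w.2

theorem exists_expMon {x : Mon} (hx : x ∈ monOn (vertices P)) : ∃ s, expMon P s = x := by
  refine ⟨Multiset.toFinsupp (x.attach.map fun v => ⟨v.1, hx v.1 v.2⟩), ?_⟩
  rw [expMon, Multiset.toFinsupp_toMultiset, Multiset.map_map]
  simp

theorem card_expMon (s : vertices P →₀ ℕ) : (expMon P s).card = s.degree := by
  rw [expMon, Multiset.card_map, Finsupp.card_toMultiset]
  rfl

/-- Each monomial goes to its class. -/
noncomputable def classMap :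
    vertexRing K P →ₗ[K] (Quotient (eqvSetoid P) →₀ K) :=
  (MvPolynomial.basisMonomials (vertices P) K).constr K fun s =>
    Finsupp.single (Quotient.mk (eqvSetoid P) (expMon P s)) 1

theorem classMap_monomial (s : vertices P →₀ ℕ) :
    classMap K P (MvPolynomial.monomial s 1) =
      Finsupp.single (Quotient.mk (eqvSetoid P) (expMon P s)) 1 := by
  have : MvPolynomial.monomial s (1 : K) = MvPolynomial.basisMonomials (vertices P) K s := by
    simp
  rw [this, classMap, Module.Basis.constr_basis]

/-- Lets `classMap` descend to `K[P]`, which is what makes monomials from distinct classes linearly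
independent there. -/
theorem classMap_eq_zero {f : vertexRing K P} (hf : f ∈ polyominoIdeal K P) :
    classMap K P f = 0 := by
  suffices h : ∀ p : vertexRing K P, classMap K P (p * f) = 0 by simpa using h 1
  induction hf using Submodule.span_induction with
  | zero => simp
  | add f g _ _ hf hg => intro p; rw [mul_add, map_add, hf, hg, add_zero]
  | smul q f _ hf => intro p; rw [smul_eq_mul, ← mul_assoc]; exact hf _
  | mem f hf =>
    obtain ⟨a, b, c, d, hab, hc, hd, rfl⟩ := hf
    -- By linearity the multiplier `p` may be taken to be a monomial; its product with the generator
    -- is then a difference of two monomials joined by a move.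
    suffices h : (classMap K P).comp (LinearMap.mulRight K (MvPolynomial.X a * MvPolynomial.X b -
        MvPolynomial.X c * MvPolynomial.X d)) = 0 by
      intro p
      exact LinearMap.congr_fun h p
    refine (MvPolynomial.basisMonomials (vertices P) K).ext fun s => ?_
    rw [MvPolynomial.coe_basisMonomials, LinearMap.comp_apply, LinearMap.mulRight_apply, mul_sub,
      map_sub, MvPolynomial.X, MvPolynomial.X, MvPolynomial.X, MvPolynomial.X,
      MvPolynomial.monomial_mul, MvPolynomial.monomial_mul, MvPolynomial.monomial_mul,
      MvPolynomial.monomial_mul, mul_one, mul_one, classMap_monomial, classMap_monomial,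
      LinearMap.zero_apply, sub_eq_zero]
    congr 1
    refine Quotient.sound (?_ : Eqv P _ _)
    simp only [expMon_add, expMon_single]
    refine Eqv.add_left ?_ _
    have := Eqv.of_interval hab 0
    rw [hc, hd]
    exact this

theorem monomial_sub_monomial {σ : Type*} (u : σ →₀ ℕ) (a b c d : σ) :
    MvPolynomial.monomial (u + (Finsupp.single a 1 + Finsupp.single b 1)) (1 : K) -
      MvPolynomial.monomial (u + (Finsupp.single c 1 + Finsupp.single d 1)) 1 =
      MvPolynomial.monomial u 1 * (MvPolynomial.X a * MvPolynomial.X b -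
        MvPolynomial.X c * MvPolynomial.X d) := by
  simp only [mul_sub, MvPolynomial.X, MvPolynomial.monomial_mul, mul_one]

/-- Each move is a monomial multiple of a generator of the ideal. A chain of moves never leaves the
monomials supported on `vertices P`, so all its members come from exponent vectors. -/
theorem mk_eq_of_eqv {s t : vertices P →₀ ℕ} (h : Eqv P (expMon P s) (expMon P t)) :
    Ideal.Quotient.mk (polyominoIdeal K P) (MvPolynomial.monomial s 1) =
      Ideal.Quotient.mk (polyominoIdeal K P) (MvPolynomial.monomial t 1) := by
  have hinj : ∀ s t, expMon P s = expMon P t → s = t := by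
    intro s t h
    exact Finsupp.orderIsoMultiset.injective (Multiset.map_injective Subtype.val_injective h)
  have hmove : ∀ s t, Move P (expMon P s) (expMon P t) →
      Ideal.Quotient.mk (polyominoIdeal K P) (MvPolynomial.monomial s 1) =
      Ideal.Quotient.mk (polyominoIdeal K P) (MvPolynomial.monomial t 1) := by
    rintro s t ⟨a, b, z, hab, hs, ht⟩
    obtain ⟨ha, hb, hc, hd⟩ := corner_mem_vertices hab
    have hz : z ∈ monOn (vertices P) := by
      intro v hv
      refine expMon_mem P s v ?_
      rw [hs]; simp [hv]
    obtain ⟨u, rfl⟩ := exists_expMon P hz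
    have h1 : s = u + (Finsupp.single ⟨a, ha⟩ 1 + Finsupp.single ⟨b, hb⟩ 1) := by
      apply hinj
      rw [hs, expMon_add, expMon_add, expMon_single, expMon_single, add_comm]
      simp
    have h2 : t = u + (Finsupp.single ⟨_, hc⟩ 1 + Finsupp.single ⟨_, hd⟩ 1) := by
      apply hinj
      rw [ht, expMon_add, expMon_add, expMon_single, expMon_single, add_comm]
      simp
    rw [Ideal.Quotient.eq]
    subst h1 h2
    rw [monomial_sub_monomial]
    exact Ideal.mul_mem_left _ _ (Ideal.subset_span
      ⟨⟨a, ha⟩, ⟨b, hb⟩, ⟨_, hc⟩, ⟨_, hd⟩, hab, rfl, rfl, rfl⟩)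
  generalize hx : expMon P s = x at h
  generalize hy : expMon P t = y at h
  induction h generalizing t with
  | refl => rw [hinj s t (hx.trans hy.symm)]
  | @tail w y _ hwy ih =>
    have hw : w ∈ monOn (vertices P) := by
      have : Eqv P w y := Relation.ReflTransGen.single hwy
      rw [this.mem_monOn subset_rfl, ← hy]
      exact expMon_mem P t
    obtain ⟨u, hu⟩ := exists_expMon P hw
    rw [ih hu]
    subst hu hy
    exact hwy.elim (hmove _ _) fun h => (hmove _ _ h).symm

/-- One monomial from each class gives a basis: it spans by `mk_eq_of_eqv` and is independent by
`classMap`. The set `T` of exponents is arbitrary in order to cover both the graded pieces and the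
degree filtration. -/
theorem finrank_map_restrictSupport (T : Set (vertices P →₀ ℕ)) :
    Module.finrank K ((MvPolynomial.restrictSupport K T).map
      (Ideal.Quotient.mkₐ K (polyominoIdeal K P)).toLinearMap) =
      classCount (eqvSetoid P) (expMon P '' T) := by
  set Q := Quotient.mk (eqvSetoid P) '' (expMon P '' T) with hQ
  have hrel : ∀ q : Q, ∃ s ∈ T, Quotient.mk (eqvSetoid P) (expMon P s) = q := by
    rintro ⟨_, _, ⟨s, hs, rfl⟩, rfl⟩
    exact ⟨s, hs, rfl⟩
  choose g hgT hg using hrel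
  set b : Q → coordinateRing K P := fun q =>
    Ideal.Quotient.mk (polyominoIdeal K P) (MvPolynomial.monomial (g q) 1) with hb
  have hli : LinearIndependent K b := by
    rw [linearIndependent_iff']
    intro t c hsum q hq
    have h1 : ∑ q ∈ t, c q • MvPolynomial.monomial (g q) (1 : K) ∈ polyominoIdeal K P := by
      rw [← Ideal.Quotient.eq_zero_iff_mem, ← hsum, map_sum]
      rfl
    have h2 := classMap_eq_zero K P h1
    rw [map_sum] at h2
    simp only [map_smul, classMap_monomial, hg] at h2
    have h3 := DFunLike.congr_fun h2 q.1
    rw [Finsupp.finsetSum_apply, Finset.sum_eq_single q] at h3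
    · simpa using h3
    · intro q' _ hne
      have : q'.1 ≠ q.1 := fun h => hne (Subtype.ext h)
      simp [this]
    · exact fun h => absurd hq h
  have hspan : (MvPolynomial.restrictSupport K T).map
      (Ideal.Quotient.mkₐ K (polyominoIdeal K P)).toLinearMap =
      Submodule.span K (Set.range b) := by
    apply le_antisymm
    · rintro _ ⟨p, hp, rfl⟩
      rw [MvPolynomial.as_sum p, map_sum]
      refine Submodule.sum_mem _ fun s hs => ?_
      have hsT : s ∈ T := hp hs
      have h1 : (Ideal.Quotient.mkₐ K (polyominoIdeal K P)).toLinearMap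
          (MvPolynomial.monomial s (MvPolynomial.coeff s p)) = MvPolynomial.coeff s p •
          Ideal.Quotient.mk (polyominoIdeal K P) (MvPolynomial.monomial s 1) := by
        rw [← mul_one (MvPolynomial.coeff s p), ← smul_eq_mul, ← MvPolynomial.smul_monomial,
          map_smul, smul_eq_mul, mul_one]
        rfl
      rw [h1]
      refine Submodule.smul_mem _ _ ?_
      have hq : Quotient.mk (eqvSetoid P) (expMon P s) ∈ Q := ⟨_, ⟨s, hsT, rfl⟩, rfl⟩
      rw [mk_eq_of_eqv K P (t := g ⟨_, hq⟩) (Quotient.exact (hg ⟨_, hq⟩).symm)]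
      exact Submodule.subset_span ⟨⟨_, hq⟩, rfl⟩
    · rw [Submodule.span_le]
      rintro _ ⟨q, rfl⟩
      refine ⟨MvPolynomial.monomial (g q) 1, ?_, rfl⟩
      intro s hs
      have : s = g q := by
        by_contra hne
        have h' := hs
        rw [Finset.mem_coe, Finsupp.mem_support_iff] at h'
        exact h' (by
          change MvPolynomial.coeff s (MvPolynomial.monomial (g q) (1 : K)) = 0
          rw [MvPolynomial.coeff_monomial, if_neg (Ne.symm hne)])
      rw [this]; exact hgT q
  rw [hspan, classCount, ← Nat.card_coe_set_eq]
  exact Module.finrank_eq_nat_card_basis (Module.Basis.span hli)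

theorem image_expMon (p : ℕ → Prop) :
    expMon P '' {s | p s.degree} = monOn (vertices P) ∩ {x | p x.card} := by
  ext x
  constructor
  · rintro ⟨s, hs, rfl⟩
    exact ⟨expMon_mem P s, by rw [Set.mem_ofPred_eq, card_expMon]; exact hs⟩
  · rintro ⟨hx, hp⟩
    obtain ⟨s, rfl⟩ := exists_expMon P hx
    rw [Set.mem_ofPred_eq, card_expMon] at hp
    exact ⟨s, hp, rfl⟩

theorem hilbertSeries_eq : hilbertSeries K P = monSeries P (vertices P) := by
  ext k
  rw [hilbertSeries, monSeries, classSeries, PowerSeries.coeff_mk, PowerSeries.coeff_mk,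
    gradedPiece]
  have : MvPolynomial.homogeneousSubmodule (vertices P) K k =
      MvPolynomial.restrictSupport K {s | s.degree = k} :=
    MvPolynomial.homogeneousSubmodule_eq_finsupp_supported _ _ _
  rw [this, finrank_map_restrictSupport, image_expMon P (fun n => n = k)]

/-- Moves preserve the degree, so the classes of degree at most `k` are sorted by their exact
degrees. -/
theorem finrank_degreeFiltration (k : ℕ) :
    (Module.finrank K (degreeFiltration (Ideal.Quotient.mkₐ K (polyominoIdeal K P)) k) : ℤ) =
      ∑ i ∈ Finset.range (k + 1), (hilbertSeries K P).coeff i := by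
  have h1 : MvPolynomial.restrictTotalDegree (vertices P) K k =
      MvPolynomial.restrictSupport K {s | s.degree ≤ k} := rfl
  rw [degreeFiltration, h1, finrank_map_restrictSupport, image_expMon P (fun n => n ≤ k),
    hilbertSeries_eq]
  induction k with
  | zero => simp [monSeries, classSeries]
  | succ k ih =>
    rw [Finset.sum_range_succ, ← ih rfl]
    have h2 : monOn (vertices P) ∩ {x | x.card ≤ k + 1} =
        (monOn (vertices P) ∩ {x | x.card ≤ k}) ∪ (monOn (vertices P) ∩ {x | x.card = k + 1}) := by
      ext x
      simp only [Set.mem_inter_iff, Set.mem_ofPred_eq, Set.mem_union]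
      rw [Nat.le_succ_iff]
      tauto
    rw [h2, classCount_union]
    · simp [monSeries, classSeries]
    · have : monOn (vertices P) ∩ {x | x.card ≤ k} =
          ⋃ i ∈ Finset.range (k + 1), (monOn (vertices P) ∩ {x | x.card = i}) := by
        ext x; simp
      rw [this]
      exact Set.Finite.biUnion (Finset.finite_toSet _) fun i _ => finite_monOn _ i
    · exact finite_monOn _ _
    · rintro x ⟨-, hx⟩ y ⟨-, hy⟩ hxy
      have := Eqv.card_eq (S := P) hxy
      simp only [Set.mem_ofPred_eq] at hx hy
      omega

/-- The dimensions of the degree filtration are the partial sums of the Hilbert series, with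
generating function `h / (1 - t) ^ (D + 1)`. As `h(1) ≠ 0` nothing cancels, and their Hilbert
polynomial has degree exactly `D`. -/
theorem ringKrullDim_eq_of_hilbertSeries {D : ℕ} {h : ℤ[X]} (hh : h.eval 1 ≠ 0)
    (hH : (1 - PowerSeries.X) ^ D * hilbertSeries K P = (h : ℤ⟦X⟧)) :
    ringKrullDim (coordinateRing K P) = (D : ℕ) := by
  set hR : ℝ[X] := h.map (Int.castRingHom ℝ) with hhR
  have hne : hR.eval 1 ≠ 0 := by
    rw [hhR, Polynomial.eval_one_map]
    simpa using hh
  have hroot : hR.rootMultiplicity 1 = 0 := Polynomial.rootMultiplicity_eq_zero hne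
  have hR0 : hR ≠ 0 := by intro h0; rw [h0] at hne; simp at hne
  have hdeg : (Polynomial.hilbertPoly hR (D + 1)).natDegree = D := by
    rw [Polynomial.natDegree_hilbertPoly_of_ne_zero_of_rootMultiplicity_lt hR0 (by omega), hroot]
    omega
  -- `PowerSeries.mk 1` is `1 / (1 - t)`; multiplying by it forms partial sums.
  have hser : PowerSeries.map (Int.castRingHom ℝ) (hilbertSeries K P) * PowerSeries.mk 1 =
      (hR : ℝ⟦X⟧) * (PowerSeries.invOneSubPow ℝ (D + 1)).val := by
    have h1 : (1 - PowerSeries.X) ^ D * PowerSeries.map (Int.castRingHom ℝ) (hilbertSeries K P) =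
        (hR : ℝ⟦X⟧) := by
      have := congrArg (PowerSeries.map (Int.castRingHom ℝ)) hH
      rw [map_mul, map_pow, map_sub, map_one, PowerSeries.map_X] at this
      rw [this, hhR, Polynomial.polynomial_map_coe]
    have h2 : (PowerSeries.invOneSubPow ℝ (D + 1)).val * (1 - PowerSeries.X) ^ (D + 1) = 1 := by
      rw [← PowerSeries.invOneSubPow_inv_eq_one_sub_pow]
      exact (PowerSeries.invOneSubPow ℝ (D + 1)).val_inv
    have h3 : (PowerSeries.mk 1 : ℝ⟦X⟧) * (1 - PowerSeries.X) = 1 :=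
      PowerSeries.mk_one_mul_one_sub_eq_one ℝ
    rw [← h1]
    calc _ = PowerSeries.map (Int.castRingHom ℝ) (hilbertSeries K P) * PowerSeries.mk 1 *
          ((PowerSeries.invOneSubPow ℝ (D + 1)).val * (1 - PowerSeries.X) ^ (D + 1)) := by
            rw [h2, mul_one]
      _ = (PowerSeries.mk 1 * (1 - PowerSeries.X)) * ((1 - PowerSeries.X) ^ D *
          PowerSeries.map (Int.castRingHom ℝ) (hilbertSeries K P) *
          (PowerSeries.invOneSubPow ℝ (D + 1)).val) := by ring
      _ = _ := by rw [h3, one_mul]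
  have hq : ∀ k, hR.natDegree + 1 ≤ k → (Module.finrank K
      (degreeFiltration (Ideal.Quotient.mkₐ K (polyominoIdeal K P)) k) : ℝ) =
      (Polynomial.hilbertPoly hR (D + 1)).eval (k : ℝ) := by
    intro k hk
    rw [← Polynomial.coeff_mul_invOneSubPow_eq_hilbertPoly_eval (D + 1) (by omega), ← hser]
    have h1 := congrArg (fun z : ℤ => (z : ℝ)) (finrank_degreeFiltration K P k)
    simp only [Int.cast_natCast, Int.cast_sum] at h1
    rw [h1, PowerSeries.coeff_mul, Finset.Nat.sum_antidiagonal_eq_sum_range_succ_mk]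
    simp
  have : Nontrivial (coordinateRing K P) := by
    rw [Ideal.Quotient.nontrivial_iff, Ne, Ideal.eq_top_iff_one]
    intro h1
    have h2 := classMap_eq_zero K P h1
    have h3 : (1 : vertexRing K P) = MvPolynomial.monomial 0 1 := rfl
    rw [h3, classMap_monomial] at h2
    simp at h2
  rw [ringKrullDim_eq_natDegree _ (Ideal.Quotient.mkₐ_surjective K _) _ _ hq, hdeg]

end Ring

end Polyomino

namespace Polyomino

variable {S S' : Finset Cell} {x y z : Mon}

/-! ### Degrees along edge intervals -/

/-- The degree of a monomial in the variables from `L`. -/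
def degOn (L : Finset (ℤ × ℤ)) (x : Mon) : ℕ := x.countP (· ∈ L)

theorem degOn_add (L : Finset (ℤ × ℤ)) (x y : Mon) : degOn L (x + y) = degOn L x + degOn L y :=
  Multiset.countP_add _ _ _

theorem degOn_cons (L : Finset (ℤ × ℤ)) (v : ℤ × ℤ) (x : Mon) :
    degOn L (v ::ₘ x) = degOn L x + if v ∈ L then 1 else 0 :=
  Multiset.countP_cons _ _ _

theorem degOn_pos {L : Finset (ℤ × ℤ)} {x : Mon} : 0 < degOn L x ↔ ∃ v ∈ x, v ∈ L :=
  Multiset.countP_pos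

theorem degOn_eq_zero {L : Finset (ℤ × ℤ)} {x : Mon} : degOn L x = 0 ↔ ∀ v ∈ x, v ∉ L :=
  Multiset.countP_eq_zero

/-- The basic source of invariants: the degree in the variables from `L` is preserved if each inner
interval has as many diagonal as anti-diagonal corners in `L`. -/
theorem Eqv.degOn_eq {L : Finset (ℤ × ℤ)} (hL : ∀ a b, IsInnerInterval S a b →
    ((if a ∈ L then 1 else 0) + (if b ∈ L then 1 else 0) : ℕ) =
      (if (a.1, b.2) ∈ L then 1 else 0) + if (b.1, a.2) ∈ L then 1 else 0) (h : Eqv S x y) :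
    degOn L x = degOn L y := by
  refine h.invariant _ ?_
  rintro x y ⟨a, b, z, hab, rfl, rfl⟩
  have := hL a b hab
  rw [degOn_cons, degOn_cons, degOn_cons, degOn_cons]
  omega

/-- `L` contains both or none of the ends of each horizontal edge of `S`. -/
def RowClosed (S : Finset Cell) (L : Finset (ℤ × ℤ)) : Prop :=
  ∀ C ∈ S, ((C.1, C.2) ∈ L ↔ (C.1 + 1, C.2) ∈ L) ∧ ((C.1, C.2 + 1) ∈ L ↔ (C.1 + 1, C.2 + 1) ∈ L)

/-- `L` contains both or none of the ends of each vertical edge of `S`. -/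
def ColClosed (S : Finset Cell) (L : Finset (ℤ × ℤ)) : Prop :=
  ∀ C ∈ S, ((C.1, C.2) ∈ L ↔ (C.1, C.2 + 1) ∈ L) ∧ ((C.1 + 1, C.2) ∈ L ↔ (C.1 + 1, C.2 + 1) ∈ L)

theorem cell_mem_of_interval {a b : ℤ × ℤ} (h : IsInnerInterval S a b) {u v : ℤ} (h1 : a.1 ≤ u)
    (h2 : u < b.1) (h3 : a.2 ≤ v) (h4 : v < b.2) : (u, v) ∈ S := by
  refine h.2.2 (Finset.mem_Icc.2 ⟨⟨h1, h3⟩, ⟨?_, ?_⟩⟩)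
  · simp only [Prod.fst_sub]; omega
  · simp only [Prod.snd_sub]; omega

theorem interval_iff {a b : ℤ × ℤ} : IsInnerInterval S a b ↔ a.1 < b.1 ∧ a.2 < b.2 ∧
    ∀ u v : ℤ, a.1 ≤ u → u < b.1 → a.2 ≤ v → v < b.2 → (u, v) ∈ S := by
  constructor
  · exact fun h => ⟨h.1, h.2.1, fun u v h1 h2 h3 h4 => cell_mem_of_interval h h1 h2 h3 h4⟩
  · rintro ⟨h1, h2, h3⟩
    refine ⟨h1, h2, ?_⟩
    rintro ⟨u, v⟩ huv
    rw [Finset.mem_Icc] at huv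
    obtain ⟨⟨h4, h5⟩, ⟨h6, h7⟩⟩ := huv
    simp only [Prod.fst_sub, Prod.snd_sub] at h4 h5 h6 h7
    exact h3 u v h4 (by omega) h5 (by omega)

/-- Walk along the lower and the upper side of the interval, one cell at a time. -/
theorem RowClosed.corner {L : Finset (ℤ × ℤ)} (hL : RowClosed S L) {a b : ℤ × ℤ}
    (h : IsInnerInterval S a b) :
    (a ∈ L ↔ (b.1, a.2) ∈ L) ∧ ((a.1, b.2) ∈ L ↔ b ∈ L) := by
  have key : ∀ n : ℕ, a.1 + n ≤ b.1 →
      ((a.1, a.2) ∈ L ↔ (a.1 + n, a.2) ∈ L) ∧ ((a.1, b.2) ∈ L ↔ (a.1 + n, b.2) ∈ L) := by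
    intro n
    induction n with
    | zero => simp
    | succ n ih =>
      intro hn
      push_cast at hn ⊢
      obtain ⟨i1, i2⟩ := ih (by omega)
      have h1 := (hL _ (cell_mem_of_interval h (u := a.1 + n) (v := a.2) (by omega) (by omega)
        le_rfl h.2.1)).1
      have h2 := (hL _ (cell_mem_of_interval h (u := a.1 + n) (v := b.2 - 1) (by omega) (by omega)
        (by have := h.2.1; omega) (by omega))).2
      simp only [sub_add_cancel] at h2
      rw [i1, i2, ← add_assoc]
      exact ⟨h1, h2⟩
  have := key (b.1 - a.1).toNat (by have := h.1; omega)
  rw [Int.toNat_of_nonneg (by have := h.1; omega), add_sub_cancel] at this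
  exact this

theorem ColClosed.corner {L : Finset (ℤ × ℤ)} (hL : ColClosed S L) {a b : ℤ × ℤ}
    (h : IsInnerInterval S a b) :
    (a ∈ L ↔ (a.1, b.2) ∈ L) ∧ ((b.1, a.2) ∈ L ↔ b ∈ L) := by
  have key : ∀ n : ℕ, a.2 + n ≤ b.2 →
      ((a.1, a.2) ∈ L ↔ (a.1, a.2 + n) ∈ L) ∧ ((b.1, a.2) ∈ L ↔ (b.1, a.2 + n) ∈ L) := by
    intro n
    induction n with
    | zero => simp
    | succ n ih =>
      intro hn
      push_cast at hn ⊢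
      obtain ⟨i1, i2⟩ := ih (by omega)
      have h1 := (hL _ (cell_mem_of_interval h (u := a.1) (v := a.2 + n) le_rfl h.1 (by omega)
        (by omega))).1
      have h2 := (hL _ (cell_mem_of_interval h (u := b.1 - 1) (v := a.2 + n)
        (by have := h.1; omega) (by omega) (by omega) (by omega))).2
      simp only [sub_add_cancel] at h2
      rw [i1, i2, ← add_assoc]
      exact ⟨h1, h2⟩
  have := key (b.2 - a.2).toNat (by have := h.2.1; omega)
  rw [Int.toNat_of_nonneg (by have := h.2.1; omega), add_sub_cancel] at this
  exact this

theorem RowClosed.degOn_eq {L : Finset (ℤ × ℤ)} (hL : RowClosed S L) (h : Eqv S x y) :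
    degOn L x = degOn L y := by
  refine h.degOn_eq fun a b hab => ?_
  obtain ⟨h1, h2⟩ := hL.corner hab
  simp only [h1, ← h2]
  omega

theorem ColClosed.degOn_eq {L : Finset (ℤ × ℤ)} (hL : ColClosed S L) (h : Eqv S x y) :
    degOn L x = degOn L y := by
  refine h.degOn_eq fun a b hab => ?_
  obtain ⟨h1, h2⟩ := hL.corner hab
  simp only [h1, ← h2]

theorem mem_vertices {S : Finset Cell} {v : ℤ × ℤ} : v ∈ vertices S ↔ ∃ C ∈ S,
    (v = (C.1, C.2) ∨ v = (C.1 + 1, C.2) ∨ v = (C.1, C.2 + 1) ∨ v = (C.1 + 1, C.2 + 1)) := by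
  simp [vertices, cellVertices]

theorem mem_cellVertices {C : Cell} {v : ℤ × ℤ} : v ∈ cellVertices C ↔
    (v = (C.1, C.2) ∨ v = (C.1 + 1, C.2) ∨ v = (C.1, C.2 + 1) ∨ v = (C.1 + 1, C.2 + 1)) := by
  simp [cellVertices]

theorem mem_vertices_iff {S : Finset Cell} {v : ℤ × ℤ} :
    v ∈ vertices S ↔ ∃ C ∈ S, v ∈ cellVertices C := by
  simp [vertices]

theorem vertices_mono (h : S ⊆ S') : vertices S ⊆ vertices S' :=
  Finset.biUnion_subset_biUnion_of_subset_left _ h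

theorem rowClosed_of_disjoint {L : Finset (ℤ × ℤ)} (h : ∀ v ∈ L, v ∉ vertices S) :
    RowClosed S L := by
  intro C hC
  have h1 : (C.1, C.2) ∉ L := fun hv => h _ hv (mem_vertices.2 ⟨C, hC, by simp⟩)
  have h2 : (C.1 + 1, C.2) ∉ L := fun hv => h _ hv (mem_vertices.2 ⟨C, hC, by simp⟩)
  have h3 : (C.1, C.2 + 1) ∉ L := fun hv => h _ hv (mem_vertices.2 ⟨C, hC, by simp⟩)
  have h4 : (C.1 + 1, C.2 + 1) ∉ L := fun hv => h _ hv (mem_vertices.2 ⟨C, hC, by simp⟩)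
  simp [h1, h2, h3, h4]

theorem Eqv.degOn_eq_of_disjoint {L : Finset (ℤ × ℤ)} (hL : ∀ v ∈ L, v ∉ vertices S)
    (h : Eqv S x y) : degOn L x = degOn L y :=
  (rowClosed_of_disjoint hL).degOn_eq h

/-- Monomials avoiding `L` are only moved by the intervals avoiding `L`. -/
theorem Eqv.restrict {L : Finset (ℤ × ℤ)} (hL : ∀ a b, IsInnerInterval S' a b →
    IsInnerInterval S a b ∨ ((a ∈ L ∨ b ∈ L) ∧ ((a.1, b.2) ∈ L ∨ (b.1, a.2) ∈ L)))
    (hS : ∀ v ∈ L, v ∉ vertices S) (hx : ∀ v ∈ x, v ∉ L) (h : Eqv S' x y) : Eqv S x y := by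
  suffices h : Eqv S x y ∧ ∀ v ∈ y, v ∉ L from h.1
  induction h with
  | refl => exact ⟨Eqv.refl _ _, hx⟩
  | @tail y w _ hyw ih =>
    obtain ⟨ih1, ih2⟩ := ih
    have key : Eqv S y w := by
      -- An interval that is not one of `S` has a corner in `L` on both sides of its move, so it
      -- cannot be applied to a monomial avoiding `L`, in either direction.
      rcases hyw with ⟨a, b, z, hab, rfl, rfl⟩ | ⟨a, b, z, hab, rfl, rfl⟩
      · rcases hL a b hab with hab | ⟨h1 | h1, -⟩
        · exact Eqv.of_interval hab z
        · exact absurd h1 (ih2 _ (by simp))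
        · exact absurd h1 (ih2 _ (by simp))
      · rcases hL a b hab with hab | ⟨-, h1 | h1⟩
        · exact (Eqv.of_interval hab z).symm
        · exact absurd h1 (ih2 _ (by simp))
        · exact absurd h1 (ih2 _ (by simp))
    refine ⟨ih1.trans key, ?_⟩
    rw [← degOn_eq_zero, ← key.degOn_eq_of_disjoint hS, degOn_eq_zero]
    exact ih2

/-! ### Cancellation -/

/-- The monoid of classes is cancellative. -/
def Cancellative (S : Finset Cell) : Prop := ∀ x y z : Mon, Eqv S (x + z) (y + z) → Eqv S x y

theorem Cancellative.cons (h : Cancellative S) {v : ℤ × ℤ} (hv : Eqv S (v ::ₘ x) (v ::ₘ y)) :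
    Eqv S x y := by
  refine h x y {v} ?_
  rwa [add_comm, add_comm y, Multiset.singleton_add, Multiset.singleton_add]

theorem exists_add_of_mem_two {x : Mon} {u v : ℤ × ℤ} (hu : u ∈ x) (hv : v ∈ x) (huv : u ≠ v) :
    ∃ z, x = u ::ₘ v ::ₘ z := by
  obtain ⟨y, rfl⟩ := Multiset.exists_cons_of_mem hu
  rcases Multiset.mem_cons.1 hv with h | h
  · exact absurd h.symm huv
  · obtain ⟨z, rfl⟩ := Multiset.exists_cons_of_mem h
    exact ⟨z, rfl⟩

/-! ### Adjoining the variables of a Rees algebra -/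

/-- The substitution of the variables in `N` along `ω`. -/
def substVar (N : Finset (ℤ × ℤ)) (ω : ℤ × ℤ → ℤ × ℤ) (v : ℤ × ℤ) : ℤ × ℤ :=
  if v ∈ N then ω v else v

/-- The substitution on monomials. -/
def substMon (N : Finset (ℤ × ℤ)) (ω : ℤ × ℤ → ℤ × ℤ) (x : Mon) : Mon := x.map (substVar N ω)

theorem substMon_cons (N : Finset (ℤ × ℤ)) (ω : ℤ × ℤ → ℤ × ℤ) (v : ℤ × ℤ) (x : Mon) :
    substMon N ω (v ::ₘ x) = substVar N ω v ::ₘ substMon N ω x := Multiset.map_cons _ _ _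

theorem substMon_add (N : Finset (ℤ × ℤ)) (ω : ℤ × ℤ → ℤ × ℤ) (x y : Mon) :
    substMon N ω (x + y) = substMon N ω x + substMon N ω y := Multiset.map_add _ _ _

theorem card_substMon (N : Finset (ℤ × ℤ)) (ω : ℤ × ℤ → ℤ × ℤ) (x : Mon) :
    (substMon N ω x).card = x.card := Multiset.card_map _ _

theorem substMon_eq_self {N : Finset (ℤ × ℤ)} {ω : ℤ × ℤ → ℤ × ℤ} {x : Mon}
    (h : ∀ v ∈ x, v ∉ N) : substMon N ω x = x := by
  conv_rhs => rw [← Multiset.map_id x]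
  exact Multiset.map_congr rfl fun v hv => if_neg (h v hv)

theorem substMon_eq_map {N : Finset (ℤ × ℤ)} {ω : ℤ × ℤ → ℤ × ℤ} {x : Mon}
    (h : ∀ v ∈ x, v ∈ N) : substMon N ω x = x.map ω :=
  Multiset.map_congr rfl fun v hv => if_pos (h v hv)

/-- The classes of `S'` form the Rees monoid of the ideal generated by `ω '' N` in the monoid of
classes of `S`. -/
structure IsRees (S S' : Finset Cell) (N : Finset (ℤ × ℤ)) (ω : ℤ × ℤ → ℤ × ℤ) : Prop where
  sub : S ⊆ S'
  canc : Cancellative S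
  move : ∀ a b, IsInnerInterval S' a b → Eqv S {substVar N ω a, substVar N ω b}
    {substVar N ω (a.1, b.2), substVar N ω (b.1, a.2)}
  deg : ∀ a b, IsInnerInterval S' a b →
    ((if a ∈ N then 1 else 0) + (if b ∈ N then 1 else 0) : ℕ) =
      (if (a.1, b.2) ∈ N then 1 else 0) + if (b.1, a.2) ∈ N then 1 else 0
  -- The only condition that depends on the shape: two monomials that ought to be equivalent can be
  -- moved until they share a variable of `N`, which can then be cancelled.
  exch : ∀ x y, Eqv S (substMon N ω x) (substMon N ω y) → degOn N x = degOn N y →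
    (∀ v ∈ N, v ∈ x → v ∉ y) → 0 < degOn N x →
    ∃ x' y', Eqv S' x x' ∧ Eqv S' y y' ∧ ∃ v ∈ N, v ∈ x' ∧ v ∈ y'

namespace IsRees

variable {N : Finset (ℤ × ℤ)} {ω : ℤ × ℤ → ℤ × ℤ}

theorem substMon_eqv (R : IsRees S S' N ω) (h : Eqv S' x y) :
    Eqv S (substMon N ω x) (substMon N ω y) := by
  have key : ∀ x y, Move S' x y → Eqv S (substMon N ω x) (substMon N ω y) := by
    rintro x y ⟨a, b, z, hab, rfl, rfl⟩
    have := (R.move a b hab).add_right (substMon N ω z)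
    simpa [substMon_cons] using this
  induction h with
  | refl => exact Eqv.refl _ _
  | tail _ h ih => exact ih.trans (h.elim (key _ _) fun h => (key _ _ h).symm)

theorem degOn_eq (R : IsRees S S' N ω) (h : Eqv S' x y) : degOn N x = degOn N y :=
  h.degOn_eq R.deg

/-- Induction on the degree in `N`: `exch` produces a common variable of `N`, which is removed from
both sides because `S` is cancellative. In degree zero the substitution does nothing. Thus the
classes of `S'` embed into pairs of a class of `S` and a degree. -/
theorem eqv_iff (R : IsRees S S' N ω) :
    Eqv S' x y ↔ Eqv S (substMon N ω x) (substMon N ω y) ∧ degOn N x = degOn N y := by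
  refine ⟨fun h => ⟨R.substMon_eqv h, R.degOn_eq h⟩, ?_⟩
  rintro ⟨h, hd⟩
  generalize hn : degOn N x = n at hd
  induction n generalizing x y with
  | zero =>
    rw [degOn_eq_zero] at hn
    rw [eq_comm, degOn_eq_zero] at hd
    rw [substMon_eq_self hn, substMon_eq_self hd] at h
    exact h.mono R.sub
  | succ n ih =>
    have hcommon : ∀ x y, Eqv S (substMon N ω x) (substMon N ω y) → degOn N x = n + 1 →
        n + 1 = degOn N y → (∃ v ∈ N, v ∈ x ∧ v ∈ y) → Eqv S' x y := by
      rintro x y h hx hy ⟨v, hv, hvx, hvy⟩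
      obtain ⟨x, rfl⟩ := Multiset.exists_cons_of_mem hvx
      obtain ⟨y, rfl⟩ := Multiset.exists_cons_of_mem hvy
      rw [degOn_cons, if_pos hv] at hx hy
      rw [substMon_cons, substMon_cons] at h
      exact (ih (R.canc.cons h) (by omega) (by omega)).cons v
    by_cases hc : ∃ v ∈ N, v ∈ x ∧ v ∈ y
    · exact hcommon x y h hn hd hc
    · push Not at hc
      obtain ⟨x', y', hx', hy', hc'⟩ := R.exch x y h (hn.trans hd) hc (by omega)
      refine (hx'.trans ?_).trans hy'.symm
      refine hcommon x' y' ?_ (by rw [← R.degOn_eq hx', hn]) (by rw [← R.degOn_eq hy', hd]) hc'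
      exact (R.substMon_eqv hx').symm.trans (h.trans (R.substMon_eqv hy'))

/-- Pairs of a class of `S` and a natural number can be cancelled componentwise. -/
theorem cancellative (R : IsRees S S' N ω) : Cancellative S' := by
  intro x y z h
  rw [R.eqv_iff] at h ⊢
  rw [substMon_add, substMon_add, degOn_add, degOn_add] at h
  exact ⟨R.canc _ _ _ h.1, by omega⟩

end IsRees

/-- `x` lies in the `j`-th power of the ideal generated by `ω '' N`. -/
def InPower (S : Finset Cell) (N : Finset (ℤ × ℤ)) (ω : ℤ × ℤ → ℤ × ℤ) (U : Finset (ℤ × ℤ))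
    (x : Mon) (j : ℕ) : Prop :=
  ∃ c ∈ monOn N, ∃ z ∈ monOn U, c.card = j ∧ Eqv S (c.map ω + z) x

/-! ### Powers of the ideal and counting in the Rees monoid -/

section InPower

variable {N : Finset (ℤ × ℤ)} {ω : ℤ × ℤ → ℤ × ℤ} {U : Finset (ℤ × ℤ)}

theorem InPower.congr {j : ℕ} (h : InPower S N ω U x j) (hxy : Eqv S x y) :
    InPower S N ω U y j := by
  obtain ⟨c, hc, z, hz, hj, h⟩ := h
  exact ⟨c, hc, z, hz, hj, h.trans hxy⟩

theorem monOn_map (hω : ∀ v ∈ N, ω v ∈ U) {c : Mon} (hc : c ∈ monOn N) : c.map ω ∈ monOn U := by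
  intro v hv
  obtain ⟨w, hw, rfl⟩ := Multiset.mem_map.1 hv
  exact hω w (hc w hw)

theorem monOn_add {x y : Mon} (hx : x ∈ monOn U) (hy : y ∈ monOn U) : x + y ∈ monOn U := by
  intro v hv
  rcases Multiset.mem_add.1 hv with h | h
  exacts [hx v h, hy v h]

theorem InPower.mono (hω : ∀ v ∈ N, ω v ∈ U) {i j : ℕ} (hij : i ≤ j)
    (h : InPower S N ω U x j) : InPower S N ω U x i := by
  obtain ⟨c, hc, z, hz, hj, h⟩ := h
  obtain ⟨c', hc', hi⟩ : ∃ c' ≤ c, c'.card = i := by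
    have h0 : 0 < (Multiset.powersetCard i c).card := by
      rw [Multiset.card_powersetCard]; exact Nat.choose_pos (by omega)
    obtain ⟨c', h'⟩ := Multiset.card_pos_iff_exists_mem.1 h0
    exact ⟨c', Multiset.mem_powersetCard.1 h'⟩
  obtain ⟨e, rfl⟩ := Multiset.le_iff_exists_add.1 hc'
  refine ⟨c', fun v hv => hc v (Multiset.mem_add.2 (Or.inl hv)), e.map ω + z,
    monOn_add (monOn_map hω fun v hv => hc v (Multiset.mem_add.2 (Or.inr hv))) hz, hi, ?_⟩
  rwa [← add_assoc, ← Multiset.map_add]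

theorem InPower.zero (hx : x ∈ monOn U) : InPower S N ω U x 0 :=
  ⟨0, by simp [monOn], x, hx, rfl, by simpa using Eqv.refl S x⟩

theorem InPower.le_card {j : ℕ} (h : InPower S N ω U x j) : j ≤ x.card := by
  obtain ⟨c, hc, z, hz, hj, h⟩ := h
  have := h.card_eq
  rw [Multiset.card_add, Multiset.card_map] at this
  omega

/-- The order function of the ideal generated by `ω '' N`. -/
theorem exists_order (S : Finset Cell) (hω : ∀ v ∈ N, ω v ∈ U) :
    ∃ ν : Quotient (eqvSetoid S) → ℕ, ∀ x ∈ monOn U, ∀ j,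
      InPower S N ω U x j ↔ j ≤ ν (Quotient.mk _ x) := by
  have key : ∀ q : Quotient (eqvSetoid S), ∃ n : ℕ, ∀ x ∈ monOn U, Quotient.mk _ x = q → ∀ j,
      InPower S N ω U x j ↔ j ≤ n := by
    intro q
    by_cases hq : ∃ x ∈ monOn U, Quotient.mk _ x = q
    · obtain ⟨x, hx, rfl⟩ := hq
      classical
      -- The powers containing `x` have exponent at most its degree, so a largest one exists; by
      -- `InPower.mono` all smaller ones contain `x` too.
      refine ⟨Nat.findGreatest (InPower S N ω U x) x.card, fun y hy hyx j => ?_⟩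
      have hxy : Eqv S y x := Quotient.exact hyx
      have hiff : InPower S N ω U y j ↔ InPower S N ω U x j :=
        ⟨fun h => h.congr hxy, fun h => h.congr hxy.symm⟩
      rw [hiff]
      constructor
      · exact fun h => Nat.le_findGreatest h.le_card h
      · intro h
        exact (Nat.findGreatest_spec (P := InPower S N ω U x) (Nat.zero_le _)
          (InPower.zero hx)).mono hω h
    · exact ⟨0, fun x hx hxq => absurd ⟨x, hx, hxq⟩ hq⟩
  choose ν hν using key
  exact ⟨ν, fun x hx j => hν _ x hx rfl j⟩

/-- The classes of degree `k`. -/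
noncomputable def classFinset (S : Finset Cell) (U : Finset (ℤ × ℤ)) (k : ℕ) :
    Finset (Quotient (eqvSetoid S)) :=
  ((finite_monOn U k).image (Quotient.mk (eqvSetoid S))).toFinset

theorem mem_classFinset {k : ℕ} {q : Quotient (eqvSetoid S)} : q ∈ classFinset S U k ↔
    ∃ x ∈ monOn U, x.card = k ∧ Quotient.mk _ x = q := by
  simp [classFinset, and_assoc]

theorem coeff_monSeries (S : Finset Cell) (U : Finset (ℤ × ℤ)) (k : ℕ) :
    (monSeries S U).coeff k = ∑ _q ∈ classFinset S U k, (1 : ℤ) := by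
  rw [monSeries, classSeries, PowerSeries.coeff_mk, classCount, classFinset,
    Set.ncard_eq_toFinset_card _ ((finite_monOn U k).image _)]
  simp

/-- Over a class `q` of `S` lie the pairs `(q, j)` with `q` in the `j`-th power of the ideal, that
is `0 ≤ j ≤ ν q`. Substitution preserves the degree, so the count can be made degree by degree. -/
theorem IsRees.coeff_monSeries (R : IsRees S S' N ω)
    (hω : ∀ v ∈ N, ω v ∈ U) (hNU : ∀ v ∈ N, v ∉ U) {ν : Quotient (eqvSetoid S) → ℕ}
    (hν : ∀ x ∈ monOn U, ∀ j, InPower S N ω U x j ↔ j ≤ ν (Quotient.mk _ x)) (k : ℕ) :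
    (monSeries S' (U ∪ N)).coeff k = ∑ q ∈ classFinset S U k, ((ν q : ℤ) + 1) := by
  classical
  rw [monSeries, classSeries, PowerSeries.coeff_mk]
  set Z : Finset (Σ _ : Quotient (eqvSetoid S), ℕ) :=
    (classFinset S U k).sigma fun q => Finset.range (ν q + 1) with hZ
  have hsub : ∀ x ∈ monOn (U ∪ N), substMon N ω x ∈ monOn U := by
    intro x hx v hv
    obtain ⟨w, hw, rfl⟩ := Multiset.mem_map.1 hv
    rw [substVar]
    split_ifs with h
    · exact hω w h
    · exact (Finset.mem_union.1 (hx w hw)).resolve_right h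
  -- The set of pairs carries the equality relation, so that its elements are counted as classes.
  have h1 : classCount (eqvSetoid S') (monOn (U ∪ N) ∩ {x | x.card = k}) =
      classCount (⊥ : Setoid (Σ _ : Quotient (eqvSetoid S), ℕ)) (Z : Set _) := by
    refine classCount_congr (fun x => ⟨Quotient.mk _ (substMon N ω x), degOn N x⟩) ?_ ?_ ?_
    · rintro x ⟨hx, hxk⟩
      rw [Finset.mem_coe, hZ, Finset.mem_sigma, Finset.mem_range, Nat.lt_succ_iff, mem_classFinset]
      refine ⟨⟨_, hsub x hx, by rw [card_substMon]; exact hxk, rfl⟩, ?_⟩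
      rw [← hν _ (hsub x hx)]
      refine ⟨x.filter (· ∈ N), ?_, x.filter (· ∉ N), ?_, ?_, ?_⟩
      · intro v hv; exact (Multiset.mem_filter.1 hv).2
      · intro v hv
        rw [Multiset.mem_filter] at hv
        exact (Finset.mem_union.1 (hx v hv.1)).resolve_right hv.2
      · exact (Multiset.countP_eq_card_filter _ _).symm
      · have e1 : (x.filter (· ∈ N)).map ω = substMon N ω (x.filter (· ∈ N)) :=
          (substMon_eq_map fun v hv => (Multiset.mem_filter.1 hv).2).symm
        have e2 : x.filter (· ∉ N) = substMon N ω (x.filter (· ∉ N)) :=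
          (substMon_eq_self fun v hv => (Multiset.mem_filter.1 hv).2).symm
        rw [e1, e2, ← substMon_add, Multiset.filter_add_not]
        exact Eqv.refl _ _
    · intro x _ y _
      change Eqv S' x y ↔ _ = _
      rw [R.eqv_iff, Sigma.mk.injEq, Quotient.eq, heq_eq_eq]
      rfl
    · rintro ⟨q, j⟩ hqj
      rw [Finset.mem_coe, hZ, Finset.mem_sigma, Finset.mem_range, Nat.lt_succ_iff,
        mem_classFinset] at hqj
      obtain ⟨⟨x, hx, hxk, rfl⟩, hj⟩ := hqj
      obtain ⟨c, hc, z, hz, hcj, h⟩ := (hν x hx j).2 hj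
      have hzN : ∀ v ∈ z, v ∉ N := fun v hv hvN => hNU v hvN (hz v hv)
      have hval : substMon N ω (c + z) = c.map ω + z := by
        rw [substMon_add, substMon_eq_map hc, substMon_eq_self hzN]
      refine ⟨c + z, ⟨?_, ?_⟩, ?_⟩
      · intro v hv
        rw [Finset.mem_union]
        rcases Multiset.mem_add.1 hv with h | h
        exacts [Or.inr (hc v h), Or.inl (hz v h)]
      · rw [Set.mem_ofPred_eq, ← card_substMon N ω, hval, h.card_eq, hxk]
      · change _ = _
        simp only [hval, degOn_add, degOn_eq_zero.2 hzN, Sigma.mk.injEq, heq_eq_eq]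
        refine ⟨Quotient.sound h, ?_⟩
        rw [← hcj, degOn, Multiset.countP_eq_card.2 hc]
        rfl
  have h2 : classCount (⊥ : Setoid (Σ _ : Quotient (eqvSetoid S), ℕ)) (Z : Set _) = Z.card := by
    rw [classCount, Set.ncard_image_of_injective, Set.ncard_coe_finset]
    intro a b hab
    exact Quotient.exact hab
  rw [h1, h2, hZ, Finset.card_sigma]
  simp

end InPower

end Polyomino

namespace Polyomino

variable {S S' : Finset Cell} {x y z : Mon}

/-! ### Removing the last cell of a tail -/

/-- The cells `(x₀, y), …, (x₁, y)` form a straight end of `S`, attached to the rest of `S` from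
below and only near `(x₀, y)`. -/
structure IsTail (S : Finset Cell) (x₀ x₁ y : ℤ) : Prop where
  le : x₀ ≤ x₁
  sub : ∀ x, x₀ ≤ x → x ≤ x₁ → (x, y) ∈ S
  corner : ∀ D ∈ S, D ≠ (x₁, y) → (x₁ + 1, y + 1) ∉ cellVertices D ∧ (x₁ + 1, y) ∉ cellVertices D
  line : ∀ D ∈ S, ¬ (x₀ ≤ D.1 ∧ D.1 ≤ x₁ ∧ D.2 = y) → ∀ x, x₀ ≤ x → x ≤ x₁ →
    (x, y + 1) ∉ cellVertices D

/-- The horizontal segment of lattice points. -/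
noncomputable def rowSegment (x₀ x₁ y : ℤ) : Finset (ℤ × ℤ) := Finset.Icc (x₀, y) (x₁, y)

theorem mem_rowSegment {x₀ x₁ y : ℤ} {v : ℤ × ℤ} :
    v ∈ rowSegment x₀ x₁ y ↔ x₀ ≤ v.1 ∧ v.1 ≤ x₁ ∧ v.2 = y := by
  obtain ⟨a, b⟩ := v
  simp only [rowSegment, Finset.mem_Icc, Prod.mk_le_mk]
  constructor
  · rintro ⟨⟨h1, h2⟩, h3, h4⟩; exact ⟨h1, h3, le_antisymm h4 h2⟩
  · rintro ⟨h1, h2, h3⟩; exact ⟨⟨h1, h3.ge⟩, h2, h3.le⟩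

theorem card_rowSegment {x₀ x₁ y : ℤ} (h : x₀ ≤ x₁ + 1) :
    ((rowSegment x₀ x₁ y).card : ℤ) = x₁ + 1 - x₀ := by
  have : rowSegment x₀ x₁ y = (Finset.Icc x₀ x₁).image fun x => (x, y) := by
    ext ⟨a, b⟩
    simp only [mem_rowSegment, Finset.mem_image, Finset.mem_Icc, Prod.mk.injEq]
    constructor
    · rintro ⟨h1, h2, rfl⟩; exact ⟨a, ⟨h1, h2⟩, rfl, rfl⟩
    · rintro ⟨_, ⟨h1, h2⟩, rfl, rfl⟩; exact ⟨h1, h2, rfl⟩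
  rw [this, Finset.card_image_of_injective _ (fun a b h => (Prod.mk.inj h).1), Int.card_Icc,
    Int.toNat_of_nonneg (by omega)]

namespace IsTail

variable {x₀ x₁ y₀ : ℤ} (hT : IsTail S x₀ x₁ y₀)
include hT

/-- An interval through the tail that rose above the row or ran past either end would contain a cell
touching the top line of the tail or its free edge. It is not prevented from extending downwards. -/
theorem interval_row {a b : ℤ × ℤ} (h : IsInnerInterval S a b) {u : ℤ} (h1 : x₀ ≤ u)
    (h2 : u ≤ x₁) (h3 : a.1 ≤ u) (h4 : u < b.1) (h5 : a.2 ≤ y₀) (h6 : y₀ < b.2) :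
    b.2 = y₀ + 1 ∧ x₀ ≤ a.1 ∧ b.1 ≤ x₁ + 1 := by
  refine ⟨?_, ?_, ?_⟩
  · by_contra hne
    have hm := cell_mem_of_interval h h3 h4 (v := y₀ + 1) (by omega) (by omega)
    exact hT.line _ hm (by simp) u h1 h2 (by simp [mem_cellVertices])
  · by_contra hne
    have hm := cell_mem_of_interval h (u := x₀ - 1) (v := y₀) (by omega) (by omega) h5 h6
    exact hT.line _ hm (by simp) x₀ le_rfl hT.le (by simp [mem_cellVertices])
  · by_contra hne
    have hm := cell_mem_of_interval h (u := x₁ + 1) (v := y₀) (by omega) (by omega) h5 h6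
    exact (hT.corner _ hm (by simp)).2 (by simp [mem_cellVertices])

theorem interval_end {a b : ℤ × ℤ} (h : IsInnerInterval S a b) (h3 : a.1 ≤ x₁) (h4 : x₁ < b.1)
    (h5 : a.2 ≤ y₀) (h6 : y₀ < b.2) : b = (x₁ + 1, y₀ + 1) ∧ a.2 = y₀ ∧ x₀ ≤ a.1 := by
  obtain ⟨h7, h8, h9⟩ := hT.interval_row h hT.le le_rfl h3 h4 h5 h6
  refine ⟨Prod.ext (by dsimp only; omega) h7, ?_, h8⟩
  by_contra hne
  have hm := cell_mem_of_interval h (u := x₁) (v := y₀ - 1) h3 h4 (by omega) (by omega)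
  exact (hT.corner _ hm (by simp)).2 (by simp [mem_cellVertices])

theorem interval_erase {a b : ℤ × ℤ} (h : IsInnerInterval S a b) :
    IsInnerInterval (S.erase (x₁, y₀)) a b ∨
      b = (x₁ + 1, y₀ + 1) ∧ a.2 = y₀ ∧ x₀ ≤ a.1 ∧ a.1 ≤ x₁ := by
  by_cases hc : a.1 ≤ x₁ ∧ x₁ < b.1 ∧ a.2 ≤ y₀ ∧ y₀ < b.2
  · obtain ⟨h1, h2, h3⟩ := hT.interval_end h hc.1 hc.2.1 hc.2.2.1 hc.2.2.2
    exact Or.inr ⟨h1, h2, h3, hc.1⟩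
  · left
    rw [interval_iff]
    refine ⟨h.1, h.2.1, fun u v h1 h2 h3 h4 => Finset.mem_erase.2
      ⟨?_, cell_mem_of_interval h h1 h2 h3 h4⟩⟩
    rintro heq
    obtain ⟨rfl, rfl⟩ := Prod.mk.inj heq
    exact hc ⟨h1, h2, h3, h4⟩

theorem corner_notMem : (x₁ + 1, y₀ + 1) ∉ vertices (S.erase (x₁, y₀)) ∧
    (x₁ + 1, y₀) ∉ vertices (S.erase (x₁, y₀)) := by
  constructor <;>
  · intro h
    obtain ⟨D, hD, hv⟩ := mem_vertices_iff.1 h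
    rw [Finset.mem_erase] at hD
    first
    | exact (hT.corner D hD.2 hD.1).1 hv
    | exact (hT.corner D hD.2 hD.1).2 hv

theorem rowClosed_erase : RowClosed (S.erase (x₁, y₀)) (rowSegment x₀ x₁ (y₀ + 1)) := by
  intro D hD
  rw [Finset.mem_erase] at hD
  simp only [mem_rowSegment]
  by_cases hc : x₀ ≤ D.1 ∧ D.1 ≤ x₁ ∧ D.2 = y₀
  · have : D.1 ≠ x₁ := fun h => hD.1 (Prod.ext h hc.2.2)
    omega
  · have key := hT.line D hD.2 hc
    simp only [mem_cellVertices, Prod.ext_iff] at key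
    constructor
    · constructor
      · intro h; exact absurd (Or.inl ⟨rfl, h.2.2.symm⟩) (key _ h.1 h.2.1)
      · intro h; exact absurd (Or.inr (Or.inl ⟨rfl, h.2.2.symm⟩)) (key _ h.1 h.2.1)
    · constructor
      · intro h; exact absurd (Or.inr (Or.inr (Or.inl ⟨rfl, h.2.2.symm⟩))) (key _ h.1 h.2.1)
      · intro h; exact absurd (Or.inr (Or.inr (Or.inr ⟨rfl, h.2.2.symm⟩))) (key _ h.1 h.2.1)

theorem rowClosed : RowClosed S (rowSegment x₀ (x₁ + 1) (y₀ + 1)) := by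
  intro D hD
  simp only [mem_rowSegment]
  by_cases hc : x₀ ≤ D.1 ∧ D.1 ≤ x₁ ∧ D.2 = y₀
  · omega
  · have key : ∀ x, x₀ ≤ x → x ≤ x₁ + 1 → (x, y₀ + 1) ∉ cellVertices D := by
      intro x h1 h2
      by_cases hx : x ≤ x₁
      · exact hT.line D hD hc x h1 hx
      · obtain rfl : x = x₁ + 1 := by omega
        refine (hT.corner D hD ?_).1
        rintro rfl
        exact hc ⟨hT.le, le_rfl, rfl⟩
    simp only [mem_cellVertices, Prod.ext_iff] at key
    constructor
    · constructor
      · intro h; exact absurd (Or.inl ⟨rfl, h.2.2.symm⟩) (key _ h.1 h.2.1)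
      · intro h; exact absurd (Or.inr (Or.inl ⟨rfl, h.2.2.symm⟩)) (key _ h.1 h.2.1)
    · constructor
      · intro h; exact absurd (Or.inr (Or.inr (Or.inl ⟨rfl, h.2.2.symm⟩))) (key _ h.1 h.2.1)
      · intro h; exact absurd (Or.inr (Or.inr (Or.inr ⟨rfl, h.2.2.symm⟩))) (key _ h.1 h.2.1)

theorem line_notMem : ∀ v ∈ rowSegment x₀ (x₁ + 1) (y₀ + 1),
    v ∉ vertices (S \ rowSegment x₀ x₁ y₀) := by
  rintro v hv h
  obtain ⟨D, hD, hvD⟩ := mem_vertices_iff.1 h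
  rw [Finset.mem_sdiff, mem_rowSegment] at hD
  rw [mem_rowSegment] at hv
  have hv' : v = (v.1, y₀ + 1) := Prod.ext rfl hv.2.2
  by_cases hx : v.1 ≤ x₁
  · exact hT.line D hD.1 hD.2 v.1 hv.1 hx (hv' ▸ hvD)
  · have hx1 : v.1 = x₁ + 1 := by omega
    refine (hT.corner D hD.1 ?_).1 (hx1 ▸ hv' ▸ hvD)
    rintro rfl
    exact hD.2 ⟨hT.le, le_rfl, rfl⟩

theorem interval_sdiff {a b : ℤ × ℤ} (h : IsInnerInterval S a b) :
    IsInnerInterval (S \ rowSegment x₀ x₁ y₀) a b ∨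
      b ∈ rowSegment x₀ (x₁ + 1) (y₀ + 1) ∧ (a.1, b.2) ∈ rowSegment x₀ (x₁ + 1) (y₀ + 1) := by
  by_cases hc : ∃ u, x₀ ≤ u ∧ u ≤ x₁ ∧ a.1 ≤ u ∧ u < b.1 ∧ a.2 ≤ y₀ ∧ y₀ < b.2
  · obtain ⟨u, h1, h2, h3, h4, h5, h6⟩ := hc
    obtain ⟨h7, h8, h9⟩ := hT.interval_row h h1 h2 h3 h4 h5 h6
    right
    simp only [mem_rowSegment]
    have := h.1
    omega
  · left
    rw [interval_iff]
    refine ⟨h.1, h.2.1, fun u v h1 h2 h3 h4 => Finset.mem_sdiff.2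
      ⟨cell_mem_of_interval h h1 h2 h3 h4, ?_⟩⟩
    rw [mem_rowSegment]
    rintro ⟨h5, h6, rfl⟩
    exact hc ⟨u, h5, h6, h1, h2, h3, h4⟩

theorem interval_mem {u : ℤ} (h1 : x₀ ≤ u) (h2 : u ≤ x₁) :
    IsInnerInterval S (u, y₀) (x₁ + 1, y₀ + 1) := by
  rw [interval_iff]
  refine ⟨by dsimp only; omega, by dsimp only; omega, ?_⟩
  intro a b h3 h4 h5 h6
  dsimp only at h3 h4 h5 h6
  obtain rfl : b = y₀ := by omega
  exact hT.sub a (by omega) (by omega)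

/-- The vertices of the free edge act like `T` times their left neighbours: every interval through
the last cell has its upper right corner at the upper end of that edge and its lower side on the
row, and replacing the free edge by the one before it gives a shorter interval or a trivial move. -/
theorem isRees (hc : Cancellative (S.erase (x₁, y₀))) :
    IsRees (S.erase (x₁, y₀)) S {(x₁ + 1, y₀ + 1), (x₁ + 1, y₀)} (fun v => (v.1 - 1, v.2)) where
  sub := Finset.erase_subset _ _
  canc := hc
  move := by
    intro a b hab
    rcases hT.interval_erase hab with h | ⟨rfl, h1, h2, h3⟩
    · have key : ∀ v ∈ vertices (S.erase (x₁, y₀)),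
          substVar {(x₁ + 1, y₀ + 1), (x₁ + 1, y₀)} (fun v => (v.1 - 1, v.2)) v = v := by
        intro v hv
        refine if_neg ?_
        rw [Finset.mem_insert, Finset.mem_singleton]
        rintro (rfl | rfl)
        exacts [hT.corner_notMem.1 hv, hT.corner_notMem.2 hv]
      obtain ⟨h1, h2, h3, h4⟩ := corner_mem_vertices h
      rw [key _ h1, key _ h2, key _ h3, key _ h4]
      exact Eqv.of_interval h 0
    · obtain ⟨u, v⟩ := a
      dsimp only at h1 h2 h3
      subst h1
      have e : ¬ (u = x₁ + 1) := by omega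
      simp only [substVar, Finset.mem_insert, Finset.mem_singleton, Prod.mk.injEq, e, false_and,
        or_self, if_false, true_and, true_or, or_true, if_true, add_sub_cancel_right]
      rcases eq_or_lt_of_le h3 with rfl | h3
      · rw [Multiset.pair_comm]; exact Eqv.refl _ _
      · have hi : IsInnerInterval (S.erase (x₁, v)) (u, v) (x₁, v + 1) := by
          rw [interval_iff]
          refine ⟨h3, by dsimp only; omega, ?_⟩
          intro a b h4 h5 h6 h7
          dsimp only at h4 h5 h6 h7
          obtain rfl : b = v := by omega
          rw [Finset.mem_erase]
          exact ⟨fun h => by have := (Prod.mk.inj h).1; omega, hT.sub a (by omega) (by omega)⟩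
        exact Eqv.of_interval hi 0
  deg := by
    intro a b hab
    rcases hT.interval_erase hab with h | ⟨rfl, h1, h2, h3⟩
    · have key : ∀ v ∈ vertices (S.erase (x₁, y₀)),
          v ∉ ({(x₁ + 1, y₀ + 1), (x₁ + 1, y₀)} : Finset (ℤ × ℤ)) := by
        intro v hv
        rw [Finset.mem_insert, Finset.mem_singleton]
        rintro (rfl | rfl)
        exacts [hT.corner_notMem.1 hv, hT.corner_notMem.2 hv]
      obtain ⟨h1, h2, h3, h4⟩ := corner_mem_vertices h
      rw [if_neg (key _ h1), if_neg (key _ h2), if_neg (key _ h3), if_neg (key _ h4)]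
    · obtain ⟨u, v⟩ := a
      dsimp only at h1 h2 h3
      subst h1
      have e : ¬ (u = x₁ + 1) := by omega
      simp [e]
  exch := by
    -- The upper end of the free edge in `x` is substituted into the top line of the shortened tail.
    -- The degree on that line is invariant, so `y` has a vertex on the line; together with the
    -- lower end of the free edge it can be exchanged to produce the upper end.
    have pull : ∀ x y : Mon, Eqv (S.erase (x₁, y₀))
        (substMon {(x₁ + 1, y₀ + 1), (x₁ + 1, y₀)} (fun v => (v.1 - 1, v.2)) x)
        (substMon {(x₁ + 1, y₀ + 1), (x₁ + 1, y₀)} (fun v => (v.1 - 1, v.2)) y) →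
        (x₁ + 1, y₀ + 1) ∈ x → (x₁ + 1, y₀ + 1) ∉ y → (x₁ + 1, y₀) ∈ y →
        ∃ y', Eqv S y y' ∧ (x₁ + 1, y₀ + 1) ∈ y' := by
      intro x y h hx hy hs
      have h1 := hT.rowClosed_erase.degOn_eq h
      have h2 : 0 < degOn (rowSegment x₀ x₁ (y₀ + 1))
          (substMon {(x₁ + 1, y₀ + 1), (x₁ + 1, y₀)} (fun v => (v.1 - 1, v.2)) x) := by
        rw [degOn_pos]
        refine ⟨(x₁, y₀ + 1), Multiset.mem_map.2 ⟨_, hx, by simp [substVar]⟩, ?_⟩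
        rw [mem_rowSegment]
        exact ⟨hT.le, le_rfl, rfl⟩
      rw [h1, degOn_pos] at h2
      obtain ⟨v, hv, hvL⟩ := h2
      obtain ⟨w, hw, rfl⟩ := Multiset.mem_map.1 hv
      rw [mem_rowSegment, substVar] at hvL
      have hwN : w ∉ ({(x₁ + 1, y₀ + 1), (x₁ + 1, y₀)} : Finset (ℤ × ℤ)) := by
        rw [Finset.mem_insert, Finset.mem_singleton]
        rintro (rfl | rfl)
        · exact hy hw
        · simp at hvL
      rw [if_neg hwN] at hvL
      obtain ⟨p, q⟩ := w
      obtain ⟨h3, h4, h5⟩ := hvL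
      dsimp only at h3 h4 h5
      subst h5
      obtain ⟨z, rfl⟩ := exists_add_of_mem_two hw hs (by simp)
      exact ⟨_, (Eqv.of_interval (hT.interval_mem h3 h4) z).symm, by simp⟩
    intro x y h hd hc hpos
    have hpos' := hpos
    rw [hd] at hpos'
    obtain ⟨v, hvx, hvN⟩ := degOn_pos.1 hpos
    obtain ⟨w, hwy, hwN⟩ := degOn_pos.1 hpos'
    have hvN' := hvN
    have hwN' := hwN
    rw [Finset.mem_insert, Finset.mem_singleton] at hvN' hwN'
    rcases hvN' with rfl | rfl <;> rcases hwN' with rfl | rfl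
    · exact absurd hwy (hc _ hvN hvx)
    · obtain ⟨y', hy', hm⟩ := pull x y h hvx (hc _ hvN hvx) hwy
      exact ⟨x, y', Eqv.refl _ _, hy', _, hvN, hvx, hm⟩
    · obtain ⟨x', hx', hm⟩ := pull y x h.symm hwy (fun h => hc _ hwN h hwy) hvx
      exact ⟨x', y, hx', Eqv.refl _ _, _, hwN, hm, hwy⟩
    · exact absurd hwy (hc _ hvN hvx)

theorem cancellative (hc : Cancellative (S.erase (x₁, y₀))) : Cancellative S :=
  (hT.isRees hc).cancellative

/-- With `r` and `s` the upper and lower end of the free edge and `L` the top line of the tail, the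
normal forms are the multiples of `r`, the monomials avoiding `r` and `s`, and `s` times monomials
avoiding `L`. A product of `s` with a vertex of `L` other than `r` moves to a multiple of `r`.
Multiplication by `r` is injective on classes, so the first family contributes `t` times the whole
series, which accounts for the factor `1 - t`. -/
theorem monSeries_eq (hc : Cancellative (S.erase (x₁, y₀))) {U : Finset (ℤ × ℤ)}
    (hU : vertices S ⊆ U) :
    (1 - PowerSeries.X) * monSeries S U =
      monSeries (S.erase (x₁, y₀)) (U \ {(x₁ + 1, y₀ + 1), (x₁ + 1, y₀)}) +
      PowerSeries.X * monSeries (S \ rowSegment x₀ x₁ y₀)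
        (U \ rowSegment x₀ (x₁ + 1) (y₀ + 1)) := by
  have hcS := hT.cancellative hc
  have hR := hT.isRees hc
  set r : ℤ × ℤ := (x₁ + 1, y₀ + 1) with hr
  set s : ℤ × ℤ := (x₁ + 1, y₀) with hs
  set L := rowSegment x₀ (x₁ + 1) (y₀ + 1) with hL
  have hmem := hT.sub x₁ hT.le le_rfl
  have hrU : r ∈ U := hU (mem_vertices_iff.2 ⟨_, hmem, by simp [mem_cellVertices, hr]⟩)
  have hsU : s ∈ U := hU (mem_vertices_iff.2 ⟨_, hmem, by simp [mem_cellVertices, hs]⟩)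
  have hrL : r ∈ L := by
    have := hT.le
    rw [hL, mem_rowSegment, hr]
    exact ⟨by dsimp only; omega, le_rfl, rfl⟩
  have hsL : s ∉ L := by rw [hL, mem_rowSegment]; simp [hs]
  have hsub : ∀ {V : Finset (ℤ × ℤ)} {x : Mon}, x ∈ monOn (U \ V) → x ∈ monOn U :=
    fun hx v hv => (Finset.mem_sdiff.1 (hx v hv)).1
  have hcons : ∀ {v : ℤ × ℤ} {x : Mon}, v ∈ U → x ∈ monOn U → v ::ₘ x ∈ monOn U := by
    intro v x hv hx w hw
    rcases Multiset.mem_cons.1 hw with rfl | hw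
    exacts [hv, hx w hw]
  set Y₁ : Set Mon := (fun x => r ::ₘ x) '' monOn U with hY₁
  set Y₂ : Set Mon := monOn (U \ {r, s}) with hY₂
  set Y₃ : Set Mon := (fun x => s ::ₘ x) '' monOn (U \ L) with hY₃
  have hY₁U : Y₁ ⊆ monOn U := by rintro _ ⟨x, hx, rfl⟩; exact hcons hrU hx
  have hY₂U : Y₂ ⊆ monOn U := fun x hx => hsub hx
  have hY₃U : Y₃ ⊆ monOn U := by rintro _ ⟨x, hx, rfl⟩; exact hcons hsU (hsub hx)
  have hfin : ∀ {Y : Set Mon}, Y ⊆ monOn U → ∀ k, (Y ∩ {x | x.card = k}).Finite :=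
    fun h k => (finite_monOn U k).subset (Set.inter_subset_inter_left _ h)
  have hd1 : ∀ x ∈ Y₁, 0 < degOn {r, s} x := by
    rintro _ ⟨x, -, rfl⟩
    exact degOn_pos.2 ⟨r, by simp, by simp⟩
  have hd2 : ∀ x ∈ Y₂, degOn {r, s} x = 0 :=
    fun x hx => degOn_eq_zero.2 fun v hv => (Finset.mem_sdiff.1 (hx v hv)).2
  have hd3 : ∀ x ∈ Y₃, 0 < degOn {r, s} x := by
    rintro _ ⟨x, -, rfl⟩
    exact degOn_pos.2 ⟨s, by simp, by simp⟩
  have hl1 : ∀ x ∈ Y₁, 0 < degOn L x := by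
    rintro _ ⟨x, -, rfl⟩
    exact degOn_pos.2 ⟨r, by simp, hrL⟩
  have hl3 : ∀ x ∈ Y₃, degOn L x = 0 := by
    rintro _ ⟨x, hx, rfl⟩
    rw [degOn_eq_zero]
    intro v hv
    rcases Multiset.mem_cons.1 hv with rfl | hv
    exacts [hsL, (Finset.mem_sdiff.1 (hx v hv)).2]
  have hcover : monSeries S U = classSeries (eqvSetoid S) Multiset.card (Y₁ ∪ (Y₂ ∪ Y₃)) := by
    refine classSeries_eq_of_cover (Set.union_subset hY₁U (Set.union_subset hY₂U hY₃U)) ?_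
    intro x hx
    suffices h : ∃ y ∈ Y₁ ∪ (Y₂ ∪ Y₃), Eqv S y x by
      obtain ⟨y, hy, hyx⟩ := h
      exact ⟨y, hy, hyx, hyx.card_eq⟩
    have hrx : ∀ y, r ∈ y → y ∈ monOn U → y ∈ Y₁ := by
      intro y hry hy
      obtain ⟨y, rfl⟩ := Multiset.exists_cons_of_mem hry
      exact ⟨y, fun v hv => hy v (Multiset.mem_cons_of_mem hv), rfl⟩
    by_cases h1 : r ∈ x
    · exact ⟨x, Or.inl (hrx x h1 hx), Eqv.refl _ _⟩
    by_cases h2 : s ∈ x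
    · obtain ⟨x', rfl⟩ := Multiset.exists_cons_of_mem h2
      by_cases h3 : ∃ v ∈ x', v ∈ L
      · obtain ⟨v, hv, hvL⟩ := h3
        obtain ⟨z, rfl⟩ := Multiset.exists_cons_of_mem hv
        have hvr : v ≠ r := by rintro rfl; exact h1 (by simp)
        obtain ⟨p, q⟩ := v
        rw [hL, mem_rowSegment] at hvL
        obtain ⟨h4, h5, h6⟩ := hvL
        dsimp only at h4 h5 h6
        subst h6
        have h7 : p ≤ x₁ := by
          by_contra h8
          have h9 : p = x₁ + 1 := by omega
          exact hvr (Prod.ext h9 rfl)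
        have he : Eqv S ((p, y₀) ::ₘ r ::ₘ z) (s ::ₘ (p, y₀ + 1) ::ₘ z) := by
          rw [Multiset.cons_swap s]
          exact Eqv.of_interval (hT.interval_mem h4 h7) z
        exact ⟨_, Or.inl (hrx _ (by simp) ((he.mem_monOn hU).2 hx)), he⟩
      · push Not at h3
        refine ⟨s ::ₘ x', Or.inr (Or.inr ⟨x', fun v hv => Finset.mem_sdiff.2 ⟨hx v ?_, h3 v hv⟩,
          rfl⟩), Eqv.refl _ _⟩
        exact Multiset.mem_cons_of_mem hv
    · refine ⟨x, Or.inr (Or.inl fun v hv => Finset.mem_sdiff.2 ⟨hx v hv, ?_⟩), Eqv.refl _ _⟩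
      rw [Finset.mem_insert, Finset.mem_singleton]
      rintro (rfl | rfl)
      exacts [h1 hv, h2 hv]
  have e1 : classSeries (eqvSetoid S) Multiset.card Y₁ = PowerSeries.X ^ 1 * monSeries S U := by
    refine classSeries_congr (fun x => r ::ₘ x) 1 (fun x _ => Multiset.card_cons _ _)
      (fun x hx => ⟨x, hx, rfl⟩) ?_ ?_
    · exact fun x _ y _ => ⟨fun h => Eqv.cons h r, fun h => hcS.cons h⟩
    · rintro _ ⟨x, hx, rfl⟩
      exact ⟨x, hx, Eqv.refl _ _, rfl⟩
  have e2 : classSeries (eqvSetoid S) Multiset.card Y₂ = PowerSeries.X ^ 0 *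
      monSeries (S.erase (x₁, y₀)) (U \ {r, s}) := by
    refine classSeries_congr id 0 (fun x _ => rfl) (fun x hx => hx) ?_
      fun x hx => ⟨x, hx, Eqv.refl _ _, rfl⟩
    intro x hx y _
    refine ⟨fun h => Eqv.mono (Finset.erase_subset _ _) h, fun h => ?_⟩
    refine Eqv.restrict (L := {r, s}) ?_ ?_ (fun v hv => (Finset.mem_sdiff.1 (hx v hv)).2) h
    · intro a b hab
      rcases hT.interval_erase hab with h | ⟨rfl, h1, -⟩
      · exact Or.inl h
      · right
        simp [hr, hs, h1]
    · intro v hv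
      rw [Finset.mem_insert, Finset.mem_singleton] at hv
      rcases hv with rfl | rfl
      exacts [hT.corner_notMem.1, hT.corner_notMem.2]
  have e3 : classSeries (eqvSetoid S) Multiset.card Y₃ = PowerSeries.X ^ 1 *
      monSeries (S \ rowSegment x₀ x₁ y₀) (U \ L) := by
    refine classSeries_congr (fun x => s ::ₘ x) 1 (fun x _ => Multiset.card_cons _ _)
      (fun x hx => ⟨x, hx, rfl⟩) ?_ ?_
    · intro x hx y _
      refine ⟨fun h => Eqv.cons (Eqv.mono Finset.sdiff_subset h) s, fun h => ?_⟩
      refine Eqv.restrict (L := L) ?_ hT.line_notMem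
        (fun v hv => (Finset.mem_sdiff.1 (hx v hv)).2) (hcS.cons h)
      intro a b hab
      exact (hT.interval_sdiff hab).imp id fun h => ⟨Or.inr h.1, Or.inl h.2⟩
    · rintro _ ⟨x, hx, rfl⟩
      exact ⟨x, hx, Eqv.refl _ _, rfl⟩
  have hsum : monSeries S U = PowerSeries.X * monSeries S U +
      (monSeries (S.erase (x₁, y₀)) (U \ {r, s}) + PowerSeries.X *
      monSeries (S \ rowSegment x₀ x₁ y₀) (U \ L)) := by
    conv_lhs => rw [hcover]
    -- The degree in `{r, s}` separates `Y₂` from the other families, and the degree on `L`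
    -- separates `Y₁` from `Y₃`.
    rw [classSeries_union (hfin hY₁U) (hfin (Set.union_subset hY₂U hY₃U)),
      classSeries_union (hfin hY₂U) (hfin hY₃U), e1, e2, e3, pow_one, pow_zero, one_mul]
    · intro x hx y hy h
      have := hR.degOn_eq h
      have h2 := hd2 x hx
      have h3 := hd3 y hy
      omega
    · rintro x hx y (hy | hy) h
      · have := hR.degOn_eq h
        have h1 := hd1 x hx
        have h2 := hd2 y hy
        omega
      · have : degOn L x = degOn L y := hT.rowClosed.degOn_eq h
        have h1 := hl1 x hx
        have h2 := hl3 y hy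
        omega
  rw [sub_mul, one_mul]
  linear_combination hsum

end IsTail

/-! ### The normalised series -/

/-- The unit `1 - t`. -/
noncomputable def oneSubX : ℤ⟦X⟧ˣ := (PowerSeries.invOneSubPow ℤ 1)⁻¹

theorem oneSubX_val : (oneSubX : ℤ⟦X⟧) = 1 - PowerSeries.X := by
  have := PowerSeries.invOneSubPow_inv_eq_one_sub_pow ℤ 1
  rwa [pow_one] at this

/-- The numerator of `monSeries S U` over `(1 - t) ^ (|U| - |S|)`. -/
noncomputable def numer (S : Finset Cell) (U : Finset (ℤ × ℤ)) : ℤ⟦X⟧ :=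
  ((oneSubX ^ ((U.card : ℤ) - S.card) : ℤ⟦X⟧ˣ) : ℤ⟦X⟧) * monSeries S U

theorem oneSubX_zpow_succ (n : ℤ) : ((oneSubX ^ (n + 1) : ℤ⟦X⟧ˣ) : ℤ⟦X⟧) =
    ((oneSubX ^ n : ℤ⟦X⟧ˣ) : ℤ⟦X⟧) * (1 - PowerSeries.X) := by
  rw [zpow_add_one, Units.val_mul, oneSubX_val]

/-- A variable outside `vertices S` is free over the classes and multiplies the series by `1 / (1 -
t)`, which the exponent in `numer` compensates. Hence any convenient set of vertices may be used. -/
theorem numer_insert (hc : Cancellative S) {U : Finset (ℤ × ℤ)} {v : ℤ × ℤ}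
    (hv : v ∉ vertices S) (hvU : v ∉ U) : numer S (insert v U) = numer S U := by
  have hinv : ∀ x y, Eqv S x y → degOn {v} x = degOn {v} y := fun x y h =>
    h.degOn_eq_of_disjoint (by simpa using hv)
  set Y : Set Mon := (fun x => v ::ₘ x) '' monOn (insert v U) with hY
  have hYU : Y ⊆ monOn (insert v U) := by
    rintro _ ⟨x, hx, rfl⟩ w hw
    rcases Multiset.mem_cons.1 hw with rfl | hw
    exacts [Finset.mem_insert_self _ _, hx w hw]
  have hU : monOn U ⊆ monOn (insert v U) := fun x hx w hw => Finset.mem_insert_of_mem (hx w hw)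
  have hunion : monOn (insert v U) = Y ∪ monOn U := by
    refine Set.Subset.antisymm ?_ (Set.union_subset hYU hU)
    intro x hx
    by_cases h : v ∈ x
    · obtain ⟨x, rfl⟩ := Multiset.exists_cons_of_mem h
      exact Or.inl ⟨x, fun w hw => hx w (Multiset.mem_cons_of_mem hw), rfl⟩
    · exact Or.inr fun w hw => (Finset.mem_insert.1 (hx w hw)).resolve_left
        fun hwv => h (hwv ▸ hw)
  have hfin : ∀ {Y : Set Mon}, Y ⊆ monOn (insert v U) → ∀ k, (Y ∩ {x | x.card = k}).Finite :=
    fun h k => (finite_monOn _ k).subset (Set.inter_subset_inter_left _ h)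
  have e1 : classSeries (eqvSetoid S) Multiset.card Y =
      PowerSeries.X ^ 1 * monSeries S (insert v U) := by
    refine classSeries_congr (fun x => v ::ₘ x) 1 (fun x _ => Multiset.card_cons _ _)
      (fun x hx => ⟨x, hx, rfl⟩) ?_ ?_
    · exact fun x _ y _ => ⟨fun h => Eqv.cons h v, fun h => hc.cons h⟩
    · rintro _ ⟨x, hx, rfl⟩
      exact ⟨x, hx, Eqv.refl _ _, rfl⟩
  have hsum : monSeries S (insert v U) =
      PowerSeries.X * monSeries S (insert v U) + monSeries S U := by
    conv_lhs => rw [monSeries, hunion]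
    rw [classSeries_union (hfin hYU) (hfin hU), e1, pow_one]
    · rfl
    · rintro _ ⟨x, hx, rfl⟩ y hy h
      have h1 := hinv _ _ h
      have h2 : degOn {v} y = 0 := degOn_eq_zero.2 fun w hw => by
        rw [Finset.mem_singleton]
        rintro rfl
        exact hvU (hy w hw)
      rw [degOn_cons, h2] at h1
      simp at h1
  rw [numer, numer, Finset.card_insert_of_notMem hvU]
  push_cast
  rw [show (U.card : ℤ) + 1 - S.card = (U.card - S.card) + 1 by ring, oneSubX_zpow_succ]
  linear_combination ((oneSubX ^ ((U.card : ℤ) - S.card) : ℤ⟦X⟧ˣ) : ℤ⟦X⟧) * hsum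

theorem numer_eq (hc : Cancellative S) {U : Finset (ℤ × ℤ)} (hU : vertices S ⊆ U) :
    numer S U = numer S (vertices S) := by
  suffices h : ∀ W : Finset (ℤ × ℤ), Disjoint W (vertices S) →
      numer S (vertices S ∪ W) = numer S (vertices S) by
    have := h (U \ vertices S) Finset.sdiff_disjoint
    rwa [Finset.union_sdiff_of_subset hU] at this
  intro W
  induction W using Finset.induction_on with
  | empty => simp
  | insert v W hv ih =>
    intro hd
    rw [Finset.disjoint_insert_left] at hd
    rw [Finset.union_insert, numer_insert hc hd.1, ih hd.2]
    rw [Finset.mem_union, not_or]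
    exact ⟨hd.1, hv⟩

/-- The numerator of the series of `S`. -/
noncomputable def rookSeries (S : Finset Cell) : ℤ⟦X⟧ := numer S (vertices S)

/-- Dropping the last cell with the two ends of its free edge, or the whole run with its top line,
which has one vertex more than the run has cells, lowers the exponent by one in both cases. This
absorbs the factor `1 - t` of `IsTail.monSeries_eq`. -/
theorem IsTail.rookSeries_eq {x₀ x₁ y₀ : ℤ} (hT : IsTail S x₀ x₁ y₀)
    (hc : Cancellative (S.erase (x₁, y₀))) (hc' : Cancellative (S \ rowSegment x₀ x₁ y₀)) :
    rookSeries S = rookSeries (S.erase (x₁, y₀)) +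
      PowerSeries.X * rookSeries (S \ rowSegment x₀ x₁ y₀) := by
  have h := hT.monSeries_eq hc subset_rfl
  have hmem := hT.sub x₁ hT.le le_rfl
  have hNU : ({(x₁ + 1, y₀ + 1), (x₁ + 1, y₀)} : Finset (ℤ × ℤ)) ⊆ vertices S := by
    intro v hv
    refine mem_vertices_iff.2 ⟨_, hmem, ?_⟩
    rw [Finset.mem_insert, Finset.mem_singleton] at hv
    rcases hv with rfl | rfl <;> simp [mem_cellVertices]
  have hLU : rowSegment x₀ (x₁ + 1) (y₀ + 1) ⊆ vertices S := by
    rintro ⟨p, q⟩ hv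
    rw [mem_rowSegment] at hv
    obtain ⟨h1, h2, h3⟩ := hv
    dsimp only at h1 h2 h3
    subst h3
    by_cases hp : p ≤ x₁
    · exact mem_vertices_iff.2 ⟨_, hT.sub p h1 hp, by simp [mem_cellVertices]⟩
    · obtain rfl : p = x₁ + 1 := by omega
      exact mem_vertices_iff.2 ⟨_, hmem, by simp [mem_cellVertices]⟩
  have hTS : rowSegment x₀ x₁ y₀ ⊆ S := by
    rintro ⟨p, q⟩ hv
    rw [mem_rowSegment] at hv
    obtain ⟨h1, h2, h3⟩ := hv
    dsimp only at h1 h2 h3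
    subst h3
    exact hT.sub p h1 h2
  have h1 : vertices (S.erase (x₁, y₀)) ⊆ vertices S \ {(x₁ + 1, y₀ + 1), (x₁ + 1, y₀)} := by
    intro v hv
    refine Finset.mem_sdiff.2 ⟨vertices_mono (Finset.erase_subset _ _) hv, ?_⟩
    rw [Finset.mem_insert, Finset.mem_singleton]
    rintro (rfl | rfl)
    exacts [hT.corner_notMem.1 hv, hT.corner_notMem.2 hv]
  have h2 : vertices (S \ rowSegment x₀ x₁ y₀) ⊆
      vertices S \ rowSegment x₀ (x₁ + 1) (y₀ + 1) := by
    intro v hv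
    exact Finset.mem_sdiff.2 ⟨vertices_mono Finset.sdiff_subset hv,
      fun hvL => hT.line_notMem v hvL hv⟩
  have c1 : (((vertices S \ {(x₁ + 1, y₀ + 1), (x₁ + 1, y₀)}).card : ℕ) : ℤ) -
      (S.erase (x₁, y₀)).card = ((vertices S).card : ℤ) - S.card - 1 := by
    have e1 := Finset.card_sdiff_add_card_eq_card hNU
    have e2 := Finset.card_erase_add_one hmem
    have e3 : ({(x₁ + 1, y₀ + 1), (x₁ + 1, y₀)} : Finset (ℤ × ℤ)).card = 2 :=
      Finset.card_pair (by simp)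
    omega
  have c2 : (((vertices S \ rowSegment x₀ (x₁ + 1) (y₀ + 1)).card : ℕ) : ℤ) -
      (S \ rowSegment x₀ x₁ y₀).card = ((vertices S).card : ℤ) - S.card - 1 := by
    have e1 := Finset.card_sdiff_add_card_eq_card hLU
    have e2 := Finset.card_sdiff_add_card_eq_card hTS
    have hle := hT.le
    have e3 := card_rowSegment (x₀ := x₀) (x₁ := x₁) (y := y₀) (by omega)
    have e4 := card_rowSegment (x₀ := x₀) (x₁ := x₁ + 1) (y := y₀ + 1) (by omega)
    omega
  rw [rookSeries, rookSeries, rookSeries, ← numer_eq hc h1, ← numer_eq hc' h2, numer, numer, numer,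
    c1, c2]
  have c3 : ((vertices S).card : ℤ) - S.card = ((vertices S).card : ℤ) - S.card - 1 + 1 := by ring
  rw [c3, oneSubX_zpow_succ, add_sub_cancel_right]
  linear_combination ((oneSubX ^ ((((vertices S).card : ℤ) - S.card - 1)) : ℤ⟦X⟧ˣ) : ℤ⟦X⟧) * h

theorem cancellative_empty : Cancellative ∅ := by
  have : ∀ x y, Eqv ∅ x y → x = y := by
    intro x y h
    refine h.invariant id ?_
    rintro _ _ ⟨a, b, z, hab, -, -⟩
    exact absurd (cell_mem_of_interval hab le_rfl hab.1 le_rfl hab.2.1) (by simp)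
  intro x y z h
  rw [add_right_cancel (this _ _ h)]
  exact Eqv.refl _ _

theorem rookSeries_empty : rookSeries ∅ = 1 := by
  have hv : vertices ∅ = ∅ := rfl
  rw [rookSeries, numer, hv]
  have : monOn ∅ = {0} := by
    ext x
    simp only [monOn, Finset.notMem_empty, imp_false, Set.mem_ofPred_eq, Set.mem_singleton_iff]
    exact Multiset.eq_zero_iff_forall_notMem.symm
  ext k
  simp only [Finset.card_empty, Nat.cast_zero, sub_zero, zpow_zero, Units.val_one, one_mul,
    monSeries, classSeries, PowerSeries.coeff_mk, this, PowerSeries.coeff_one]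
  by_cases hk : k = 0
  · subst hk
    have : ({0} : Set Mon) ∩ {x | x.card = 0} = {0} := by ext x; simp
    rw [this]; simp [classCount]
  · have : ({0} : Set Mon) ∩ {x | x.card = k} = ∅ := by
      ext x
      simp only [Set.mem_inter_iff, Set.mem_singleton_iff, Set.mem_ofPred_eq,
        Set.mem_empty_iff_false, iff_false, not_and]
      rintro rfl h
      exact hk (by simpa using h.symm)
    rw [this]; simp [classCount, hk]

end Polyomino

namespace Polyomino

variable {x y z : Mon}

/-! ### A block bending down at both ends -/

/-- The shift by one row downwards. -/
def down (v : ℤ × ℤ) : ℤ × ℤ := (v.1, v.2 - 1)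

/-- Over `K` one can place a block in row `y + 1` from `(c, y + 1)` to `(b, y + 1)` that meets `K`
in an edge of `(c, y)` and an edge of `(b, y)`; to the right of `(b, y)` there is the block from
`(b, y)` to `(d, y)`, whose top line meets no other cell of `K`. -/
structure IsHat (K : Finset Cell) (c b d y : ℤ) : Prop where
  cb : c + 2 ≤ b
  bd : b + 1 ≤ d
  left : (c, y) ∈ K
  right : ∀ x, b ≤ x → x ≤ d → (x, y) ∈ K
  top : ∀ D ∈ K, ∀ x, c ≤ x → x ≤ b + 1 → (x, y + 2) ∉ cellVertices D
  free : ∀ D ∈ K, ∀ x, c + 2 ≤ x → x ≤ b - 1 → (x, y + 1) ∉ cellVertices D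
  colL : ∀ D ∈ K, D ≠ (c, y) → (c + 1, y + 1) ∉ cellVertices D ∧ (c + 1, y) ∉ cellVertices D
  colR : ∀ D ∈ K, D ≠ (b, y) → (b, y + 1) ∉ cellVertices D ∧ (b, y) ∉ cellVertices D
  colR' : ∀ D ∈ K, D ≠ (b, y) → D ≠ (b + 1, y) →
    (b + 1, y + 1) ∉ cellVertices D ∧ (b + 1, y) ∉ cellVertices D
  line : ∀ D ∈ K, ¬ (b ≤ D.1 ∧ D.1 ≤ d ∧ D.2 = y) → ∀ x, b ≤ x → x ≤ d + 1 →
    (x, y + 1) ∉ cellVertices D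

theorem substVar_down {c b y₀ : ℤ} (v : ℤ × ℤ) :
    substVar (rowSegment c b (y₀ + 2)) down v =
      if c ≤ v.1 ∧ v.1 ≤ b ∧ v.2 = y₀ + 2 then (v.1, y₀ + 1) else v := by
  simp only [substVar, mem_rowSegment]
  split_ifs with h
  · rw [down, h.2.2]; exact Prod.ext rfl (by dsimp only; ring)
  · rfl

/-! ### Putting a row of cells on top -/

section Top

variable {K : Finset Cell} {c b y₀ : ℤ}

/-- The intervals of `K` with the row `[c, b] × {y₀ + 1}` put on top. -/
theorem interval_top (hcb : c ≤ b)
    (htop : ∀ D ∈ K, ∀ x, c ≤ x → x ≤ b + 1 → (x, y₀ + 2) ∉ cellVertices D)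
    (hsep : ∀ x, c ≤ x → x + 1 ≤ b → (x, y₀) ∈ K → (x + 1, y₀) ∉ K)
    (hbot : ∀ x, c ≤ x → x ≤ b → (x, y₀) ∈ K → (x, y₀ - 1) ∉ K) {p q : ℤ × ℤ}
    (h : IsInnerInterval (K ∪ rowSegment c b (y₀ + 1)) p q) :
    IsInnerInterval K p q ∨ (c ≤ p.1 ∧ q.1 ≤ b + 1 ∧ q.2 = y₀ + 2 ∧
      (p.2 = y₀ + 1 ∨ p.2 = y₀ ∧ q.1 = p.1 + 1 ∧ (p.1, y₀) ∈ K)) := by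
  have hmem : ∀ u v, p.1 ≤ u → u < q.1 → p.2 ≤ v → v < q.2 → (u, v) ∈ K ∨
      (c ≤ u ∧ u ≤ b ∧ v = y₀ + 1) := by
    intro u v h1 h2 h3 h4
    have := cell_mem_of_interval h h1 h2 h3 h4
    rwa [Finset.mem_union, mem_rowSegment] at this
  by_cases hc : ∃ u, c ≤ u ∧ u ≤ b ∧ p.1 ≤ u ∧ u < q.1 ∧ p.2 ≤ y₀ + 1 ∧ y₀ + 1 < q.2
  · right
    obtain ⟨u, h1, h2, h3, h4, h5, h6⟩ := hc
    have hq2 : q.2 = y₀ + 2 := by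
      by_contra hne
      rcases hmem u (y₀ + 2) h3 h4 (by omega) (by omega) with hk | hk
      · exact htop _ hk u h1 (by omega) (by simp [mem_cellVertices])
      · omega
    have hp1 : c ≤ p.1 := by
      by_contra hne
      rcases hmem (c - 1) (y₀ + 1) (by omega) (by omega) (by omega) (by omega) with hk | hk
      · exact htop _ hk c le_rfl (by omega) (by simp [mem_cellVertices]; omega)
      · omega
    have hq1 : q.1 ≤ b + 1 := by
      by_contra hne
      rcases hmem (b + 1) (y₀ + 1) (by omega) (by omega) (by omega) (by omega) with hk | hk
      · exact htop _ hk (b + 1) (by omega) le_rfl (by simp [mem_cellVertices]; omega)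
      · omega
    refine ⟨hp1, hq1, hq2, ?_⟩
    by_cases hp2 : p.2 = y₀ + 1
    · exact Or.inl hp2
    · have hlt := h.1
      have hK : ∀ v, p.1 ≤ v → v < q.1 → (v, y₀) ∈ K := by
        intro v h7 h8
        rcases hmem v y₀ h7 h8 (by omega) (by omega) with hk | hk
        · exact hk
        · omega
      refine Or.inr ⟨?_, ?_, hK _ le_rfl h.1⟩
      · by_contra hne
        rcases hmem p.1 (y₀ - 1) le_rfl h.1 (by omega) (by omega) with hk | hk
        · exact hbot _ hp1 (by omega) (hK _ le_rfl h.1) hk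
        · omega
      · by_contra hne
        exact hsep p.1 hp1 (by omega) (hK _ le_rfl h.1) (hK _ (by omega) (by omega))
  · left
    rw [interval_iff]
    refine ⟨h.1, h.2.1, fun u v h1 h2 h3 h4 => (hmem u v h1 h2 h3 h4).resolve_right ?_⟩
    rintro ⟨h5, h6, rfl⟩
    exact hc ⟨u, h5, h6, h1, h2, h3, h4⟩

theorem top_notMem (htop : ∀ D ∈ K, ∀ x, c ≤ x → x ≤ b + 1 → (x, y₀ + 2) ∉ cellVertices D) :
    ∀ v ∈ vertices K, ¬ (c ≤ v.1 ∧ v.1 ≤ b + 1 ∧ v.2 = y₀ + 2) := by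
  rintro v hv ⟨h1, h2, h3⟩
  obtain ⟨D, hD, hvD⟩ := mem_vertices_iff.1 hv
  exact htop D hD v.1 h1 h2 (by rw [← h3]; exact hvD)

/-- An interval of height two reaching into the new row stands on a single cell of `K`, because of
`hsep` and `hbot`. Only the exchange condition depends on the shape further below; it stays a
hypothesis so that the full row and its two end cells can be treated alike. -/
theorem isRees_top (hcb : c ≤ b) (hcanc : Cancellative K)
    (htop : ∀ D ∈ K, ∀ x, c ≤ x → x ≤ b + 1 → (x, y₀ + 2) ∉ cellVertices D)
    (hsep : ∀ x, c ≤ x → x + 1 ≤ b → (x, y₀) ∈ K → (x + 1, y₀) ∉ K)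
    (hbot : ∀ x, c ≤ x → x ≤ b → (x, y₀) ∈ K → (x, y₀ - 1) ∉ K)
    (hexch : ∀ x y,
      Eqv K (substMon (rowSegment c (b + 1) (y₀ + 2)) down x)
        (substMon (rowSegment c (b + 1) (y₀ + 2)) down y) →
      (∀ v ∈ rowSegment c (b + 1) (y₀ + 2), v ∈ x → v ∉ y) →
      (∃ v ∈ x, v ∈ rowSegment c (b + 1) (y₀ + 2)) →
      (∃ v ∈ y, v ∈ rowSegment c (b + 1) (y₀ + 2)) →
      ∃ x' y', Eqv (K ∪ rowSegment c b (y₀ + 1)) x x' ∧ Eqv (K ∪ rowSegment c b (y₀ + 1)) y y' ∧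
        ∃ v ∈ rowSegment c (b + 1) (y₀ + 2), v ∈ x' ∧ v ∈ y') :
    IsRees K (K ∪ rowSegment c b (y₀ + 1)) (rowSegment c (b + 1) (y₀ + 2)) down where
  sub := Finset.subset_union_left
  canc := hcanc
  move := by
    intro p q hpq
    rcases interval_top hcb htop hsep hbot hpq with h | ⟨h1, h2, h3, h4⟩
    · obtain ⟨m1, m2, m3, m4⟩ := corner_mem_vertices h
      have key := top_notMem htop
      simp only [substVar_down]
      rw [if_neg (key _ m1), if_neg (key _ m2), if_neg (key _ m3), if_neg (key _ m4)]
      exact Eqv.of_interval h 0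
    · obtain ⟨p1, p2⟩ := p
      obtain ⟨q1, q2⟩ := q
      have hlt := hpq.1
      dsimp only at h1 h2 h3 h4 hlt
      subst h3
      have e1 : p1 ≤ b + 1 := by omega
      have e2 : c ≤ q1 := by omega
      have e3 : p2 ≠ y₀ + 2 := by omega
      simp only [substVar_down, h1, h2, e1, e2, e3, true_and, if_true, and_false, if_false]
      -- After the substitution the move of an interval of height one is trivial, and that of height
      -- two becomes the move of the cell of `K` underneath.
      rcases h4 with rfl | ⟨rfl, rfl, hK⟩
      · rw [Multiset.pair_comm]; exact Eqv.refl _ _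
      · refine Eqv.of_interval (a := (p1, p2)) (b := (p1 + 1, p2 + 1)) ?_ 0
        rw [interval_iff]
        refine ⟨by dsimp only; omega, by dsimp only; omega, fun u v h5 h6 h7 h8 => ?_⟩
        dsimp only at h5 h6 h7 h8
        obtain rfl : u = p1 := by omega
        obtain rfl : v = p2 := by omega
        exact hK
  deg := by
    intro p q hpq
    simp only [mem_rowSegment]
    rcases interval_top hcb htop hsep hbot hpq with h | ⟨h1, h2, h3, h4⟩
    · obtain ⟨m1, m2, m3, m4⟩ := corner_mem_vertices h
      have key := top_notMem htop
      rw [if_neg (key _ m1), if_neg (key _ m2), if_neg (key _ m3), if_neg (key _ m4)]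
    · have hlt := hpq.1
      have e1 : p.1 ≤ b + 1 := by omega
      have e2 : c ≤ q.1 := by omega
      have e3 : p.2 ≠ y₀ + 2 := by omega
      simp [h1, h2, h3, e1, e2, e3]
  exch := fun x y h hd hc hpos =>
    hexch x y h hc (degOn_pos.1 hpos) (degOn_pos.1 (hd ▸ hpos))

/-- If `w` below `v` occurs in `y`, any other top variable in `y` can be exchanged for `v`. -/
theorem exchange_row {u v : ℤ} (hu : c ≤ u) (hu' : u ≤ b + 1) (hv : c ≤ v) (hv' : v ≤ b + 1)
    (hy : (u, y₀ + 2) ∈ y) (hw : (v, y₀ + 1) ∈ y) :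
    ∃ y', Eqv (K ∪ rowSegment c b (y₀ + 1)) y y' ∧ (v, y₀ + 2) ∈ y' := by
  have hint : ∀ s t : ℤ, c ≤ s → s < t → t ≤ b + 1 →
      IsInnerInterval (K ∪ rowSegment c b (y₀ + 1)) (s, y₀ + 1) (t, y₀ + 2) := by
    intro s t h1 h2 h3
    rw [interval_iff]
    refine ⟨h2, by dsimp only; omega, fun e f h4 h5 h6 h7 => Finset.mem_union_right _ ?_⟩
    dsimp only at h4 h5 h6 h7
    rw [mem_rowSegment]
    dsimp only
    omega
  rcases eq_or_ne u v with rfl | huv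
  · exact ⟨y, Eqv.refl _ _, hy⟩
  obtain ⟨z, rfl⟩ := exists_add_of_mem_two hy hw (by simp)
  rcases lt_or_gt_of_ne huv with h | h
  · exact ⟨_, (Eqv.of_interval (hint u v hu h hv') z).symm, by simp⟩
  · refine ⟨_, (?_ : Eqv _ _ ((v, y₀ + 2) ::ₘ (u, y₀ + 1) ::ₘ z)), by simp⟩
    rw [Multiset.cons_swap]
    exact Eqv.of_interval (hint v u hv h hu') z

/-- The way invariants are used: a top variable of `x` that is substituted into `L` gives the
substitute of `y` positive degree on `L`. By `hy` this degree does not come from a top variable of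
`y`, so `y` itself contains a vertex of `L`. -/
theorem mem_of_substMon {L : Finset (ℤ × ℤ)}
    (hdeg : degOn L (substMon (rowSegment c (b + 1) (y₀ + 2)) down x) =
      degOn L (substMon (rowSegment c (b + 1) (y₀ + 2)) down y)) {v : ℤ} (hv : c ≤ v)
    (hv' : v ≤ b + 1) (hL : (v, y₀ + 1) ∈ L) (hx : (v, y₀ + 2) ∈ x)
    (hy : ∀ u, c ≤ u → u ≤ b + 1 → (u, y₀ + 1) ∈ L → (u, y₀ + 2) ∉ y) : ∃ w ∈ y, w ∈ L := by
  have h0 : 0 < degOn L (substMon (rowSegment c (b + 1) (y₀ + 2)) down x) := by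
    rw [degOn_pos]
    refine ⟨_, Multiset.mem_map.2 ⟨_, hx, rfl⟩, ?_⟩
    rw [substVar_down]
    simpa [hv, hv'] using hL
  rw [hdeg, degOn_pos] at h0
  obtain ⟨w', hw', hwL⟩ := h0
  obtain ⟨w, hw, rfl⟩ := Multiset.mem_map.1 hw'
  rw [substVar_down] at hwL
  split_ifs at hwL with h
  · refine absurd ?_ (hy w.1 h.1 h.2.1 hwL)
    rw [← h.2.2]; exact hw
  · exact ⟨w, hw, hwL⟩

/-- Exchange along a column bounded by the cell `(p, y₀)`. -/
theorem exchange_col {u v p : ℤ} (hp : c ≤ p) (hp' : p ≤ b) (hpK : (p, y₀) ∈ K)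
    (huv : u = p ∧ v = p + 1 ∨ u = p + 1 ∧ v = p)
    (hL : ColClosed K {(v, y₀ + 1), (v, y₀)})
    (h : Eqv K (substMon (rowSegment c (b + 1) (y₀ + 2)) down x)
      (substMon (rowSegment c (b + 1) (y₀ + 2)) down y))
    (hx : (v, y₀ + 2) ∈ x) (hy : (v, y₀ + 2) ∉ y) (hu : (u, y₀ + 2) ∈ y) :
    ∃ y', Eqv (K ∪ rowSegment c b (y₀ + 1)) y y' ∧ (v, y₀ + 2) ∈ y' := by
  obtain ⟨w, hw, hwL⟩ := mem_of_substMon (hL.degOn_eq h) (v := v) (by omega) (by omega) (by simp)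
    hx (by
      intro t _ _ ht
      simp only [Finset.mem_insert, Finset.mem_singleton, Prod.mk.injEq] at ht
      obtain rfl : t = v := by omega
      exact hy)
  rw [Finset.mem_insert, Finset.mem_singleton] at hwL
  rcases hwL with rfl | rfl
  · exact exchange_row (by omega) (by omega) (by omega) (by omega) hu hw
  -- The vertex found is two rows below the top line; the interval of height two over the cell `(p,
  -- y₀)` makes the exchange.
  · have hint : IsInnerInterval (K ∪ rowSegment c b (y₀ + 1)) (p, y₀) (p + 1, y₀ + 2) := by
      rw [interval_iff]
      refine ⟨by dsimp only; omega, by dsimp only; omega, fun e f h4 h5 h6 h7 => ?_⟩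
      dsimp only at h4 h5 h6 h7
      obtain rfl : e = p := by omega
      rw [Finset.mem_union, mem_rowSegment]
      dsimp only
      rcases (by omega : f = y₀ ∨ f = y₀ + 1) with rfl | rfl
      · exact Or.inl hpK
      · right; omega
    obtain ⟨z, rfl⟩ := exists_add_of_mem_two hu hw (by simp)
    rcases huv with ⟨rfl, rfl⟩ | ⟨rfl, rfl⟩
    · exact ⟨_, (Eqv.of_interval hint z).symm, by simp⟩
    · refine ⟨_, (?_ : Eqv _ _ ((v, y₀ + 2) ::ₘ (v + 1, y₀) ::ₘ z)), by simp⟩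
      rw [Multiset.cons_swap]
      exact Eqv.of_interval hint z

end Top

theorem colClosed_pair {K : Finset Cell} {v y₀ : ℤ} (h : ∀ D ∈ K,
    (D.1 = v ∨ D.1 + 1 = v) ∧ D.2 = y₀ ∨
      (v, y₀ + 1) ∉ cellVertices D ∧ (v, y₀) ∉ cellVertices D) :
    ColClosed K {(v, y₀ + 1), (v, y₀)} := by
  rintro ⟨p, q⟩ hD
  have := h _ hD
  simp only [mem_cellVertices, Prod.mk.injEq, not_or, not_and] at this
  simp only [Finset.mem_insert, Finset.mem_singleton, Prod.mk.injEq]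
  omega

/-! ### Exchange of top variables over a hat -/

namespace IsHat

variable {K : Finset Cell} {c b d y₀ : ℤ} (H : IsHat K c b d y₀)
include H

theorem colClosed_left : ColClosed K {(c + 1, y₀ + 1), (c + 1, y₀)} := by
  refine colClosed_pair fun D hD => ?_
  by_cases h : D = (c, y₀)
  · subst h; left; simp
  · exact Or.inr (H.colL D hD h)

theorem colClosed_right : ColClosed K {(b, y₀ + 1), (b, y₀)} := by
  refine colClosed_pair fun D hD => ?_
  by_cases h : D = (b, y₀)
  · subst h; left; simp
  · exact Or.inr (H.colR D hD h)

theorem colClosed_right' : ColClosed K {(b + 1, y₀ + 1), (b + 1, y₀)} := by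
  refine colClosed_pair fun D hD => ?_
  by_cases h : D = (b, y₀)
  · subst h; left; simp
  by_cases h' : D = (b + 1, y₀)
  · subst h'; left; simp
  · exact Or.inr (H.colR' D hD h h')

theorem rowClosed_line : RowClosed K (rowSegment b (d + 1) (y₀ + 1)) := by
  rintro ⟨p, q⟩ hD
  simp only [mem_rowSegment]
  by_cases hc : b ≤ p ∧ p ≤ d ∧ q = y₀
  · omega
  · have key := H.line _ hD hc
    simp only [mem_cellVertices, Prod.mk.injEq] at key
    constructor
    · constructor
      · intro h; exact absurd (Or.inl ⟨rfl, h.2.2.symm⟩) (key _ h.1 h.2.1)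
      · intro h; exact absurd (Or.inr (Or.inl ⟨rfl, h.2.2.symm⟩)) (key _ h.1 h.2.1)
    · constructor
      · intro h; exact absurd (Or.inr (Or.inr (Or.inl ⟨rfl, h.2.2.symm⟩))) (key _ h.1 h.2.1)
      · intro h; exact absurd (Or.inr (Or.inr (Or.inr ⟨rfl, h.2.2.symm⟩))) (key _ h.1 h.2.1)

theorem free_notMem : ∀ v ∈ rowSegment (c + 2) (b - 1) (y₀ + 1), v ∉ vertices K := by
  intro v hv h
  obtain ⟨D, hD, hvD⟩ := mem_vertices_iff.1 h
  rw [mem_rowSegment] at hv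
  exact H.free D hD v.1 hv.1 hv.2.1 (by rw [← hv.2.2]; exact hvD)

theorem below_cases {x : ℤ} (h1 : c ≤ x) (h2 : x ≤ b) (h : (x, y₀) ∈ K) : x = c ∨ x = b := by
  by_contra hne
  rcases eq_or_ne x (c + 1) with rfl | h3
  · exact (H.colL _ h (by simp)).1 (by simp [mem_cellVertices])
  · exact H.free _ h x (by omega) (by omega) (by simp [mem_cellVertices])

theorem bottom {x : ℤ} (h1 : c ≤ x) (h2 : x ≤ b) (h : (x, y₀) ∈ K) : (x, y₀ - 1) ∉ K := by
  intro h3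
  rcases H.below_cases h1 h2 h with rfl | rfl
  · exact (H.colL _ h3 (by simp)).2 (by simp [mem_cellVertices])
  · exact (H.colR _ h3 (by simp)).2 (by simp [mem_cellVertices])

/-- Of the two columns of the cell `(c, y₀)` only the one through `c + 1` is known to carry an
invariant, since `K` may have further cells to the left. So it is always the top variable at `c + 1`
that is exchanged in. -/
theorem isRees_left (hc : Cancellative K) :
    IsRees K (K ∪ rowSegment c c (y₀ + 1)) (rowSegment c (c + 1) (y₀ + 2)) down := by
  have hcb := H.cb
  refine isRees_top le_rfl hc (fun D hD x h1 h2 => H.top D hD x h1 (by omega))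
    (fun x h1 h2 => by omega) (fun x h1 h2 => H.bottom h1 (by omega)) ?_
  rintro x y h hne ⟨⟨v, v'⟩, hv, hvN⟩ ⟨⟨w, w'⟩, hw, hwN⟩
  have hvN' := mem_rowSegment.1 hvN
  have hwN' := mem_rowSegment.1 hwN
  dsimp only at hvN' hwN'
  obtain rfl := hvN'.2.2
  obtain rfl := hwN'.2.2
  have hvw : v ≠ w := by rintro rfl; exact hne _ hvN hv hw
  rcases (by omega : v = c ∧ w = c + 1 ∨ v = c + 1 ∧ w = c) with ⟨rfl, rfl⟩ | ⟨rfl, rfl⟩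
  · obtain ⟨x', hx', hm⟩ := exchange_col (p := v) (u := v) le_rfl le_rfl H.left (Or.inl ⟨rfl, rfl⟩)
      H.colClosed_left h.symm hw (fun h' => hne _ hwN h' hw) hv
    exact ⟨x', y, hx', Eqv.refl _ _, _, hwN, hm, hw⟩
  · obtain ⟨y', hy', hm⟩ := exchange_col (p := w) (u := w) le_rfl le_rfl H.left (Or.inl ⟨rfl, rfl⟩)
      H.colClosed_left h hv (hne _ hvN hv) hw
    exact ⟨x, y', Eqv.refl _ _, hy', _, hvN, hv, hm⟩

theorem isRees_right (hc : Cancellative K) :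
    IsRees K (K ∪ rowSegment b b (y₀ + 1)) (rowSegment b (b + 1) (y₀ + 2)) down := by
  have hcb := H.cb
  have hbK := H.right b le_rfl (by have := H.bd; omega)
  refine isRees_top le_rfl hc (fun D hD x h1 h2 => H.top D hD x (by omega) (by omega))
    (fun x h1 h2 => by omega) (fun x h1 h2 => H.bottom (by omega) (by omega)) ?_
  rintro x y h hne ⟨⟨v, v'⟩, hv, hvN⟩ ⟨⟨w, w'⟩, hw, hwN⟩
  have hvN' := mem_rowSegment.1 hvN
  have hwN' := mem_rowSegment.1 hwN
  dsimp only at hvN' hwN'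
  obtain rfl := hvN'.2.2
  obtain rfl := hwN'.2.2
  have hvw : v ≠ w := by rintro rfl; exact hne _ hvN hv hw
  rcases (by omega : v = b ∧ w = b + 1 ∨ v = b + 1 ∧ w = b) with ⟨rfl, rfl⟩ | ⟨rfl, rfl⟩
  · obtain ⟨y', hy', hm⟩ := exchange_col (p := v) (u := v + 1) le_rfl le_rfl hbK
      (Or.inr ⟨rfl, rfl⟩) H.colClosed_right h hv (hne _ hvN hv) hw
    exact ⟨x, y', Eqv.refl _ _, hy', _, hvN, hv, hm⟩
  · obtain ⟨x', hx', hm⟩ := exchange_col (p := w) (u := w + 1) le_rfl le_rfl hbK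
      (Or.inr ⟨rfl, rfl⟩) H.colClosed_right h.symm hw (fun h' => hne _ hwN h' hw) hv
    exact ⟨x', y, hx', Eqv.refl _ _, _, hwN, hm, hw⟩

/-- In the right block, the variable at `(v, y₀ + 1)` can be exchanged in. -/
theorem exchange_line {v p : ℤ} (hv : v = b ∨ v = b + 1) (hp : b ≤ p) (hp' : p ≤ d + 1)
    (h1 : (p, y₀ + 1) ∈ y) (h2 : (v, y₀) ∈ y) :
    ∃ y', Eqv K y y' ∧ (v, y₀ + 1) ∈ y' ∧ ∀ w ∈ y, w.2 = y₀ + 2 → w ∈ y' := by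
  have hbd := H.bd
  have hint : ∀ s t : ℤ, b ≤ s → s < t → t ≤ d + 1 →
      IsInnerInterval K (s, y₀) (t, y₀ + 1) := by
    intro s t h1 h2 h3
    rw [interval_iff]
    refine ⟨h2, by dsimp only; omega, fun e f h4 h5 h6 h7 => ?_⟩
    dsimp only at h4 h5 h6 h7
    obtain rfl : f = y₀ := by omega
    exact H.right e (by omega) (by omega)
  rcases eq_or_ne p v with rfl | hpv
  · exact ⟨y, Eqv.refl _ _, h1, fun w hw _ => hw⟩
  obtain ⟨z, rfl⟩ := exists_add_of_mem_two h1 h2 (by simp)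
  have hrest : ∀ w ∈ (p, y₀ + 1) ::ₘ (v, y₀) ::ₘ z, w.2 = y₀ + 2 →
      w ∈ (v, y₀ + 1) ::ₘ (p, y₀) ::ₘ z := by
    intro w hw hw2
    simp only [Multiset.mem_cons] at hw ⊢
    rcases hw with rfl | rfl | hw
    · dsimp only at hw2; omega
    · dsimp only at hw2; omega
    · exact Or.inr (Or.inr hw)
  refine ⟨_, ?_, Multiset.mem_cons_self _ _, hrest⟩
  rcases lt_or_gt_of_ne hpv with h | h
  · rw [Multiset.cons_swap (v, y₀ + 1)]
    exact (Eqv.of_interval (hint p v hp h (by omega)) z).symm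
  · rw [Multiset.cons_swap]
    exact Eqv.of_interval (hint v p (by omega) h hp') z

/-- The top line of the right block and the column through `v` are both invariant. The first yields
a vertex `(p, y₀ + 1)` of `y` and the second `(v, y₀ + 1)` or `(v, y₀)`. In the latter case an
interval of the right block exchanges the pair so that `(v, y₀ + 1)` occurs, and `exchange_row`
finishes. -/
theorem exchange_right {u v : ℤ} (hv : v = b ∨ v = b + 1) (hu : c ≤ u) (hu' : u < b)
    (h : Eqv K (substMon (rowSegment c (b + 1) (y₀ + 2)) down x)
      (substMon (rowSegment c (b + 1) (y₀ + 2)) down y))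
    (hx : (v, y₀ + 2) ∈ x) (hyu : (u, y₀ + 2) ∈ y)
    (hyr : ∀ t, b ≤ t → t ≤ b + 1 → (t, y₀ + 2) ∉ y) :
    ∃ y', Eqv (K ∪ rowSegment c b (y₀ + 1)) y y' ∧ (v, y₀ + 2) ∈ y' := by
  have hcb := H.cb
  have hbd := H.bd
  obtain ⟨⟨p, q⟩, hw, hwL⟩ := mem_of_substMon (H.rowClosed_line.degOn_eq h) (v := v) (by omega)
    (by omega) (by rw [mem_rowSegment]; dsimp only; omega) hx (by
      intro t h1 h2 ht
      rw [mem_rowSegment] at ht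
      exact hyr t ht.1 h2)
  rw [mem_rowSegment] at hwL
  dsimp only at hwL
  obtain ⟨hp, hp', rfl⟩ := hwL
  have hcol : ColClosed K {(v, y₀ + 1), (v, y₀)} := by
    rcases hv with rfl | rfl
    exacts [H.colClosed_right, H.colClosed_right']
  obtain ⟨w, hw2, hwL⟩ := mem_of_substMon (hcol.degOn_eq h) (v := v) (by omega) (by omega)
    (by simp) hx (by
      intro t _ _ ht
      simp only [Finset.mem_insert, Finset.mem_singleton, Prod.mk.injEq] at ht
      exact hyr t (by omega) (by omega))
  rw [Finset.mem_insert, Finset.mem_singleton] at hwL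
  rcases hwL with rfl | rfl
  · exact exchange_row hu (by omega) (by omega) (by omega) hyu hw2
  · obtain ⟨y', hy', hm, hk⟩ := H.exchange_line hv hp hp' hw hw2
    obtain ⟨y'', hy'', hm'⟩ := exchange_row (K := K) (c := c) (b := b) hu (by omega)
      (by omega) (by omega) (hk _ hyu rfl) hm
    exact ⟨y'', (hy'.mono Finset.subset_union_left).trans hy'', hm'⟩

/-- The vertex `(v, y₀ + 1)` does not belong to `K`, so the degree at this single vertex is an
invariant. -/
theorem exchange_free {u v : ℤ} (hv : c + 2 ≤ v) (hv' : v ≤ b - 1) (hu : c ≤ u) (hu' : u ≤ b + 1)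
    (h : Eqv K (substMon (rowSegment c (b + 1) (y₀ + 2)) down x)
      (substMon (rowSegment c (b + 1) (y₀ + 2)) down y))
    (hx : (v, y₀ + 2) ∈ x) (hyu : (u, y₀ + 2) ∈ y) (hyv : (v, y₀ + 2) ∉ y) :
    ∃ y', Eqv (K ∪ rowSegment c b (y₀ + 1)) y y' ∧ (v, y₀ + 2) ∈ y' := by
  have hfree : ∀ w ∈ ({(v, y₀ + 1)} : Finset (ℤ × ℤ)), w ∉ vertices K := by
    intro w hw
    rw [Finset.mem_singleton] at hw
    subst hw
    exact H.free_notMem _ (mem_rowSegment.2 ⟨hv, hv', rfl⟩)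
  obtain ⟨w, hw, hwL⟩ := mem_of_substMon (h.degOn_eq_of_disjoint hfree) (v := v) (by omega)
    (by omega) (by simp) hx (by
      intro t _ _ ht
      simp only [Finset.mem_singleton, Prod.mk.injEq] at ht
      rw [ht.1]; exact hyv)
  rw [Finset.mem_singleton] at hwL
  subst hwL
  exact exchange_row hu hu' (by omega) (by omega) hyu hw

/-- Collects the positions `v` at which the invariants suffice to exchange the top variable into
`y`. The position `c` is missing, for lack of an invariant column, and `b + 1` is allowed only if
`y` has no top variable at `b`. -/
theorem exchange_some {v w : ℤ} (h : Eqv K (substMon (rowSegment c (b + 1) (y₀ + 2)) down x)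
      (substMon (rowSegment c (b + 1) (y₀ + 2)) down y))
    (hne : ∀ t, c ≤ t → t ≤ b + 1 → (t, y₀ + 2) ∈ x → (t, y₀ + 2) ∉ y)
    (hv : (v, y₀ + 2) ∈ x) (hv1 : c ≤ v) (hv2 : v ≤ b + 1) (hw : (w, y₀ + 2) ∈ y) (hw1 : c ≤ w)
    (hw2 : w ≤ b + 1) (hcase : c + 2 ≤ v ∧ v ≤ b ∨ v = b + 1 ∧ (b, y₀ + 2) ∉ y ∨
      v = c + 1 ∧ w = c) :
    ∃ y', Eqv (K ∪ rowSegment c b (y₀ + 1)) y y' ∧ (v, y₀ + 2) ∈ y' := by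
  have hcb := H.cb
  have hbd := H.bd
  have hvy := hne v hv1 hv2 hv
  by_cases h1 : v ≤ b - 1 ∧ c + 2 ≤ v
  · exact H.exchange_free h1.2 h1.1 hw1 hw2 h hv hw hvy
  by_cases h2 : v = c + 1
  · obtain rfl : w = c := by omega
    subst h2
    exact exchange_col le_rfl (by omega) H.left (Or.inl ⟨rfl, rfl⟩) H.colClosed_left h hv hvy hw
  by_cases h3 : v = b
  · subst h3
    by_cases h4 : (v + 1, y₀ + 2) ∈ y
    · exact exchange_col (p := v) (by omega) le_rfl (H.right v le_rfl (by omega))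
        (Or.inr ⟨rfl, rfl⟩) H.colClosed_right h hv hvy h4
    · have hyr : ∀ t, v ≤ t → t ≤ v + 1 → (t, y₀ + 2) ∉ y := by
        intro t h5 h6
        rcases (by omega : t = v ∨ t = v + 1) with rfl | rfl
        exacts [hvy, h4]
      refine H.exchange_right (Or.inl rfl) hw1 ?_ h hv hw hyr
      by_contra h5
      exact hyr w (by omega) (by omega) hw
  · obtain rfl : v = b + 1 := by omega
    have h4 : (b, y₀ + 2) ∉ y := by
      rcases hcase with h4 | h4 | h4
      · omega
      · exact h4.2
      · omega
    have hyr : ∀ t, b ≤ t → t ≤ b + 1 → (t, y₀ + 2) ∉ y := by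
      intro t h5 h6
      rcases (by omega : t = b ∨ t = b + 1) with rfl | rfl
      exacts [h4, hvy]
    refine H.exchange_right (Or.inr rfl) hw1 ?_ h hv hw hyr
    by_contra h5
    exact hyr w (by omega) (by omega) hw

theorem isRees (hc : Cancellative K) :
    IsRees K (K ∪ rowSegment c b (y₀ + 1)) (rowSegment c (b + 1) (y₀ + 2)) down := by
  have hcb := H.cb
  refine isRees_top (by omega) hc H.top ?_ (fun x h1 h2 => H.bottom h1 h2) ?_
  · intro x h1 h2 h3 h4
    have := H.below_cases h1 (by omega) h3
    have := H.below_cases (by omega) h2 h4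
    omega
  rintro x y h hne ⟨⟨v, v'⟩, hv, hvN⟩ ⟨⟨w, w'⟩, hw, hwN⟩
  have hvN' := mem_rowSegment.1 hvN
  have hwN' := mem_rowSegment.1 hwN
  dsimp only at hvN' hwN'
  obtain rfl := hvN'.2.2
  obtain rfl := hwN'.2.2
  have hne' : ∀ t, c ≤ t → t ≤ b + 1 → (t, y₀ + 2) ∈ x → (t, y₀ + 2) ∉ y :=
    fun t h1 h2 => hne _ (mem_rowSegment.2 ⟨h1, h2, rfl⟩)
  have hne'' : ∀ t, c ≤ t → t ≤ b + 1 → (t, y₀ + 2) ∈ y → (t, y₀ + 2) ∉ x :=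
    fun t h1 h2 hy hx => hne' t h1 h2 hx hy
  -- `fin1` changes `y` and `fin2` changes `x`: whichever monomial has its top variable at a
  -- favourable position stays fixed.
  have fin1 : ∀ t s : ℤ, c ≤ t → t ≤ b + 1 → (t, y₀ + 2) ∈ x → c ≤ s → s ≤ b + 1 →
      (s, y₀ + 2) ∈ y → (c + 2 ≤ t ∧ t ≤ b ∨ t = b + 1 ∧ (b, y₀ + 2) ∉ y ∨ t = c + 1 ∧ s = c) →
      ∃ x' y', Eqv (K ∪ rowSegment c b (y₀ + 1)) x x' ∧ Eqv (K ∪ rowSegment c b (y₀ + 1)) y y' ∧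
        ∃ v ∈ rowSegment c (b + 1) (y₀ + 2), v ∈ x' ∧ v ∈ y' := by
    intro t s h1 h2 h3 h4 h5 h6 h7
    obtain ⟨y', hy', hm⟩ := H.exchange_some h hne' h3 h1 h2 h6 h4 h5 h7
    exact ⟨x, y', Eqv.refl _ _, hy', _, mem_rowSegment.2 ⟨h1, h2, rfl⟩, h3, hm⟩
  have fin2 : ∀ t s : ℤ, c ≤ t → t ≤ b + 1 → (t, y₀ + 2) ∈ y → c ≤ s → s ≤ b + 1 →
      (s, y₀ + 2) ∈ x → (c + 2 ≤ t ∧ t ≤ b ∨ t = b + 1 ∧ (b, y₀ + 2) ∉ x ∨ t = c + 1 ∧ s = c) →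
      ∃ x' y', Eqv (K ∪ rowSegment c b (y₀ + 1)) x x' ∧ Eqv (K ∪ rowSegment c b (y₀ + 1)) y y' ∧
        ∃ v ∈ rowSegment c (b + 1) (y₀ + 2), v ∈ x' ∧ v ∈ y' := by
    intro t s h1 h2 h3 h4 h5 h6 h7
    obtain ⟨x', hx', hm⟩ := H.exchange_some h.symm hne'' h3 h1 h2 h6 h4 h5 h7
    exact ⟨x', y, hx', Eqv.refl _ _, _, mem_rowSegment.2 ⟨h1, h2, rfl⟩, hm, h3⟩
  have hvw : v ≠ w := by rintro rfl; exact hne' v hvN'.1 hvN'.2.1 hv hw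
  by_cases h1 : c + 2 ≤ v ∧ v ≤ b
  · exact fin1 v w hvN'.1 hvN'.2.1 hv hwN'.1 hwN'.2.1 hw (Or.inl h1)
  by_cases h2 : c + 2 ≤ w ∧ w ≤ b
  · exact fin2 w v hwN'.1 hwN'.2.1 hw hvN'.1 hvN'.2.1 hv (Or.inl h2)
  by_cases h3 : v = b + 1
  -- If `y` has the top variable at `b`, that one is exchanged into `x` instead.
  · by_cases h4 : (b, y₀ + 2) ∈ y
    · exact fin2 b v (by omega) (by omega) h4 hvN'.1 hvN'.2.1 hv (Or.inl ⟨hcb, le_rfl⟩)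
    · exact fin1 v w hvN'.1 hvN'.2.1 hv hwN'.1 hwN'.2.1 hw (Or.inr (Or.inl ⟨h3, h4⟩))
  by_cases h3' : w = b + 1
  · by_cases h4 : (b, y₀ + 2) ∈ x
    · exact fin1 b w (by omega) (by omega) h4 hwN'.1 hwN'.2.1 hw (Or.inl ⟨hcb, le_rfl⟩)
    · exact fin2 w v hwN'.1 hwN'.2.1 hw hvN'.1 hvN'.2.1 hv (Or.inr (Or.inl ⟨h3', h4⟩))
  rcases (by omega : v = c + 1 ∧ w = c ∨ w = c + 1 ∧ v = c) with h5 | h5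
  · exact fin1 v w hvN'.1 hvN'.2.1 hv hwN'.1 hwN'.2.1 hw (Or.inr (Or.inr h5))
  · exact fin2 w v hwN'.1 hwN'.2.1 hw hvN'.1 hvN'.2.1 hv (Or.inr (Or.inr h5))

end IsHat

end Polyomino

namespace Polyomino

variable {x y z : Mon} {S : Finset Cell} {U : Finset (ℤ × ℤ)}

/-! ### Counting for a block bending down at both ends -/

/-- The shift by one row upwards. -/
def up (v : ℤ × ℤ) : ℤ × ℤ := (v.1, v.2 + 1)

theorem down_up (v : ℤ × ℤ) : down (up v) = v := Prod.ext rfl (by simp [down, up])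

/-- A free variable `u`, regarded as `T` times `ω u`. Its order function is the degree in `ω u` when
`ω u` is free too (`inPower_free`), so such degrees are counted in the same way as the other
summands of the order of a hat. -/
theorem isRees_free {u : ℤ × ℤ} (hc : Cancellative S) (hu : u ∉ vertices S)
    (ω : ℤ × ℤ → ℤ × ℤ) : IsRees S S {u} ω where
  sub := subset_rfl
  canc := hc
  move := by
    intro a b hab
    obtain ⟨m1, m2, m3, m4⟩ := corner_mem_vertices hab
    have key : ∀ v ∈ vertices S, substVar {u} ω v = v := by
      intro v hv
      refine if_neg fun h => hu ?_
      rwa [Finset.mem_singleton.1 h] at hv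
    rw [key _ m1, key _ m2, key _ m3, key _ m4]
    exact Eqv.of_interval hab 0
  deg := by
    intro a b hab
    obtain ⟨m1, m2, m3, m4⟩ := corner_mem_vertices hab
    have key : ∀ v ∈ vertices S, v ∉ ({u} : Finset (ℤ × ℤ)) := by
      intro v hv h
      rw [Finset.mem_singleton.1 h] at hv
      exact hu hv
    rw [if_neg (key _ m1), if_neg (key _ m2), if_neg (key _ m3), if_neg (key _ m4)]
  exch := by
    intro x y _ hd hne hpos
    obtain ⟨v, hv, hvu⟩ := degOn_pos.1 hpos
    obtain ⟨w, hw, hwu⟩ := degOn_pos.1 (hd ▸ hpos)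
    obtain rfl : v = u := Finset.mem_singleton.1 hvu
    obtain rfl : w = v := Finset.mem_singleton.1 hwu
    exact absurd hw (hne _ hvu hv)

theorem inPower_free {u : ℤ × ℤ} {ω : ℤ × ℤ → ℤ × ℤ} (hu : ω u ∉ vertices S) (hx : x ∈ monOn U)
    {j : ℕ} : InPower S {u} ω U x j ↔ j ≤ degOn {ω u} x := by
  constructor
  · rintro ⟨c, hc, z, hz, rfl, h⟩
    rw [← h.degOn_eq_of_disjoint (by simpa using hu), degOn_add]
    have : degOn {ω u} (c.map ω) = (c.map ω).card := by
      refine Multiset.countP_eq_card.2 fun v hv => ?_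
      obtain ⟨w, hw, rfl⟩ := Multiset.mem_map.1 hv
      rw [Finset.mem_singleton.1 (hc w hw)]
      exact Finset.mem_singleton_self _
    rw [this, Multiset.card_map]
    exact Nat.le_add_right _ _
  · intro h
    have h' : Multiset.replicate j (ω u) ≤ x := by
      rw [← Multiset.le_count_iff_replicate_le, Multiset.count]
      convert h using 1
      refine Multiset.countP_congr rfl fun v _ => ?_
      rw [Finset.mem_singleton]
      exact propext eq_comm
    obtain ⟨z, rfl⟩ := Multiset.le_iff_exists_add.1 h'
    refine ⟨Multiset.replicate j u, fun v hv => ?_, z, fun v hv => hx v ?_, ?_, ?_⟩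
    · rw [Finset.mem_singleton]; exact Multiset.eq_of_mem_replicate hv
    · exact Multiset.mem_add.2 (Or.inr hv)
    · simp
    · rw [Multiset.map_replicate]; exact Eqv.refl _ _

theorem degOn_eq_sum (L : Finset (ℤ × ℤ)) (x : Mon) : degOn L x = ∑ w ∈ L, degOn {w} x := by
  induction x using Multiset.induction_on with
  | empty => simp [degOn]
  | cons v x ih =>
    simp only [degOn_cons, ih, Finset.sum_add_distrib]
    congr 1
    simp [Finset.sum_ite_eq]

theorem degOn_map_eq_zero {L : Finset (ℤ × ℤ)} {ω : ℤ × ℤ → ℤ × ℤ} {c : Mon}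
    (h : ∀ v ∈ c, ω v ∉ L) : degOn L (c.map ω) = 0 := by
  rw [degOn_eq_zero]
  intro w hw
  obtain ⟨v, hv, rfl⟩ := Multiset.mem_map.1 hw
  exact h v hv

theorem degOn_map_eq_card {L : Finset (ℤ × ℤ)} {ω : ℤ × ℤ → ℤ × ℤ} {c : Mon}
    (h : ∀ v ∈ c, ω v ∈ L) : degOn L (c.map ω) = c.card := by
  rw [degOn, Multiset.countP_eq_card.2, Multiset.card_map]
  intro w hw
  obtain ⟨v, hv, rfl⟩ := Multiset.mem_map.1 hw
  exact h v hv

namespace IsHat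

variable {K : Finset Cell} {c b d y₀ : ℤ} (H : IsHat K c b d y₀)
include H

/-- Each step uses up one unit of the degree on the line and one of the degree in the two columns: a
column vertex on the lower line is first raised by `exchange_line`, and then split off. -/
theorem extract_right (hU : vertices K ⊆ U) (k : ℕ) : ∀ {z : Mon}, z ∈ monOn U →
    k ≤ degOn (rowSegment b (d + 1) (y₀ + 1)) z →
    k ≤ degOn {(b, y₀ + 1), (b, y₀)} z + degOn {(b + 1, y₀ + 1), (b + 1, y₀)} z →
    ∃ e ∈ monOn (rowSegment b (b + 1) (y₀ + 2)), ∃ z' ∈ monOn U, e.card = k ∧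
      Eqv K (e.map down + z') z := by
  have hbd := H.bd
  induction k with
  | zero => exact fun hz _ _ => ⟨0, by simp [monOn], _, hz, rfl, by simpa using Eqv.refl _ _⟩
  | succ k ih =>
    intro z hz h1 h2
    have hmem : ∃ v, (v = b ∨ v = b + 1) ∧ ((v, y₀ + 1) ∈ z ∨ (v, y₀) ∈ z) := by
      by_cases h : 0 < degOn {(b, y₀ + 1), (b, y₀)} z
      · obtain ⟨w, hw, hwL⟩ := degOn_pos.1 h
        rw [Finset.mem_insert, Finset.mem_singleton] at hwL
        exact ⟨b, Or.inl rfl, by rcases hwL with rfl | rfl <;> simp [hw]⟩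
      · obtain ⟨w, hw, hwL⟩ := degOn_pos.1
          (show 0 < degOn {(b + 1, y₀ + 1), (b + 1, y₀)} z by omega)
        rw [Finset.mem_insert, Finset.mem_singleton] at hwL
        exact ⟨b + 1, Or.inr rfl, by rcases hwL with rfl | rfl <;> simp [hw]⟩
    obtain ⟨v, hv, hvz⟩ := hmem
    have hz' : ∃ z', Eqv K z z' ∧ (v, y₀ + 1) ∈ z' := by
      rcases hvz with hvz | hvz
      · exact ⟨z, Eqv.refl _ _, hvz⟩
      · obtain ⟨⟨p, q⟩, hw, hwL⟩ := degOn_pos.1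
          (show 0 < degOn (rowSegment b (d + 1) (y₀ + 1)) z by omega)
        rw [mem_rowSegment] at hwL
        dsimp only at hwL
        obtain ⟨h3, h4, rfl⟩ := hwL
        obtain ⟨z', hz', hm, -⟩ := H.exchange_line hv h3 h4 hw hvz
        exact ⟨z', hz', hm⟩
    obtain ⟨z', hzz', hm⟩ := hz'
    rw [H.rowClosed_line.degOn_eq hzz'] at h1
    rw [H.colClosed_right.degOn_eq hzz', H.colClosed_right'.degOn_eq hzz'] at h2
    have hzU := (hzz'.mem_monOn hU).1 hz
    obtain ⟨w, rfl⟩ := Multiset.exists_cons_of_mem hm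
    rw [degOn_cons, if_pos (mem_rowSegment.2 (by dsimp only; omega))] at h1
    have h3 : k ≤ degOn {(b, y₀ + 1), (b, y₀)} w + degOn {(b + 1, y₀ + 1), (b + 1, y₀)} w := by
      rw [degOn_cons, degOn_cons] at h2
      have hif : ((if (v, y₀ + 1) ∈ ({(b, y₀ + 1), (b, y₀)} : Finset (ℤ × ℤ)) then 1 else 0) +
          if (v, y₀ + 1) ∈ ({(b + 1, y₀ + 1), (b + 1, y₀)} : Finset (ℤ × ℤ)) then 1 else 0 : ℕ)
            = 1 := by
        rcases hv with rfl | rfl <;> simp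
      omega
    obtain ⟨e, he, u, hu, hek, heq⟩ := ih (z := w)
      (fun t ht => hzU t (Multiset.mem_cons_of_mem ht)) (by omega) h3
    refine ⟨(v, y₀ + 2) ::ₘ e, ?_, u, hu, by rw [Multiset.card_cons, hek], ?_⟩
    · intro t ht
      rcases Multiset.mem_cons.1 ht with rfl | ht
      · exact mem_rowSegment.2 (by dsimp only; omega)
      · exact he t ht
    · rw [Multiset.map_cons, Multiset.cons_add]
      have : down (v, y₀ + 2) = (v, y₀ + 1) := Prod.ext rfl (by simp only [down]; ring)
      rw [this]
      exact (heq.cons _).trans hzz'.symm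

/-- The contributions of the left end, the right end and the free vertices do not compete. Given an
optimal factorisation for the left end, the invariants of the right block show that its cofactor
still contains the optimal number of generators of the right end, and the free degrees are
unaffected by both. -/
theorem inPower_iff (hU : vertices K ⊆ U)
    (hN : ∀ v ∈ rowSegment c (b + 1) (y₀ + 2), down v ∈ U)
    {νL νR : Quotient (eqvSetoid K) → ℕ}
    (hL : ∀ x ∈ monOn U, ∀ j, InPower K (rowSegment c (c + 1) (y₀ + 2)) down U x j ↔
      j ≤ νL (Quotient.mk _ x))
    (hR : ∀ x ∈ monOn U, ∀ j, InPower K (rowSegment b (b + 1) (y₀ + 2)) down U x j ↔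
      j ≤ νR (Quotient.mk _ x)) (hx : x ∈ monOn U) (j : ℕ) :
    InPower K (rowSegment c (b + 1) (y₀ + 2)) down U x j ↔
      j ≤ νL (Quotient.mk _ x) + νR (Quotient.mk _ x) +
        degOn (rowSegment (c + 2) (b - 1) (y₀ + 1)) x := by
  have hcb := H.cb
  have hbd := H.bd
  have hfree : ∀ {x y : Mon}, Eqv K x y → degOn (rowSegment (c + 2) (b - 1) (y₀ + 1)) x =
      degOn (rowSegment (c + 2) (b - 1) (y₀ + 1)) y :=
    fun h => h.degOn_eq_of_disjoint H.free_notMem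
  constructor
  · rintro ⟨e, he, z, hz, rfl, h⟩
    -- The generators are sorted by position: over the left cell, over the right cell, and in
    -- between.
    set pL : ℤ × ℤ → Prop := fun v => v.1 ≤ c + 1 with hpL
    set pR : ℤ × ℤ → Prop := fun v => b ≤ v.1 with hpR
    have hsplit : e.filter pL + ((e.filter (¬ pL ·)).filter pR +
        (e.filter (¬ pL ·)).filter (¬ pR ·)) = e := by
      rw [Multiset.filter_add_not, Multiset.filter_add_not]
    generalize hf1 : e.filter pL = e1 at hsplit
    generalize hf2 : (e.filter (¬ pL ·)).filter pR = e2 at hsplit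
    generalize hf3 : (e.filter (¬ pL ·)).filter (¬ pR ·) = e3 at hsplit
    have h1 : ∀ v ∈ e1, v ∈ rowSegment c (c + 1) (y₀ + 2) := by
      intro v hv
      rw [← hf1, Multiset.mem_filter] at hv
      have := mem_rowSegment.1 (he v hv.1)
      exact mem_rowSegment.2 ⟨this.1, hv.2, this.2.2⟩
    have h2 : ∀ v ∈ e2, v ∈ rowSegment b (b + 1) (y₀ + 2) := by
      intro v hv
      rw [← hf2, Multiset.mem_filter, Multiset.mem_filter] at hv
      have := mem_rowSegment.1 (he v hv.1.1)
      exact mem_rowSegment.2 ⟨hv.2, this.2⟩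
    have h3 : ∀ v ∈ e3, down v ∈ rowSegment (c + 2) (b - 1) (y₀ + 1) := by
      intro v hv
      rw [← hf3, Multiset.mem_filter, Multiset.mem_filter] at hv
      have := mem_rowSegment.1 (he v hv.1.1)
      have h4 := hv.1.2
      have h5 := hv.2
      simp only [hpL, hpR] at h4 h5
      rw [mem_rowSegment, down]
      dsimp only
      omega
    subst hsplit
    have hm : ∀ e' : Mon, (∀ v ∈ e', v ∈ e1 + (e2 + e3)) → e'.map down ∈ monOn U :=
      fun e' h v hv => by
        obtain ⟨w, hw, rfl⟩ := Multiset.mem_map.1 hv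
        exact hN w (he w (h w hw))
    have l1 : e1.card ≤ νL (Quotient.mk _ x) := by
      rw [← hL x hx]
      refine ⟨e1, h1, (e2 + e3).map down + z, monOn_add (hm _ fun v hv => ?_) hz, rfl, ?_⟩
      · exact Multiset.mem_add.2 (Or.inr hv)
      · rwa [← add_assoc, ← Multiset.map_add]
    have l2 : e2.card ≤ νR (Quotient.mk _ x) := by
      rw [← hR x hx]
      refine ⟨e2, h2, (e1 + e3).map down + z, monOn_add (hm _ fun v hv => ?_) hz, rfl, ?_⟩
      · simp only [Multiset.mem_add] at hv ⊢
        tauto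
      · rwa [← add_assoc, ← Multiset.map_add, add_left_comm]
    have l3 : e3.card ≤ degOn (rowSegment (c + 2) (b - 1) (y₀ + 1)) x := by
      rw [← hfree h, Multiset.map_add, Multiset.map_add, degOn_add, degOn_add, degOn_add,
        degOn_map_eq_card h3]
      omega
    rw [Multiset.card_add, Multiset.card_add]
    omega
  · intro hj
    refine InPower.mono hN hj ?_
    obtain ⟨e1, he1, z, hz, hc1, h1⟩ := (hL x hx _).2 le_rfl
    obtain ⟨e, he, w, -, hce, h2⟩ := (hR x hx _).2 le_rfl
    have hd1 : ∀ v ∈ e1, c ≤ (down v).1 ∧ (down v).1 ≤ c + 1 ∧ (down v).2 = y₀ + 1 := by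
      intro v hv
      have := mem_rowSegment.1 (he1 v hv)
      simp only [down]
      omega
    have hd : ∀ v ∈ e, b ≤ (down v).1 ∧ (down v).1 ≤ b + 1 ∧ (down v).2 = y₀ + 1 := by
      intro v hv
      have := mem_rowSegment.1 (he v hv)
      simp only [down]
      omega
    have h12 := h2.trans h1.symm
    -- The left generators do not meet the line or the columns of the right block, so all the degree
    -- recorded by the optimal right factorisation `e` sits in the left cofactor `z`.
    have r1 : νR (Quotient.mk _ x) ≤ degOn (rowSegment b (d + 1) (y₀ + 1)) z := by
      have := H.rowClosed_line.degOn_eq h12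
      rw [degOn_add, degOn_add, degOn_map_eq_card, degOn_map_eq_zero] at this
      · omega
      · intro v hv
        have := hd1 v hv
        rw [mem_rowSegment]; omega
      · intro v hv
        have := hd v hv
        rw [mem_rowSegment]; omega
    have r2 : νR (Quotient.mk _ x) ≤
        degOn {(b, y₀ + 1), (b, y₀)} z + degOn {(b + 1, y₀ + 1), (b + 1, y₀)} z := by
      have a1 := H.colClosed_right.degOn_eq h12
      have a2 := H.colClosed_right'.degOn_eq h12
      have a3 : degOn {(b, y₀ + 1), (b, y₀)} (e.map down) +
          degOn {(b + 1, y₀ + 1), (b + 1, y₀)} (e.map down) = e.card := by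
        have key : ∀ e : Mon, (∀ v ∈ e, b ≤ (down v).1 ∧ (down v).1 ≤ b + 1 ∧
            (down v).2 = y₀ + 1) → degOn {(b, y₀ + 1), (b, y₀)} (e.map down) +
          degOn {(b + 1, y₀ + 1), (b + 1, y₀)} (e.map down) = e.card := by
          intro e
          induction e using Multiset.induction_on with
          | empty => simp [degOn]
          | cons v e ih =>
            intro hv
            have h1 := ih fun w hw => hv w (Multiset.mem_cons_of_mem hw)
            have h2 := hv v (Multiset.mem_cons_self _ _)
            rw [Multiset.map_cons, degOn_cons, degOn_cons, Multiset.card_cons]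
            have h3 : down v = (b, y₀ + 1) ∨ down v = (b + 1, y₀ + 1) := by
              rcases (by omega : (down v).1 = b ∨ (down v).1 = b + 1) with h3 | h3
              · exact Or.inl (Prod.ext h3 h2.2.2)
              · exact Or.inr (Prod.ext h3 h2.2.2)
            rcases h3 with h3 | h3
            · rw [h3, if_pos (by simp), if_neg (by simp)]; omega
            · rw [h3, if_neg (by simp), if_pos (by simp)]; omega
        exact key e hd
      rw [degOn_add, degOn_add, degOn_map_eq_zero (c := e1)] at a1 a2
      · omega
      · intro v hv hv'
        have := hd1 v hv
        rw [Finset.mem_insert, Finset.mem_singleton] at hv'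
        rcases hv' with h | h <;> · rw [h] at this; dsimp only at this; omega
      · intro v hv hv'
        have := hd1 v hv
        rw [Finset.mem_insert, Finset.mem_singleton] at hv'
        rcases hv' with h | h <;> · rw [h] at this; dsimp only at this; omega
    obtain ⟨e2, he2, w', hw', hc2, h3⟩ := H.extract_right hU _ hz r1 r2
    set W := rowSegment (c + 2) (b - 1) (y₀ + 1) with hW
    have hx' : Eqv K (e1.map down + (e2.map down + w')) x := (h3.add_left _).trans h1
    have hdeg : degOn W x = degOn W w' := by
      rw [← hfree hx', degOn_add, degOn_add, degOn_map_eq_zero, degOn_map_eq_zero, zero_add,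
        zero_add]
      · intro v hv
        have := mem_rowSegment.1 (he2 v hv)
        rw [hW, mem_rowSegment]; simp only [down]; omega
      · intro v hv
        have := hd1 v hv
        rw [hW, mem_rowSegment]; omega
    -- The free vertices of the remaining cofactor are generators themselves, so all of them are
    -- split off as well.
    refine ⟨e1 + (e2 + (w'.filter (· ∈ W)).map up), ?_, w'.filter (· ∉ W), ?_, ?_, ?_⟩
    · intro v hv
      rw [mem_rowSegment]
      rcases Multiset.mem_add.1 hv with h | h
      · have := mem_rowSegment.1 (he1 v h); omega
      rcases Multiset.mem_add.1 h with h | h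
      · have := mem_rowSegment.1 (he2 v h); omega
      · obtain ⟨u, hu, rfl⟩ := Multiset.mem_map.1 h
        have := mem_rowSegment.1 (Multiset.mem_filter.1 hu).2
        simp only [up]; omega
    · exact fun v hv => hw' v (Multiset.mem_filter.1 hv).1
    · rw [Multiset.card_add, Multiset.card_add, Multiset.card_map, hc1, hc2, hdeg, degOn,
        Multiset.countP_eq_card_filter, add_assoc]
    · have : ((w'.filter (· ∈ W)).map up).map down = w'.filter (· ∈ W) := by
        rw [Multiset.map_map]
        conv_rhs => rw [← Multiset.map_id (w'.filter (· ∈ W))]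
        exact Multiset.map_congr rfl fun v _ => down_up v
      rw [Multiset.map_add, Multiset.map_add, this, add_assoc, add_assoc,
        Multiset.filter_add_not]
      exact hx'

/-- For a sum of order functions $\nu+1=(\nu_L+1)+(\nu_R+1)+\sum_{w\in W}(\deg_w+1)-(|W|+1)$;
summing over the classes of `K` turns each bracket into the series of a Rees monoid. -/
theorem monSeries_eq (hc : Cancellative K) (hU : vertices K ⊆ U)
    (hN : ∀ v ∈ rowSegment c (b + 1) (y₀ + 2), down v ∈ U)
    (hNU : ∀ v ∈ rowSegment c (b + 1) (y₀ + 2), v ∉ U) :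
    monSeries (K ∪ rowSegment c b (y₀ + 1)) (U ∪ rowSegment c (b + 1) (y₀ + 2)) =
      monSeries (K ∪ rowSegment c c (y₀ + 1)) (U ∪ rowSegment c (c + 1) (y₀ + 2)) +
      monSeries (K ∪ rowSegment b b (y₀ + 1)) (U ∪ rowSegment b (b + 1) (y₀ + 2)) +
      ∑ w ∈ rowSegment (c + 2) (b - 1) (y₀ + 1), monSeries K (U ∪ {up w}) -
      ((rowSegment (c + 2) (b - 1) (y₀ + 1)).card + 1) * monSeries K U := by
  have hcb := H.cb
  have hL : rowSegment c (c + 1) (y₀ + 2) ⊆ rowSegment c (b + 1) (y₀ + 2) := by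
    intro v hv
    rw [mem_rowSegment] at hv ⊢
    omega
  have hR : rowSegment b (b + 1) (y₀ + 2) ⊆ rowSegment c (b + 1) (y₀ + 2) := by
    intro v hv
    rw [mem_rowSegment] at hv ⊢
    omega
  obtain ⟨νL, hνL⟩ := exists_order K fun v hv => hN v (hL hv)
  obtain ⟨νR, hνR⟩ := exists_order K fun v hv => hN v (hR hv)
  set W := rowSegment (c + 2) (b - 1) (y₀ + 1) with hW
  have hWN : ∀ w ∈ W, up w ∈ rowSegment c (b + 1) (y₀ + 2) := by
    intro w hw
    rw [hW, mem_rowSegment] at hw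
    rw [mem_rowSegment, up]
    dsimp only
    omega
  have hfree := H.free_notMem
  have hdeg : ∀ w ∈ W, ∃ f : Quotient (eqvSetoid K) → ℕ, ∀ x, f (Quotient.mk _ x) =
      degOn {w} x := by
    intro w hw
    refine ⟨Quotient.lift (degOn {w}) fun x y h => ?_, fun x => rfl⟩
    exact Eqv.degOn_eq_of_disjoint (by simpa using hfree w hw) h
  choose! f hf using hdeg
  have hU0 : ∀ v ∈ rowSegment c (b + 1) (y₀ + 2), v ∉ vertices K := fun v hv h => hNU v hv (hU h)
  ext k
  have e1 := (H.isRees hc).coeff_monSeries hN hNU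
    (ν := fun q => νL q + νR q + ∑ w ∈ W, f w q) (fun x hx j => by
      rw [H.inPower_iff hU hN hνL hνR hx, degOn_eq_sum]
      rw [Finset.sum_congr rfl fun w hw => hf w hw x]) k
  have e2 := (H.isRees_left hc).coeff_monSeries (fun v hv => hN v (hL hv))
    (fun v hv => hNU v (hL hv)) hνL k
  have e3 := (H.isRees_right hc).coeff_monSeries (fun v hv => hN v (hR hv))
    (fun v hv => hNU v (hR hv)) hνR k
  have e4 : ∀ w ∈ W, (monSeries K (U ∪ {up w})).coeff k =
      ∑ q ∈ classFinset K U k, ((f w q : ℤ) + 1) := by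
    intro w hw
    refine (isRees_free hc (hU0 _ (hWN w hw)) down).coeff_monSeries ?_ ?_ ?_ k
    · intro v hv
      rw [Finset.mem_singleton.1 hv]
      exact hN _ (hWN w hw)
    · intro v hv
      rw [Finset.mem_singleton.1 hv]
      exact hNU _ (hWN w hw)
    · intro x hx j
      rw [inPower_free (by rw [down_up]; exact hfree w hw) hx, down_up, hf w hw]
  have e5 : (((W.card : ℤ⟦X⟧) + 1) * monSeries K U).coeff k =
      ((W.card : ℤ) + 1) * (monSeries K U).coeff k := by
    rw [show ((W.card : ℤ⟦X⟧) + 1) = PowerSeries.C ((W.card : ℤ) + 1) by simp,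
      PowerSeries.coeff_C_mul]
  rw [map_sub, map_add, map_add, map_sum, e1, e2, e3, e5, Finset.sum_congr rfl e4,
    coeff_monSeries, Finset.sum_comm, Finset.mul_sum, ← Finset.sum_add_distrib,
    ← Finset.sum_add_distrib, ← Finset.sum_sub_distrib]
  refine Finset.sum_congr rfl fun q _ => ?_
  rw [Finset.sum_add_distrib]
  push_cast
  simp only [Finset.sum_const, nsmul_eq_mul, mul_one]
  ring

/-- Any nonempty row adds one vertex more than cells, so all the extensions share the exponent one
above that of `K`. The $|W|=b-c-2$ free terms and the correction combine to
$|W|\,r(K)-(|W|+1)(1-t)\,r(K)=-r(K)+(b-c-1)\,t\,r(K)$. -/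
theorem rookSeries_eq (hc : Cancellative K) :
    rookSeries (K ∪ rowSegment c b (y₀ + 1)) =
      rookSeries (K ∪ rowSegment c c (y₀ + 1)) + rookSeries (K ∪ rowSegment b b (y₀ + 1)) -
        rookSeries K + ((b - c - 1 : ℤ) : ℤ⟦X⟧) * PowerSeries.X * rookSeries K := by
  have hcb := H.cb
  set N := rowSegment c (b + 1) (y₀ + 2) with hN
  set U := vertices (K ∪ rowSegment c b (y₀ + 1)) \ N with hUdef
  have hPN : ∀ {v}, v ∈ vertices (rowSegment c b (y₀ + 1)) ↔
      c ≤ v.1 ∧ v.1 ≤ b + 1 ∧ (v.2 = y₀ + 1 ∨ v.2 = y₀ + 2) := by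
    rintro ⟨p, q⟩
    rw [mem_vertices_iff]
    dsimp only
    constructor
    · rintro ⟨⟨s, t⟩, hD, hv⟩
      rw [mem_rowSegment] at hD
      simp only [mem_cellVertices, Prod.mk.injEq] at hv hD
      omega
    · rintro ⟨h1, h2, h3⟩
      by_cases hp : p ≤ b
      · refine ⟨(p, y₀ + 1), mem_rowSegment.2 ⟨h1, hp, rfl⟩, ?_⟩
        rcases h3 with rfl | rfl
        · simp [mem_cellVertices]
        · simp [mem_cellVertices]; omega
      · refine ⟨(p - 1, y₀ + 1), mem_rowSegment.2 (by dsimp only; omega), ?_⟩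
        simp only [mem_cellVertices, Prod.mk.injEq]
        omega
  have hsub : ∀ {T}, T ⊆ rowSegment c b (y₀ + 1) →
      vertices (K ∪ T) ⊆ vertices (K ∪ rowSegment c b (y₀ + 1)) := fun h =>
    vertices_mono (Finset.union_subset_union_right h)
  have hNU : ∀ v ∈ N, v ∉ U := fun v hv hvU => (Finset.mem_sdiff.1 hvU).2 hv
  have hNK : ∀ v ∈ N, v ∉ vertices K := by
    intro v hv h
    have := mem_rowSegment.1 hv
    exact top_notMem H.top v h this
  have hU : vertices K ⊆ U := fun v hv => Finset.mem_sdiff.2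
    ⟨vertices_mono Finset.subset_union_left hv, fun h => hNK v h hv⟩
  have hNd : ∀ v ∈ N, down v ∈ U := by
    intro v hv
    have := mem_rowSegment.1 hv
    refine Finset.mem_sdiff.2 ⟨vertices_mono Finset.subset_union_right (hPN.2 ?_), fun h => ?_⟩
    · simp only [down]; omega
    · have := mem_rowSegment.1 h
      simp only [down] at this; omega
  have hPU : vertices (K ∪ rowSegment c b (y₀ + 1)) ⊆ U ∪ N := by
    rw [hUdef, Finset.sdiff_union_self_eq_union]
    exact Finset.subset_union_left
  have key := H.monSeries_eq hc hU hNd hNU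
  have hrow : ∀ p q : ℤ, c ≤ p → p ≤ q → q ≤ b →
      vertices (K ∪ rowSegment p q (y₀ + 1)) ⊆ U ∪ rowSegment p (q + 1) (y₀ + 2) := by
    intro p q h1 h2 h3 v hv
    rw [Finset.mem_union, or_iff_not_imp_right]
    intro hv'
    refine Finset.mem_sdiff.2 ⟨hsub ?_ hv, fun hvN => ?_⟩
    · intro w hw
      rw [mem_rowSegment] at hw ⊢
      omega
    · obtain ⟨⟨s, t⟩, hD, hvD⟩ := mem_vertices_iff.1 hv
      rcases Finset.mem_union.1 hD with hD | hD
      · exact hNK v hvN (mem_vertices_iff.2 ⟨_, hD, hvD⟩)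
      · rw [mem_rowSegment] at hD hvN hv'
        obtain ⟨v1, v2⟩ := v
        simp only [mem_cellVertices, Prod.mk.injEq] at hvD hD hvN hv'
        omega
  have hdisj : ∀ p q : ℤ, c ≤ p → q ≤ b → Disjoint K (rowSegment p q (y₀ + 1)) := by
    intro p q h1 h2
    rw [Finset.disjoint_left]
    intro D hD hD'
    have := mem_rowSegment.1 hD'
    refine H.top D hD D.1 (by omega) (by omega) ?_
    rw [mem_cellVertices]
    refine Or.inr (Or.inr (Or.inl (Prod.ext rfl ?_)))
    dsimp only
    omega
  have hdisjU : ∀ p q : ℤ, c ≤ p → q ≤ b + 1 → Disjoint U (rowSegment p q (y₀ + 2)) := by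
    intro p q h1 h2
    rw [Finset.disjoint_left]
    intro v hv hv'
    refine hNU v ?_ hv
    have := mem_rowSegment.1 hv'
    exact mem_rowSegment.2 ⟨by omega, by omega, this.2.2⟩
  have hn : ∀ p q : ℤ, c ≤ p → p ≤ q → q ≤ b → Cancellative (K ∪ rowSegment p q (y₀ + 1)) →
      rookSeries (K ∪ rowSegment p q (y₀ + 1)) =
        ((oneSubX ^ ((U.card : ℤ) - K.card + 1) : ℤ⟦X⟧ˣ) : ℤ⟦X⟧) *
        monSeries (K ∪ rowSegment p q (y₀ + 1)) (U ∪ rowSegment p (q + 1) (y₀ + 2)) := by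
    intro p q h1 h2 h3 h4
    rw [rookSeries, ← numer_eq h4 (hrow p q h1 h2 h3), numer,
      Finset.card_union_of_disjoint (hdisjU p (q + 1) h1 (by omega)),
      Finset.card_union_of_disjoint (hdisj p q h1 h3)]
    congr 3
    have e1 := card_rowSegment (x₀ := p) (x₁ := q) (y := y₀ + 1) (by omega)
    have e2 := card_rowSegment (x₀ := p) (x₁ := q + 1) (y := y₀ + 2) (by omega)
    push_cast
    omega
  have hK : rookSeries K = ((oneSubX ^ ((U.card : ℤ) - K.card) : ℤ⟦X⟧ˣ) : ℤ⟦X⟧) *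
      monSeries K U := by
    rw [rookSeries, ← numer_eq hc hU, numer]
  have hfree : ∀ w ∈ rowSegment (c + 2) (b - 1) (y₀ + 1),
      ((oneSubX ^ ((U.card : ℤ) - K.card + 1) : ℤ⟦X⟧ˣ) : ℤ⟦X⟧) * monSeries K (U ∪ {up w}) =
        rookSeries K := by
    intro w hw
    have hwN : up w ∈ N := by
      rw [mem_rowSegment] at hw
      rw [hN, mem_rowSegment, up]
      dsimp only
      omega
    rw [rookSeries, ← numer_eq hc (hU.trans (Finset.subset_union_left (s₂ := {up w}))), numer,
      Finset.card_union_of_disjoint (Finset.disjoint_singleton_right.2 (hNU _ hwN)),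
      Finset.card_singleton]
    congr 3
    push_cast
    ring
  have hcard := card_rowSegment (x₀ := c + 2) (x₁ := b - 1) (y := y₀ + 1) (by omega)
  rw [hn c b le_rfl (by omega) le_rfl (H.isRees hc).cancellative,
    hn c c le_rfl le_rfl (by omega) (H.isRees_left hc).cancellative,
    hn b b (by omega) le_rfl le_rfl (H.isRees_right hc).cancellative, key, mul_sub, mul_add,
    mul_add, Finset.mul_sum, Finset.sum_congr rfl hfree, Finset.sum_const, nsmul_eq_mul]
  have hcard' : ((rowSegment (c + 2) (b - 1) (y₀ + 1)).card : ℤ⟦X⟧) = ((b - c - 2 : ℤ) : ℤ⟦X⟧) := by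
    rw [← Int.cast_natCast, hcard]
    congr 1
    ring
  rw [hcard', oneSubX_zpow_succ]
  push_cast
  linear_combination -((b : ℤ⟦X⟧) - c - 1) * (1 - PowerSeries.X) * (-hK)

end IsHat

end Polyomino

namespace Polyomino

variable {S : Finset Cell} {x y z : Mon}

/-! ### Adjacency -/

/-- A unit vector along one of the axes. -/
def IsStep (v : ℤ × ℤ) : Prop := v = (1, 0) ∨ v = (-1, 0) ∨ v = (0, 1) ∨ v = (0, -1)

theorem mem_cellVertices_iff_le {C : Cell} {v : ℤ × ℤ} : v ∈ cellVertices C ↔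
    C.1 ≤ v.1 ∧ v.1 ≤ C.1 + 1 ∧ C.2 ≤ v.2 ∧ v.2 ≤ C.2 + 1 := by
  obtain ⟨p, q⟩ := v
  simp only [mem_cellVertices, Prod.mk.injEq]
  omega

theorem adj_iff {C D : Cell} : Adj C D ↔ IsStep (D - C) := by
  obtain ⟨x, y⟩ := C
  obtain ⟨p, q⟩ := D
  constructor
  · rintro ⟨h, -⟩
    simp only [cellEdges, Finset.mem_insert, Finset.mem_singleton] at h
    simp only [IsStep, Prod.mk_sub_mk, Prod.mk.injEq]
    have key : ∀ v, v ∈ cellVertices (x, y) ∩ cellVertices (p, q) ↔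
      v ∈ cellVertices (x, y) ∧ v ∈ cellVertices (p, q) := fun v => Finset.mem_inter
    simp only [mem_cellVertices_iff_le] at key
    rcases h with h | h | h | h <;>
    · rw [h] at key
      have h1 := key (x, y)
      have h2 := key (x, y + 1)
      have h3 := key (x + 1, y)
      have h4 := key (x + 1, y + 1)
      simp only [Finset.mem_insert, Finset.mem_singleton, Prod.mk.injEq, true_and, and_true,
        true_or, or_true, true_iff] at h1 h2 h3 h4
      omega
  · intro h
    simp only [IsStep, Prod.mk_sub_mk, Prod.mk.injEq] at h
    rcases h with h | h | h | h
    · obtain ⟨rfl, rfl⟩ : p = x + 1 ∧ q = y := by omega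
      have e : cellVertices (x, q) ∩ cellVertices (x + 1, q) = {(x + 1, q), (x + 1, q + 1)} := by
        ext ⟨u, v⟩
        simp only [Finset.mem_inter, Finset.mem_insert, Finset.mem_singleton, mem_cellVertices,
          Prod.mk.injEq]
        omega
      rw [Adj, e]
      simp [cellEdges]
    · obtain ⟨rfl, rfl⟩ : x = p + 1 ∧ q = y := by omega
      have e : cellVertices (p + 1, q) ∩ cellVertices (p, q) = {(p + 1, q), (p + 1, q + 1)} := by
        ext ⟨u, v⟩
        simp only [Finset.mem_inter, Finset.mem_insert, Finset.mem_singleton, mem_cellVertices,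
          Prod.mk.injEq]
        omega
      rw [Adj, e]
      simp [cellEdges]
    · obtain ⟨rfl, rfl⟩ : p = x ∧ q = y + 1 := by omega
      have e : cellVertices (p, y) ∩ cellVertices (p, y + 1) = {(p, y + 1), (p + 1, y + 1)} := by
        ext ⟨u, v⟩
        simp only [Finset.mem_inter, Finset.mem_insert, Finset.mem_singleton, mem_cellVertices,
          Prod.mk.injEq]
        omega
      rw [Adj, e]
      simp [cellEdges]
    · obtain ⟨rfl, rfl⟩ : p = x ∧ y = q + 1 := by omega
      have e : cellVertices (p, q + 1) ∩ cellVertices (p, q) = {(p, q + 1), (p + 1, q + 1)} := by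
        ext ⟨u, v⟩
        simp only [Finset.mem_inter, Finset.mem_insert, Finset.mem_singleton, mem_cellVertices,
          Prod.mk.injEq]
        omega
      rw [Adj, e]
      simp [cellEdges]

theorem Adj.symm {C D : Cell} (h : Adj C D) : Adj D C := ⟨by
  rw [Finset.inter_comm]; exact h.2, by rw [Finset.inter_comm]; exact h.1⟩

theorem adj_cases {C D : Cell} (h : Adj C D) : D = (C.1 + 1, C.2) ∨ D = (C.1 - 1, C.2) ∨
    D = (C.1, C.2 + 1) ∨ D = (C.1, C.2 - 1) := by
  obtain ⟨p, q⟩ := D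
  rw [adj_iff] at h
  simp only [IsStep, Prod.ext_iff, Prod.fst_sub, Prod.snd_sub] at h ⊢
  omega

/-! ### Symmetries of the lattice -/

/-- Two orthogonal unit vectors along the axes. -/
def IsFrame (δ η : ℤ × ℤ) : Prop := IsStep δ ∧ IsStep η ∧ δ.1 * η.1 + δ.2 * η.2 = 0

/-- The coordinates of a lattice point with respect to a frame. -/
def frameVert (δ η v : ℤ × ℤ) : ℤ × ℤ := (v.1 * δ.1 + v.2 * δ.2, v.1 * η.1 + v.2 * η.2)

/-- The coordinates of a cell with respect to a frame. -/
def frameCell (δ η : ℤ × ℤ) (C : Cell) : Cell :=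
  -- A cell is named by its lower left corner, which a reflection moves to another corner; the
  -- minimum corrects for this.
  ((frameVert δ η C).1 + min 0 (δ.1 + δ.2), (frameVert δ η C).2 + min 0 (η.1 + η.2))

theorem frameCell_add (δ η v : ℤ × ℤ) (C : Cell) :
    frameCell δ η (C + v) = frameCell δ η C + frameVert δ η v := by
  ext <;> simp only [frameCell, frameVert, Prod.fst_add, Prod.snd_add] <;> ring

namespace IsFrame

variable {δ η : ℤ × ℤ} (F : IsFrame δ η)
include F

theorem cases : (δ = (1, 0) ∨ δ = (-1, 0)) ∧ (η = (0, 1) ∨ η = (0, -1)) ∨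
    (δ = (0, 1) ∨ δ = (0, -1)) ∧ (η = (1, 0) ∨ η = (-1, 0)) := by
  obtain ⟨h1, h2, h3⟩ := F
  rcases h1 with rfl | rfl | rfl | rfl <;> rcases h2 with rfl | rfl | rfl | rfl <;> simp_all

/-- The matrix with rows `δ` and `η` is orthogonal, so the frame of its columns describes the
inverse symmetry. -/
theorem symm : IsFrame (δ.1, η.1) (δ.2, η.2) := by
  rcases F.cases with ⟨rfl | rfl, rfl | rfl⟩ | ⟨rfl | rfl, rfl | rfl⟩ <;> simp [IsFrame, IsStep]

theorem vert_vert (v : ℤ × ℤ) :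
    frameVert (δ.1, η.1) (δ.2, η.2) (frameVert δ η v) = v := by
  rcases F.cases with ⟨rfl | rfl, rfl | rfl⟩ | ⟨rfl | rfl, rfl | rfl⟩ <;> simp [frameVert]

theorem vert_vert' (v : ℤ × ℤ) :
    frameVert δ η (frameVert (δ.1, η.1) (δ.2, η.2) v) = v := F.symm.vert_vert v

theorem cell_cell (C : Cell) :
    frameCell (δ.1, η.1) (δ.2, η.2) (frameCell δ η C) = C := by
  rcases F.cases with ⟨rfl | rfl, rfl | rfl⟩ | ⟨rfl | rfl, rfl | rfl⟩ <;>
  · ext <;> simp [frameVert, frameCell]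

theorem cell_cell' (C : Cell) :
    frameCell δ η (frameCell (δ.1, η.1) (δ.2, η.2) C) = C := F.symm.cell_cell C

theorem cell_injective : Function.Injective (frameCell δ η) :=
  Function.LeftInverse.injective F.cell_cell

theorem vert_injective : Function.Injective (frameVert δ η) :=
  Function.LeftInverse.injective F.vert_vert

theorem mem_image_cell {C : Cell} :
    C ∈ S.image (frameCell δ η) ↔ frameCell (δ.1, η.1) (δ.2, η.2) C ∈ S := by
  rw [Finset.mem_image]
  constructor
  · rintro ⟨D, hD, rfl⟩; rwa [F.cell_cell]
  · exact fun h => ⟨_, h, F.cell_cell' C⟩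

theorem cell_mem_image {C : Cell} : frameCell δ η C ∈ S.image (frameCell δ η) ↔ C ∈ S := by
  rw [F.mem_image_cell, F.cell_cell]

theorem image_image :
    (S.image (frameCell δ η)).image (frameCell (δ.1, η.1) (δ.2, η.2)) = S := by
  rw [Finset.image_image]
  conv_rhs => rw [← Finset.image_id (s := S)]
  exact Finset.image_congr fun C _ => F.cell_cell C

theorem vert_mem_cell {v : ℤ × ℤ} {C : Cell} :
    frameVert δ η v ∈ cellVertices (frameCell δ η C) ↔ v ∈ cellVertices C := by
  obtain ⟨p, q⟩ := v
  obtain ⟨s, t⟩ := C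
  rcases F.cases with ⟨rfl | rfl, rfl | rfl⟩ | ⟨rfl | rfl, rfl | rfl⟩ <;>
  · simp only [mem_cellVertices, frameVert, frameCell, Prod.mk.injEq]
    omega

theorem cellVertices_cell (C : Cell) :
    cellVertices (frameCell δ η C) = (cellVertices C).image (frameVert δ η) := by
  ext v
  rw [← F.vert_vert' v, F.vert_mem_cell, Finset.mem_image]
  exact ⟨fun h => ⟨_, h, rfl⟩, fun ⟨w, hw, h⟩ => by rwa [← F.vert_injective h]⟩

theorem vertices_image (S : Finset Cell) :
    vertices (S.image (frameCell δ η)) = (vertices S).image (frameVert δ η) := by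
  ext v
  rw [← F.vert_vert' v, mem_vertices_iff, Finset.mem_image]
  constructor
  · rintro ⟨C, hC, hv⟩
    rw [← F.cell_cell' C, F.vert_mem_cell] at hv
    exact ⟨_, mem_vertices_iff.2 ⟨_, F.mem_image_cell.1 hC, hv⟩, rfl⟩
  · rintro ⟨w, hw, h⟩
    rw [← h]
    obtain ⟨C, hC, hv⟩ := mem_vertices_iff.1 hw
    exact ⟨_, F.cell_mem_image.2 hC, F.vert_mem_cell.2 hv⟩

theorem adj_cell {C D : Cell} : Adj (frameCell δ η C) (frameCell δ η D) ↔ Adj C D := by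
  rw [adj_iff, adj_iff]
  obtain ⟨p, q⟩ := D
  obtain ⟨s, t⟩ := C
  rcases F.cases with ⟨rfl | rfl, rfl | rfl⟩ | ⟨rfl | rfl, rfl | rfl⟩ <;>
  · simp only [IsStep, frameVert, frameCell, Prod.mk_sub_mk, Prod.mk.injEq]
    omega

/-- A symmetry of the lattice may swap diagonals with anti-diagonals, so the image of a move is a
move or the reverse of one; hence the conclusion is in terms of `Eqv`. -/
theorem eqv_interval {a b : ℤ × ℤ} (h : IsInnerInterval S a b) :
    Eqv (S.image (frameCell δ η)) {frameVert δ η a, frameVert δ η b}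
      {frameVert δ η (a.1, b.2), frameVert δ η (b.1, a.2)} := by
  set lo : ℤ × ℤ := (min (frameVert δ η a).1 (frameVert δ η b).1,
    min (frameVert δ η a).2 (frameVert δ η b).2) with hlo
  set hi : ℤ × ℤ := (max (frameVert δ η a).1 (frameVert δ η b).1,
    max (frameVert δ η a).2 (frameVert δ η b).2) with hhi
  have hint : IsInnerInterval (S.image (frameCell δ η)) lo hi := by
    obtain ⟨p, q⟩ := a
    obtain ⟨s, t⟩ := b
    rw [interval_iff] at h ⊢
    obtain ⟨h1, h2, h3⟩ := h
    dsimp only at h1 h2 h3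
    rw [hlo, hhi]
    simp only [F.mem_image_cell]
    rcases F.cases with ⟨rfl | rfl, rfl | rfl⟩ | ⟨rfl | rfl, rfl | rfl⟩ <;>
    · simp only [frameVert, frameCell]
      refine ⟨by omega, by omega, fun u v h4 h5 h6 h7 => h3 _ _ ?_ ?_ ?_ ?_⟩ <;> omega
  have h1 := h.1
  have h2 := h.2.1
  have e := Eqv.of_interval hint 0
  have key : (({frameVert δ η a, frameVert δ η b} : Mon) = {lo, hi} ∧
      ({frameVert δ η (a.1, b.2), frameVert δ η (b.1, a.2)} : Mon) =
        {(lo.1, hi.2), (hi.1, lo.2)}) ∨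
      (({frameVert δ η (a.1, b.2), frameVert δ η (b.1, a.2)} : Mon) = {lo, hi} ∧
      ({frameVert δ η a, frameVert δ η b} : Mon) = {(lo.1, hi.2), (hi.1, lo.2)}) := by
    obtain ⟨p, q⟩ := a
    obtain ⟨s, t⟩ := b
    dsimp only at h1 h2
    have e1 : min p s = p := min_eq_left h1.le
    have e2 : max p s = s := max_eq_right h1.le
    have e3 : min q t = q := min_eq_left h2.le
    have e4 : max q t = t := max_eq_right h2.le
    have e5 : min (-p) (-s) = -s := min_eq_right (by omega)
    have e6 : max (-p) (-s) = -p := max_eq_left (by omega)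
    have e7 : min (-q) (-t) = -t := min_eq_right (by omega)
    have e8 : max (-q) (-t) = -q := max_eq_left (by omega)
    rcases F.cases with ⟨rfl | rfl, rfl | rfl⟩ | ⟨rfl | rfl, rfl | rfl⟩ <;>
    · simp only [hlo, hhi, frameVert, mul_one, mul_zero, add_zero, zero_add, mul_neg,
        e1, e2, e3, e4, e5, e6, e7, e8]
      first
      | (left; constructor <;> first | trivial | exact Multiset.pair_comm _ _)
      | (right; constructor <;> first | trivial | exact Multiset.pair_comm _ _)
  rcases key with ⟨k1, k2⟩ | ⟨k1, k2⟩
  · rw [k1, k2]; exact e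
  · rw [k1, k2]; exact e.symm

theorem eqv_image (h : Eqv S x y) :
    Eqv (S.image (frameCell δ η)) (x.map (frameVert δ η)) (y.map (frameVert δ η)) := by
  have key : ∀ x y, Move S x y →
      Eqv (S.image (frameCell δ η)) (x.map (frameVert δ η)) (y.map (frameVert δ η)) := by
    rintro x y ⟨a, b, z, hab, rfl, rfl⟩
    have := (F.eqv_interval hab).add_right (z.map (frameVert δ η))
    simpa using this
  induction h with
  | refl => exact Eqv.refl _ _
  | tail _ h ih => exact ih.trans (h.elim (key _ _) fun h => (key _ _ h).symm)

theorem map_map (x : Mon) :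
    (x.map (frameVert δ η)).map (frameVert (δ.1, η.1) (δ.2, η.2)) = x := by
  rw [Multiset.map_map]
  conv_rhs => rw [← Multiset.map_id x]
  exact Multiset.map_congr rfl fun v _ => F.vert_vert v

theorem eqv_image_iff : Eqv (S.image (frameCell δ η)) (x.map (frameVert δ η))
    (y.map (frameVert δ η)) ↔ Eqv S x y := by
  refine ⟨fun h => ?_, F.eqv_image⟩
  have := F.symm.eqv_image h
  rwa [F.image_image, F.map_map, F.map_map] at this

theorem cancellative_image (h : Cancellative S) : Cancellative (S.image (frameCell δ η)) := by
  intro x y z hxyz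
  have e : ∀ x : Mon, (x.map (frameVert (δ.1, η.1) (δ.2, η.2))).map (frameVert δ η) = x :=
    F.symm.map_map
  rw [← e x, ← e y, F.eqv_image_iff]
  refine h _ _ (z.map (frameVert (δ.1, η.1) (δ.2, η.2))) ?_
  rwa [← F.eqv_image_iff, Multiset.map_add, Multiset.map_add, e, e, e]

theorem cancellative_image_iff : Cancellative (S.image (frameCell δ η)) ↔ Cancellative S := by
  refine ⟨fun h => ?_, F.cancellative_image⟩
  have := F.symm.cancellative_image h
  rwa [F.image_image] at this

theorem rookSeries_image (S : Finset Cell) : rookSeries (S.image (frameCell δ η)) = rookSeries S := by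
  have hm : monSeries (S.image (frameCell δ η)) ((vertices S).image (frameVert δ η)) =
      PowerSeries.X ^ 0 * monSeries S (vertices S) := by
    refine classSeries_congr (fun x => x.map (frameVert δ η)) 0
      (fun x _ => Multiset.card_map _ _) ?_ ?_ ?_
    · intro x hx v hv
      obtain ⟨w, hw, rfl⟩ := Multiset.mem_map.1 hv
      exact Finset.mem_image_of_mem _ (hx w hw)
    · intro x _ y _
      exact F.eqv_image_iff.symm
    · intro y hy
      refine ⟨y.map (frameVert (δ.1, η.1) (δ.2, η.2)), ?_, ?_, ?_⟩
      · intro v hv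
        obtain ⟨w, hw, rfl⟩ := Multiset.mem_map.1 hv
        obtain ⟨u, hu, rfl⟩ := Finset.mem_image.1 (hy w hw)
        rwa [F.vert_vert]
      · change Eqv _ _ _
        have : (y.map (frameVert (δ.1, η.1) (δ.2, η.2))).map (frameVert δ η) = y :=
          F.symm.map_map y
        rw [this]
        exact Eqv.refl _ _
      · rw [Multiset.card_map, Multiset.card_map]
  rw [rookSeries, rookSeries, numer, numer, F.vertices_image,
    Finset.card_image_of_injective _ F.vert_injective,
    Finset.card_image_of_injective _ F.cell_injective, hm, pow_zero, one_mul]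

end IsFrame

end Polyomino

namespace Polyomino

/-! ### Paths of cells -/

/-- The cells `t lo, …, t hi` form a path in which cells at distance more than two do not meet. -/
structure IsPath (t : ℤ → Cell) (lo hi : ℤ) : Prop where
  adj : ∀ k, lo ≤ k → k < hi → Adj (t k) (t (k + 1))
  ne : ∀ k, lo ≤ k → k + 1 < hi → t k ≠ t (k + 2)
  disj : ∀ i j, lo ≤ i → i + 2 < j → j ≤ hi → Disjoint (cellVertices (t i)) (cellVertices (t j))

/-- The set of cells of a segment of a path. -/
noncomputable def seg (t : ℤ → Cell) (i j : ℤ) : Finset Cell := (Finset.Icc i j).image t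

theorem mem_seg {t : ℤ → Cell} {i j : ℤ} {C : Cell} :
    C ∈ seg t i j ↔ ∃ k, i ≤ k ∧ k ≤ j ∧ t k = C := by
  simp [seg, and_assoc]

theorem seg_comp {t : ℤ → Cell} {i j : ℤ} (g : Cell → Cell) :
    seg (g ∘ t) i j = (seg t i j).image g := Finset.image_image.symm

theorem seg_empty (t : ℤ → Cell) {i j : ℤ} (h : j < i) : seg t i j = ∅ := by
  rw [seg, Finset.Icc_eq_empty (by omega), Finset.image_empty]

theorem IsStep.ne_zero {v : ℤ × ℤ} (h : IsStep v) : v ≠ 0 := by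
  rcases h with rfl | rfl | rfl | rfl <;> simp

theorem IsStep.neg {v : ℤ × ℤ} (h : IsStep v) : IsStep (-v) := by
  rcases h with rfl | rfl | rfl | rfl <;> simp [IsStep]

theorem IsStep.orth {v w : ℤ × ℤ} (hv : IsStep v) (hw : IsStep w) (h1 : w ≠ v) (h2 : w ≠ -v) :
    IsFrame v w := by
  refine ⟨hv, hw, ?_⟩
  rcases hv with rfl | rfl | rfl | rfl <;> rcases hw with rfl | rfl | rfl | rfl <;> simp_all

theorem IsStep.exists_frame {v : ℤ × ℤ} (hv : IsStep v) : ∃ w, IsFrame v w := by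
  refine ⟨(-v.2, v.1), hv, ?_, by ring⟩
  rcases hv with rfl | rfl | rfl | rfl <;> simp [IsStep]

theorem IsFrame.vert_left {δ η : ℤ × ℤ} (F : IsFrame δ η) : frameVert δ η δ = (1, 0) := by
  rcases F.cases with ⟨rfl | rfl, rfl | rfl⟩ | ⟨rfl | rfl, rfl | rfl⟩ <;> simp [frameVert]

theorem IsFrame.vert_right {δ η : ℤ × ℤ} (F : IsFrame δ η) : frameVert δ η η = (0, 1) := by
  rcases F.cases with ⟨rfl | rfl, rfl | rfl⟩ | ⟨rfl | rfl, rfl | rfl⟩ <;> simp [frameVert]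

theorem Adj.ne {C D : Cell} (h : Adj C D) : C ≠ D := by
  rintro rfl
  rw [adj_iff, sub_self] at h
  exact h.ne_zero rfl

namespace IsPath

variable {t : ℤ → Cell} {lo hi : ℤ}

theorem mono (hp : IsPath t lo hi) {i j : ℤ} (h : lo ≤ i) (h' : j ≤ hi) : IsPath t i j where
  adj k h1 h2 := hp.adj k (by omega) (by omega)
  ne k h1 h2 := hp.ne k (by omega) (by omega)
  disj a b h1 h2 h3 := hp.disj a b (by omega) h2 (by omega)

theorem frame (hp : IsPath t lo hi) {δ η : ℤ × ℤ} (F : IsFrame δ η) :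
    IsPath (frameCell δ η ∘ t) lo hi where
  adj k h1 h2 := F.adj_cell.2 (hp.adj k h1 h2)
  ne k h1 h2 h := hp.ne k h1 h2 (F.cell_injective h)
  disj a b h1 h2 h3 := by
    simp only [Function.comp_apply]
    rw [F.cellVertices_cell, F.cellVertices_cell, Finset.disjoint_image F.vert_injective]
    exact hp.disj a b h1 h2 h3

theorem reverse (hp : IsPath t lo hi) : IsPath (fun k => t (-k)) (-hi) (-lo) where
  adj k h1 h2 := by
    have := hp.adj (-(k + 1)) (by omega) (by omega)
    rw [show -(k + 1) + 1 = -k by ring] at this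
    exact this.symm
  ne k h1 h2 h := by
    refine hp.ne (-(k + 2)) (by omega) (by omega) ?_
    rw [show -(k + 2) + 2 = -k by ring]
    exact h.symm
  disj a b h1 h2 h3 := (hp.disj (-b) (-a) (by omega) (by omega) (by omega)).symm

theorem near (hp : IsPath t lo hi) {i j : ℤ} (h1 : lo ≤ i) (h2 : j ≤ hi) {v : ℤ × ℤ}
    (hv : v ∈ cellVertices (t i)) (hv' : v ∈ cellVertices (t j)) : j ≤ i + 2 := by
  by_contra h
  exact Finset.disjoint_left.1 (hp.disj i j h1 (by omega) h2) hv hv'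

theorem inj (hp : IsPath t lo hi) {i j : ℤ} (h1 : lo ≤ i) (h2 : j ≤ hi) (hij : i < j) :
    t i ≠ t j := by
  intro h
  have hm : ((t i).1, (t i).2) ∈ cellVertices (t i) := by simp [mem_cellVertices]
  have := hp.near h1 h2 hm (h ▸ hm)
  rcases (by omega : j = i + 1 ∨ j = i + 2) with rfl | rfl
  · exact (hp.adj i h1 (by omega)).ne h
  · exact hp.ne i h1 (by omega) h

theorem seg_reverse (t : ℤ → Cell) (i j : ℤ) : seg (fun k => t (-k)) (-j) (-i) = seg t i j := by
  ext C
  rw [mem_seg, mem_seg]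
  constructor
  · rintro ⟨k, h1, h2, h3⟩; exact ⟨-k, by omega, by omega, h3⟩
  · rintro ⟨k, h1, h2, h3⟩; exact ⟨-k, by omega, by omega, by rwa [neg_neg]⟩

theorem seg_erase (hp : IsPath t lo hi) (h : lo ≤ hi) :
    (seg t lo hi).erase (t hi) = seg t lo (hi - 1) := by
  ext C
  rw [Finset.mem_erase, mem_seg, mem_seg]
  constructor
  · rintro ⟨h1, k, h2, h3, rfl⟩
    exact ⟨k, h2, by have : k ≠ hi := by rintro rfl; exact h1 rfl
                     omega, rfl⟩
  · rintro ⟨k, h1, h2, rfl⟩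
    exact ⟨hp.inj h1 le_rfl (by omega), k, h1, by omega, rfl⟩

theorem seg_sdiff (hp : IsPath t lo hi) {k : ℤ} (hk : k ≤ hi) :
    seg t lo hi \ seg t k hi = seg t lo (k - 1) := by
  ext C
  simp only [Finset.mem_sdiff, mem_seg]
  constructor
  · rintro ⟨⟨p, h2, h3, rfl⟩, h1⟩
    refine ⟨p, h2, ?_, rfl⟩
    by_contra h4
    exact h1 ⟨p, by omega, h3, rfl⟩
  · rintro ⟨p, h1, h2, rfl⟩
    refine ⟨⟨p, h1, by omega, rfl⟩, ?_⟩
    rintro ⟨q, h3, h4, h5⟩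
    exact hp.inj h1 h4 (by omega) h5.symm

/-- Cells more than two steps before the last run cannot touch it, and the last cells before it lie
too low, since the run is entered from below. -/
theorem isTail (hp : IsPath t lo hi) {k x y : ℤ} (hk : lo ≤ k) (hkj : k < hi)
    (run : ∀ p, k ≤ p → p ≤ hi → t p = (x + (p - k), y)) (turn : lo < k → t (k - 1) = (x, y - 1)) :
    IsTail (seg t lo hi) x (x + (hi - k)) y where
  le := by omega
  sub u h1 h2 := mem_seg.2 ⟨u - x + k, by omega, by omega, by
    rw [run _ (by omega) (by omega)]; exact Prod.ext (by dsimp only; omega) rfl⟩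
  corner := by
    intro D hD hne
    obtain ⟨p, h1, h2, rfl⟩ := mem_seg.1 hD
    have hhi := run hi hkj.le le_rfl
    have key : ∀ v : ℤ, y ≤ v → v ≤ y + 1 → (x + (hi - k) + 1, v) ∉ cellVertices (t p) := by
      intro v hv1 hv2 hv
      have hv' : (x + (hi - k) + 1, v) ∈ cellVertices (t hi) := by
        rw [hhi, mem_cellVertices_iff_le]; dsimp only; omega
      have h3 := hp.near h1 le_rfl hv hv'
      by_cases hpk : k ≤ p
      · rw [run p hpk h2, mem_cellVertices_iff_le] at hv
        dsimp only at hv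
        obtain rfl : p = hi := by omega
        exact hne hhi
      · obtain rfl : p = k - 1 := by omega
        rw [turn (by omega), mem_cellVertices_iff_le] at hv
        dsimp only at hv
        omega
    exact ⟨key _ (by omega) le_rfl, key _ le_rfl (by omega)⟩
  line := by
    intro D hD hnot u h1 h2 hv
    obtain ⟨p, h3, h4, rfl⟩ := mem_seg.1 hD
    have hq := run (u - x + k) (by omega) (by omega)
    have hv' : (u, y + 1) ∈ cellVertices (t (u - x + k)) := by
      rw [hq, mem_cellVertices_iff_le]; dsimp only; omega
    have hpk : p < k := by
      by_contra h5
      rw [run p (by omega) h4] at hnot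
      dsimp only at hnot
      omega
    have h5 := hp.near h3 (by omega) hv hv'
    have ht := turn (by omega)
    by_cases hp1 : p = k - 1
    · subst hp1
      rw [ht, mem_cellVertices_iff_le] at hv
      dsimp only at hv
      omega
    -- A neighbour of `(x, y - 1)` touching the line `y + 1` could only be `(x, y)`, which is `t k`.
    · obtain rfl : p = k - 2 := by omega
      have hadj := hp.adj (k - 2) h3 (by omega)
      have hne := hp.ne (k - 2) h3 (by omega)
      rw [show k - 2 + 1 = k - 1 by ring, ht] at hadj
      rw [show k - 2 + 2 = k by ring, run k le_rfl hkj.le] at hne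
      rw [mem_cellVertices_iff_le] at hv
      generalize t (k - 2) = D at hadj hne hv
      obtain ⟨a, b⟩ := D
      have := adj_cases hadj
      simp only [Prod.mk.injEq, ne_eq, not_and] at this hne hv
      omega

theorem seg_run (run : ∀ p, lo ≤ p → p ≤ hi → t p = (x + (p - lo), y)) :
    seg t lo hi = rowSegment x (x + (hi - lo)) y := by
  ext ⟨a, b⟩
  rw [mem_seg, mem_rowSegment]
  constructor
  · rintro ⟨k, h1, h2, h3⟩
    rw [run k h1 h2, Prod.mk.injEq] at h3
    dsimp only
    omega
  · rintro ⟨h1, h2, h3⟩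
    dsimp only at h1 h2 h3
    refine ⟨a - x + lo, by omega, by omega, ?_⟩
    rw [run _ (by omega) (by omega), Prod.mk.injEq]
    omega

theorem step_normal (hp : IsPath t lo hi) {k x y : ℤ} (hk : lo ≤ k) (hkj : k < hi)
    (run : ∀ p, k ≤ p → p ≤ hi → t p = (x + (p - k), y)) (turn : lo < k → t (k - 1) = (x, y - 1))
    (h1 : Cancellative (seg t lo (hi - 1))) (h2 : Cancellative (seg t lo (k - 1))) :
    Cancellative (seg t lo hi) ∧ rookSeries (seg t lo hi) =
      rookSeries (seg t lo (hi - 1)) + PowerSeries.X * rookSeries (seg t lo (k - 1)) := by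
  have hT := hp.isTail hk hkj run turn
  have e1 := hp.seg_erase (by omega)
  have e2 := hp.seg_sdiff hkj.le
  rw [run hi hkj.le le_rfl] at e1
  rw [seg_run run] at e2
  rw [← e1] at h1
  rw [← e2] at h2
  rw [← e1, ← e2]
  exact ⟨hT.cancellative h1, hT.rookSeries_eq h1 h2⟩

/-- A frame formed by the direction `δ` of the last run and the direction in which the run is
entered reduces to `step_normal`. If the path is one straight run, any direction orthogonal to `δ`
will do. -/
theorem step (hp : IsPath t lo hi) {k : ℤ} {δ : ℤ × ℤ} (hk : lo ≤ k) (hkj : k < hi)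
    (run : ∀ p, k ≤ p → p < hi → t (p + 1) = t p + δ) (turn : lo < k → t k ≠ t (k - 1) + δ)
    (h1 : Cancellative (seg t lo (hi - 1))) (h2 : Cancellative (seg t lo (k - 1))) :
    Cancellative (seg t lo hi) ∧ rookSeries (seg t lo hi) =
      rookSeries (seg t lo (hi - 1)) + PowerSeries.X * rookSeries (seg t lo (k - 1)) := by
  have hδ : IsStep δ := by
    have := hp.adj k hk hkj
    rwa [run k le_rfl hkj, adj_iff, add_sub_cancel_left] at this
  obtain ⟨η, F, hη⟩ : ∃ η, IsFrame δ η ∧ (lo < k → t k = t (k - 1) + η) := by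
    by_cases hlk : lo < k
    · have ha := hp.adj (k - 1) (by omega) (by omega)
      have hn := hp.ne (k - 1) (by omega) (by omega)
      rw [sub_add_cancel, adj_iff] at ha
      rw [show k - 1 + 2 = k + 1 by ring, run k le_rfl hkj] at hn
      refine ⟨_, hδ.orth ha ?_ ?_, fun _ => by abel⟩
      · exact fun h => turn hlk (by rw [← h]; abel)
      · intro h
        refine hn ?_
        rw [← neg_eq_iff_eq_neg.2 h]; abel
    · obtain ⟨η, F⟩ := hδ.exists_frame
      exact ⟨η, F, fun h => absurd h hlk⟩
  have hrun : ∀ n : ℕ, k + n ≤ hi → (frameCell δ η ∘ t) (k + n) =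
      ((frameCell δ η (t k)).1 + n, (frameCell δ η (t k)).2) := by
    intro n
    induction n with
    | zero => intro _; simp
    | succ n ih =>
      intro hn
      push_cast at hn ⊢
      have h3 := ih (by omega)
      rw [Function.comp_apply] at h3 ⊢
      rw [← add_assoc, run _ (by omega) (by omega), frameCell_add, h3, F.vert_left]
      ext <;> simp [add_assoc]
  have := (hp.frame F).step_normal (k := k) (x := (frameCell δ η (t k)).1)
    (y := (frameCell δ η (t k)).2) hk hkj ?_ ?_ ?_ ?_
  · rwa [seg_comp, seg_comp, seg_comp, F.cancellative_image_iff, F.rookSeries_image,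
      F.rookSeries_image, F.rookSeries_image] at this
  · intro p h3 h4
    have h5 := hrun (p - k).toNat (by omega)
    rw [Int.toNat_of_nonneg (by omega), add_sub_cancel] at h5
    exact h5
  · intro h
    rw [Function.comp_apply, hη h, frameCell_add, F.vert_right]
    simp
  · rwa [seg_comp, F.cancellative_image_iff]
  · rwa [seg_comp, F.cancellative_image_iff]

theorem exists_run {k₀ : ℤ} (hk₀ : lo ≤ k₀) {δ : ℤ × ℤ}
    (run : ∀ p, k₀ ≤ p → p < hi → t (p + 1) = t p + δ) :
    ∃ k, lo ≤ k ∧ k ≤ k₀ ∧ (∀ p, k ≤ p → p < hi → t (p + 1) = t p + δ) ∧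
      (lo < k → t k ≠ t (k - 1) + δ) := by
  obtain ⟨n, hn⟩ : ∃ n : ℕ, k₀ = lo + n := ⟨(k₀ - lo).toNat, by omega⟩
  induction n generalizing k₀ with
  | zero => exact ⟨k₀, hk₀, le_rfl, run, fun h => by simp at hn; omega⟩
  | succ n ih =>
    push_cast at hn
    by_cases h : t k₀ = t (k₀ - 1) + δ
    · obtain ⟨k, h1, h2, h3⟩ := ih (k₀ := k₀ - 1) (by omega) (fun p h1 h2 => by
        by_cases hp : k₀ ≤ p
        · exact run p hp h2
        · obtain rfl : p = k₀ - 1 := by omega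
          rwa [sub_add_cancel]) (by omega)
      exact ⟨k, h1, by omega, h3⟩
    · exact ⟨k₀, hk₀, le_rfl, run, fun _ => h⟩

end IsPath

theorem single_cancellative_rookSeries (C : Cell) :
    Cancellative {C} ∧ rookSeries {C} = 1 + PowerSeries.X := by
  have hT : IsTail {C} C.1 C.1 C.2 := by
    refine ⟨le_rfl, fun x h1 h2 => ?_, fun D hD hne => ?_, fun D hD hne => ?_⟩
    · rw [Finset.mem_singleton]; exact Prod.ext (le_antisymm h2 h1) rfl
    · exact absurd (Finset.mem_singleton.1 hD) hne
    · rw [Finset.mem_singleton.1 hD] at hne; simp at hne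
  have e1 : ({C} : Finset Cell).erase (C.1, C.2) = ∅ := by simp
  have e2 : ({C} : Finset Cell) \ rowSegment C.1 C.1 C.2 = ∅ := by
    rw [Finset.sdiff_eq_empty_iff_subset]
    intro D hD
    rw [Finset.mem_singleton.1 hD, mem_rowSegment]
    exact ⟨le_rfl, le_rfl, rfl⟩
  have hc := cancellative_empty
  have h1 := hT.cancellative (by rw [e1]; exact hc)
  have h2 := hT.rookSeries_eq (by rw [e1]; exact hc) (by rw [e2]; exact hc)
  rw [e1, e2, rookSeries_empty, mul_one] at h2
  exact ⟨h1, h2⟩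

theorem seg_self (t : ℤ → Cell) (i : ℤ) : seg t i i = {t i} := by simp [seg]

/-- The classes of monomials are cancellative and the numerator of the series is a polynomial
with a positive value at `1`. -/
def IsGood (S : Finset Cell) : Prop :=
  Cancellative S ∧ ∃ h : ℤ[X], rookSeries S = h ∧ 0 < h.eval 1

namespace IsPath

variable {t : ℤ → Cell} {lo hi : ℤ}

/-- The recursion has nonnegative coefficients, so positivity at `1` is inherited. It is what later
identifies the exponent of `1 - t` with the Krull dimension. -/
theorem isGood (hp : IsPath t lo hi) : IsGood (seg t lo hi) := by
  obtain ⟨n, hn⟩ : ∃ n : ℕ, hi < lo + n := ⟨(hi - lo + 1).toNat, by omega⟩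
  induction n using Nat.strong_induction_on generalizing hi with
  | _ n ih =>
    by_cases h0 : hi < lo
    · rw [seg_empty _ h0]
      exact ⟨cancellative_empty, 1, by simp [rookSeries_empty], by simp⟩
    rcases eq_or_ne lo hi with rfl | hne
    · rw [seg_self]
      obtain ⟨h1, h2⟩ := single_cancellative_rookSeries (t lo)
      exact ⟨h1, 1 + Polynomial.X, by rw [h2]; simp, by simp⟩
    obtain ⟨k, h1, h2, h3, h4⟩ := exists_run (t := t) (lo := lo) (hi := hi) (k₀ := hi - 1)
      (δ := t hi - t (hi - 1)) (by omega) (fun p h1 h2 => by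
        obtain rfl : p = hi - 1 := by omega
        rw [sub_add_cancel]; abel)
    obtain ⟨c1, f, e1, f1⟩ := ih (n - 1) (by omega) (hp.mono (i := lo) (j := hi - 1) le_rfl (by omega)) (by omega)
    obtain ⟨c2, g, e2, g1⟩ := ih (n - 1) (by omega) (hp.mono (i := lo) (j := k - 1) le_rfl (by omega)) (by omega)
    obtain ⟨c3, e3⟩ := hp.step h1 (by omega) h3 h4 c1 c2
    refine ⟨c3, f + Polynomial.X * g, by rw [e3, e1, e2]; simp, ?_⟩
    simp only [Polynomial.eval_add, Polynomial.eval_mul, Polynomial.eval_X, one_mul]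
    omega

theorem rookSeries_last (hp : IsPath t lo hi) {k : ℤ} {δ : ℤ × ℤ} (hk : lo ≤ k) (hkj : k < hi)
    (run : ∀ p, k ≤ p → p < hi → t (p + 1) = t p + δ) (turn : lo < k → t k ≠ t (k - 1) + δ) :
    rookSeries (seg t lo hi) =
      rookSeries (seg t lo (hi - 1)) + PowerSeries.X * rookSeries (seg t lo (k - 1)) :=
  (hp.step hk hkj run turn (hp.mono (j := hi - 1) le_rfl (by omega)).isGood.1
    (hp.mono (j := k - 1) le_rfl (by omega)).isGood.1).2

theorem rookSeries_first (hp : IsPath t lo hi) {k : ℤ} {δ : ℤ × ℤ} (hk : lo < k) (hkj : k ≤ hi)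
    (run : ∀ p, lo ≤ p → p < k → t (p + 1) = t p + δ) (turn : k < hi → t (k + 1) ≠ t k + δ) :
    rookSeries (seg t lo hi) =
      rookSeries (seg t (lo + 1) hi) + PowerSeries.X * rookSeries (seg t (k + 1) hi) := by
  have := hp.reverse.rookSeries_last (k := -k) (δ := -δ) (by omega) (by omega) ?_ ?_
  · rw [show -lo - 1 = -(lo + 1) by ring, show -k - 1 = -(k + 1) by ring] at this
    rwa [seg_reverse, seg_reverse, seg_reverse] at this
  · intro p h1 h2
    have h3 := run (-(p + 1)) (by omega) (by omega)
    rw [show -(p + 1) + 1 = -p by ring] at h3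
    rw [h3]; abel
  · intro h h3
    refine turn (by omega) ?_
    rw [neg_neg, show -(-k - 1) = k + 1 by ring] at h3
    rw [h3]; abel

end IsPath

end Polyomino

namespace Polyomino

/-! ### Segments of paths are simple polyominoes -/

/-- One cell can be reached from another by a walk in `S`. -/
def Reach (S : Set Cell) : Cell → Cell → Prop :=
  Relation.ReflTransGen fun X Y => Adj X Y ∧ Y ∈ S

theorem Reach.symm {S : Set Cell} {C D : Cell} (hC : C ∈ S) (h : Reach S C D) : Reach S D C := by
  suffices h' : Reach S D C ∧ D ∈ S from h'.1
  induction h with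
  | refl => exact ⟨Relation.ReflTransGen.refl, hC⟩
  | tail _ h ih => exact ⟨Relation.ReflTransGen.head ⟨h.1.symm, ih.2⟩ ih.1, h.2⟩

theorem cellConnected_univ : CellConnected Set.univ := by
  intro C _ D _
  have key : ∀ n : ℕ, ∀ C : Cell, (D.1 - C.1).natAbs + (D.2 - C.2).natAbs = n →
      Reach Set.univ C D := by
    intro n
    induction n with
    | zero =>
      intro C h
      have : C = D := Prod.ext (by omega) (by omega)
      rw [this]
      exact Relation.ReflTransGen.refl
    | succ n ih =>
      intro C h
      have step : ∀ v : ℤ × ℤ, IsStep v → (D.1 - (C + v).1).natAbs + (D.2 - (C + v).2).natAbs = n →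
          Reach Set.univ C D := fun v hv h' => Relation.ReflTransGen.head
        ⟨adj_iff.2 (by rwa [add_sub_cancel_left]), Set.mem_univ _⟩ (ih _ h')
      by_cases h1 : C.1 < D.1
      · exact step (1, 0) (by simp [IsStep]) (by simp only [Prod.fst_add, Prod.snd_add]; omega)
      by_cases h2 : D.1 < C.1
      · exact step (-1, 0) (by simp [IsStep]) (by simp only [Prod.fst_add, Prod.snd_add]; omega)
      by_cases h3 : C.2 < D.2
      · exact step (0, 1) (by simp [IsStep]) (by simp only [Prod.fst_add, Prod.snd_add]; omega)
      · exact step (0, -1) (by simp [IsStep]) (by simp only [Prod.fst_add, Prod.snd_add]; omega)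
  exact key _ C rfl

theorem IsFrame.step_cases {δ η v : ℤ × ℤ} (F : IsFrame δ η) (hv : IsStep v) :
    v = δ ∨ v = -δ ∨ v = η ∨ v = -η := by
  rcases F.cases with ⟨rfl | rfl, rfl | rfl⟩ | ⟨rfl | rfl, rfl | rfl⟩ <;>
  rcases hv with rfl | rfl | rfl | rfl <;> simp

/-- Adding a cell to a set with connected complement keeps the complement connected, if the set
touches the cell only from one side. -/
theorem cellConnected_compl_insert {S : Finset Cell} {C : Cell} {δ η : ℤ × ℤ} (F : IsFrame δ η)
    (h : CellConnected ((S : Set Cell)ᶜ)) (hC : C ∉ S)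
    (hring : ∀ w ∈ ({-δ - η, -η, δ - η, δ, δ + η, η} : Set (ℤ × ℤ)), C + w ∉ S) :
    CellConnected (((insert C S : Finset Cell) : Set Cell)ᶜ) := by
  set T : Set Cell := ((insert C S : Finset Cell) : Set Cell)ᶜ with hT
  have hmem : ∀ {X : Cell}, X ∈ T ↔ X ≠ C ∧ X ∉ S := by
    intro X
    rw [hT, Set.mem_compl_iff, Finset.mem_coe, Finset.mem_insert, not_or]
  have hne : ∀ w ∈ ({-δ - η, -η, δ - η, δ, δ + η, η} : Set (ℤ × ℤ)), w ≠ 0 := by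
    rcases F.cases with ⟨rfl | rfl, rfl | rfl⟩ | ⟨rfl | rfl, rfl | rfl⟩ <;> simp
  have hR : ∀ w ∈ ({-δ - η, -η, δ - η, δ, δ + η, η} : Set (ℤ × ℤ)), C + w ∈ T := fun w hw =>
    hmem.2 ⟨fun h' => hne w hw (add_eq_left.1 h'), hring w hw⟩
  have m1 := hR (-δ - η) (by simp)
  have m2 := hR (-η) (by simp)
  have m3 := hR (δ - η) (by simp)
  have m4 := hR δ (by simp)
  have m5 := hR (δ + η) (by simp)
  have m6 := hR η (by simp)
  have one : ∀ {X Y : Cell}, Y ∈ T → IsStep (Y - X) → Reach T X Y := fun h1 h2 =>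
    Relation.ReflTransGen.single ⟨adj_iff.2 h2, h1⟩
  have r6 : Reach T (C + η) (C + δ) := by
    refine (one (Y := C + (δ + η)) m5 ?_).trans (one m4 ?_)
    · rw [show C + (δ + η) - (C + η) = δ by abel]; exact F.1
    · rw [show C + δ - (C + (δ + η)) = -η by abel]; exact F.2.1.neg
  have r2 : Reach T (C + -η) (C + δ) := by
    refine (one (Y := C + (δ - η)) m3 ?_).trans (one m4 ?_)
    · rw [show C + (δ - η) - (C + -η) = δ by abel]; exact F.1
    · rw [show C + δ - (C + (δ - η)) = η by abel]; exact F.2.1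
  have r0 : Reach T (C + -δ) (C + δ) := by
    refine (one (Y := C + (-δ - η)) m1 ?_).trans ((one (Y := C + -η) m2 ?_).trans r2)
    · rw [show C + (-δ - η) - (C + -δ) = -η by abel]; exact F.2.1.neg
    · rw [show C + -η - (C + (-δ - η)) = δ by abel]; exact F.1
  -- The six free cells form an arc around `C` that passes by or next to each neighbour of `C`
  -- outside `S`, so all these neighbours reach `C + δ` without using `C`.
  have hub : ∀ U : Cell, U ∈ T → Adj C U → Reach T U (C + δ) := by
    intro U _ hCU
    have hU : U = C + (U - C) := by abel
    rcases F.step_cases (adj_iff.1 hCU) with h1 | h1 | h1 | h1 <;> rw [hU, h1]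
    exacts [Relation.ReflTransGen.refl, r0, r6, r2]
  intro X hX Y hY
  -- A walk outside `S` is followed step by step; while it stands on `C` itself, only a detour to `C
  -- + δ` is recorded.
  have key : ∀ Z, Reach ((S : Set Cell)ᶜ) X Z →
      (Z ∉ S) ∧ (Z ≠ C → Reach T X Z) ∧ (Z = C → Reach T X (C + δ)) := by
    intro Z hZ
    induction hZ with
    | refl =>
      exact ⟨(hmem.1 hX).2, fun _ => Relation.ReflTransGen.refl, fun h1 => absurd h1 (hmem.1 hX).1⟩
    | @tail Z W _ hZW ih =>
      obtain ⟨i0, i1, i2⟩ := ih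
      have hW : W ∉ S := hZW.2
      refine ⟨hW, fun hWC => ?_, ?_⟩
      · have hWT : W ∈ T := hmem.2 ⟨hWC, hW⟩
        by_cases hZC : Z = C
        · exact (i2 hZC).trans ((hub W hWT (hZC ▸ hZW.1)).symm hWT)
        · exact (i1 hZC).tail ⟨hZW.1, hWT⟩
      · rintro rfl
        have hZC : Z ≠ W := hZW.1.ne
        exact (i1 hZC).trans (hub Z (hmem.2 ⟨hZC, i0⟩) hZW.1.symm)
  exact (key Y (h X (hmem.1 hX).2 Y (hmem.1 hY).2)).2.1 (hmem.1 hY).1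

theorem cellVertices_not_disjoint {C w : ℤ × ℤ} (h1 : |w.1| ≤ 1) (h2 : |w.2| ≤ 1) :
    ∃ v, v ∈ cellVertices C ∧ v ∈ cellVertices (C + w) := by
  rw [abs_le] at h1 h2
  refine ⟨(max C.1 (C + w).1, max C.2 (C + w).2), ?_, ?_⟩ <;>
  · rw [mem_cellVertices_iff_le]
    simp only [Prod.fst_add, Prod.snd_add]
    omega

namespace IsPath

variable {t : ℤ → Cell} {lo hi : ℤ}

theorem cellConnected_seg (hp : IsPath t lo hi) : CellConnected (seg t lo hi : Set Cell) := by
  have key : ∀ p, lo ≤ p → ∀ n : ℕ, p + n ≤ hi → Reach (seg t lo hi : Set Cell) (t p) (t (p + n)) := by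
    intro p hlp n
    induction n with
    | zero => intro _; simp only [Nat.cast_zero, add_zero]; exact Relation.ReflTransGen.refl
    | succ n ih =>
      intro hn
      push_cast at hn ⊢
      refine (ih (by omega)).tail ⟨?_, ?_⟩
      · rw [← add_assoc]; exact hp.adj _ (by omega) (by omega)
      · rw [Finset.mem_coe, mem_seg]; exact ⟨_, by omega, by omega, rfl⟩
  have key' : ∀ p q, lo ≤ p → p ≤ q → q ≤ hi → Reach (seg t lo hi : Set Cell) (t p) (t q) := by
    intro p q h1 h2 h3
    have := key p h1 (q - p).toNat (by omega)
    rwa [Int.toNat_of_nonneg (by omega), add_sub_cancel] at this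
  intro C hC D hD
  obtain ⟨p, h1, h2, rfl⟩ := mem_seg.1 hC
  obtain ⟨q, h3, h4, rfl⟩ := mem_seg.1 hD
  rcases le_total p q with h | h
  · exact key' p q h1 h h4
  · exact (key' q p h3 h h2).symm hD

/-- Induction on the length. Only the two preceding cells can touch the last one. The first lies at
`-δ` from it and the second at `-2δ` or, for a suitable choice of `η`, at `-δ + η`, so the six
positions required by `cellConnected_compl_insert` are free. -/
theorem cellConnected_compl (hp : IsPath t lo hi) :
    CellConnected ((seg t lo hi : Set Cell)ᶜ) := by
  obtain ⟨n, hn⟩ : ∃ n : ℕ, hi < lo + n := ⟨(hi - lo + 1).toNat, by omega⟩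
  induction n generalizing hi with
  | zero =>
    rw [seg_empty _ (by simpa using hn), Finset.coe_empty, Set.compl_empty]
    exact cellConnected_univ
  | succ n ih =>
    push_cast at hn
    by_cases h0 : hi < lo
    · rw [seg_empty _ h0, Finset.coe_empty, Set.compl_empty]
      exact cellConnected_univ
    have hins : seg t lo hi = insert (t hi) (seg t lo (hi - 1)) := by
      rw [← hp.seg_erase (by omega), Finset.insert_erase]
      exact mem_seg.2 ⟨hi, by omega, le_rfl, rfl⟩
    have hnot : t hi ∉ seg t lo (hi - 1) := by
      rw [← hp.seg_erase (by omega)]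
      exact Finset.notMem_erase _ _
    have ih' := ih (hp.mono (i := lo) (j := hi - 1) le_rfl (by omega)) (by omega)
    have hring : ∀ w : ℤ × ℤ, |w.1| ≤ 1 → |w.2| ≤ 1 → t hi + w ∈ seg t lo (hi - 1) →
        (lo ≤ hi - 1 ∧ t (hi - 1) = t hi + w) ∨ (lo ≤ hi - 2 ∧ t (hi - 2) = t hi + w) := by
      intro w h1 h2 hw
      obtain ⟨p, h3, h4, h5⟩ := mem_seg.1 hw
      obtain ⟨v, hv1, hv2⟩ := cellVertices_not_disjoint (C := t hi) h1 h2
      rw [← h5] at hv2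
      have := hp.near h3 le_rfl hv2 hv1
      rcases (by omega : p = hi - 1 ∨ p = hi - 2) with rfl | rfl
      · exact Or.inl ⟨h3, h5⟩
      · exact Or.inr ⟨h3, h5⟩
    obtain ⟨δ, η, F, h1, h2⟩ : ∃ δ η, IsFrame δ η ∧ (lo ≤ hi - 1 → t (hi - 1) = t hi - δ) ∧
        (lo ≤ hi - 2 → t (hi - 2) = t hi - 2 • δ ∨ t (hi - 2) = t hi - δ + η) := by
      by_cases h1 : lo ≤ hi - 1
      · have a1 := hp.adj (hi - 1) h1 (by omega)
        rw [sub_add_cancel, adj_iff] at a1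
        obtain ⟨η, F⟩ := a1.exists_frame
        have e1 : t (hi - 1) = t hi - (t hi - t (hi - 1)) := by abel
        by_cases h2 : lo ≤ hi - 2
        · have a2 := hp.adj (hi - 2) h2 (by omega)
          have n2 := hp.ne (hi - 2) h2 (by omega)
          rw [show hi - 2 + 1 = hi - 1 by ring, adj_iff] at a2
          rw [sub_add_cancel] at n2
          generalize t hi - t (hi - 1) = δ at *
          rcases F.step_cases a2 with h3 | h3 | h3 | h3
          · refine ⟨δ, η, F, fun _ => e1, fun _ => Or.inl ?_⟩
            rw [two_smul, ← sub_sub, ← e1, ← h3]; abel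
          · refine absurd ?_ n2
            have e2 : t (hi - 2) = t (hi - 1) - (t (hi - 1) - t (hi - 2)) := by abel
            rw [e2, h3, e1]; abel
          · refine ⟨δ, -η, ?_, fun _ => e1, fun _ => Or.inr ?_⟩
            · exact ⟨F.1, F.2.1.neg, by have := F.2.2; simp; linarith⟩
            · rw [← e1, ← h3]; abel
          · refine ⟨δ, η, F, fun _ => e1, fun _ => Or.inr ?_⟩
            rw [← e1, ← neg_eq_iff_eq_neg.2 h3]; abel
        · exact ⟨_, η, F, fun _ => e1, fun h => absurd h h2⟩
      · exact ⟨(1, 0), (0, 1), by simp [IsFrame, IsStep], fun h => absurd h h1,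
          fun h => absurd (by omega) h1⟩
    rw [hins]
    refine cellConnected_compl_insert F ih' hnot fun w hw hwS => ?_
    have hsmall : |w.1| ≤ 1 ∧ |w.2| ≤ 1 ∧ w ≠ -δ ∧ w ≠ -(2 • δ) ∧ w ≠ -δ + η := by
      simp only [Set.mem_insert_iff, Set.mem_singleton_iff] at hw
      rcases F.cases with ⟨rfl | rfl, rfl | rfl⟩ | ⟨rfl | rfl, rfl | rfl⟩ <;>
      rcases hw with rfl | rfl | rfl | rfl | rfl | rfl <;> simp
    obtain ⟨s1, s2, s3, s4, s5⟩ := hsmall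
    rcases hring w s1 s2 hwS with ⟨h3, h4⟩ | ⟨h3, h4⟩
    · rw [h1 h3, sub_eq_add_neg, add_right_inj] at h4
      exact s3 h4.symm
    · rcases h2 h3 with h5 | h5
      · rw [h5, sub_eq_add_neg, add_right_inj] at h4
        exact s4 h4.symm
      · rw [h5, sub_eq_add_neg, add_assoc, add_right_inj] at h4
        exact s5 h4.symm

theorem isSimplePolyomino (hp : IsPath t lo hi) (h : lo ≤ hi) : IsSimplePolyomino (seg t lo hi) :=
  ⟨⟨⟨t lo, mem_seg.2 ⟨lo, le_rfl, h, rfl⟩⟩, hp.cellConnected_seg⟩, hp.cellConnected_compl⟩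

end IsPath

end Polyomino

namespace Polyomino

/-! ### Cyclic sequences of cells -/

/-- A cyclic sequence of `n` cells that runs through a closed path. -/
structure IsCycle (s : ℤ → Cell) (n : ℤ) : Prop where
  lt : 5 < n
  adj : ∀ k, Adj (s k) (s (k + 1))
  period : ∀ k, s (k + n) = s k
  inj : ∀ i j, i < j → j < i + n → s i ≠ s j
  disj : ∀ i j, i + 2 < j → j < i + n - 2 → Disjoint (cellVertices (s i)) (cellVertices (s j))

namespace IsCycle

variable {s : ℤ → Cell} {n : ℤ} (hs : IsCycle s n)
include hs

theorem isPath {lo hi : ℤ} (h : hi < lo + n - 2) : IsPath s lo hi where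
  adj k _ _ := hs.adj k
  ne k _ _ := hs.inj _ _ (by omega) (by have := hs.lt; omega)
  disj i j h1 h2 h3 := hs.disj i j h2 (by omega)

theorem period_mul (q k : ℤ) : s (k + q * n) = s k := by
  induction q using Int.induction_on with
  | zero => simp
  | succ i ih => rw [add_mul, one_mul, ← add_assoc, hs.period, ih]
  | pred i ih =>
    rw [← hs.period, sub_mul, one_mul, add_assoc, sub_add_cancel, ih]

theorem exists_window (i k : ℤ) : ∃ j, i ≤ j ∧ j < i + n ∧ s j = s k := by
  have hn : 0 < n := by have := hs.lt; omega
  refine ⟨i + (k - i) % n, ?_, ?_, ?_⟩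
  · have := Int.emod_nonneg (k - i) hn.ne'; omega
  · have := Int.emod_lt_of_pos (k - i) hn; omega
  · rw [← hs.period_mul ((k - i) / n)]
    congr 1
    have := Int.emod_add_mul_ediv (k - i) n
    rw [mul_comm] at this
    omega

theorem near {i j : ℤ} {v : ℤ × ℤ} (hv : v ∈ cellVertices (s i))
    (hv' : v ∈ cellVertices (s j)) : j ≤ i + 2 ∨ i + n - 2 ≤ j := by
  by_contra h
  exact Finset.disjoint_left.1 (hs.disj i j (by omega) (by omega)) hv hv'

theorem exists_near {i j : ℤ} {v : ℤ × ℤ} (hv : v ∈ cellVertices (s i))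
    (hv' : v ∈ cellVertices (s j)) : ∃ e, -2 ≤ e ∧ e ≤ 2 ∧ s j = s (i + e) := by
  obtain ⟨k, h1, h2, h3⟩ := hs.exists_window (i - 2) j
  rw [← h3] at hv'
  by_cases h : k ≤ i + 2
  · exact ⟨k - i, by omega, by omega, by rw [← h3]; congr 1; omega⟩
  · exact absurd hv' (Finset.disjoint_left.1 (hs.disj i k (by omega) (by omega)) hv)

/-- Adjacent cells share vertices, so their cyclic distance is at most two. Distance two is excluded
by the chessboard colouring. -/
theorem eq_of_adj {i : ℤ} {C : Cell} (hC : ∃ k, s k = C) (h : Adj (s i) C) :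
    C = s (i + 1) ∨ C = s (i - 1) := by
  obtain ⟨j, rfl⟩ := hC
  obtain ⟨v, hv1, hv2⟩ : ∃ v, v ∈ cellVertices (s i) ∧ v ∈ cellVertices (s j) := by
    have := cellVertices_not_disjoint (C := s i) (w := s j - s i) ?_ ?_
    · rwa [add_sub_cancel] at this
    all_goals rcases adj_iff.1 h with h | h | h | h <;> rw [h] <;> simp
  obtain ⟨e, h1, h2, h3⟩ := hs.exists_near hv1 hv2
  rw [h3] at h ⊢
  have a1 := adj_cases h
  rcases (by omega : e = -2 ∨ e = -1 ∨ e = 0 ∨ e = 1 ∨ e = 2) with rfl | rfl | rfl | rfl | rfl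
  · have a2 := adj_cases (hs.adj (i - 2))
    have a3 := adj_cases (hs.adj (i - 1))
    rw [show i - 2 + 1 = i - 1 by ring] at a2
    rw [sub_add_cancel] at a3
    rw [← sub_eq_add_neg] at a1
    simp only [Prod.ext_iff] at a1 a2 a3
    omega
  · exact Or.inr rfl
  · rw [add_zero] at h; exact absurd rfl h.ne
  · exact Or.inl rfl
  · have a2 := adj_cases (hs.adj i)
    have a3 := adj_cases (hs.adj (i + 1))
    rw [add_assoc, one_add_one_eq_two] at a3
    simp only [Prod.ext_iff] at a1 a2 a3
    omega

end IsCycle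

/-- The part of a closed path near the first two blocks of a ladder: the block `s 0, …, s (l - 1)`
runs to the right and is left downwards, the block `s (-1), …, s (-m)` runs to the left, one row
above, and is left downwards and then to the left. -/
structure IsBend (s : ℤ → Cell) (n l m x y : ℤ) : Prop extends IsCycle s n where
  hl : 3 ≤ l
  hm : 3 ≤ m
  right : ∀ k, 0 ≤ k → k < l → s k = (x + k, y)
  left : ∀ k, 0 ≤ k → k < m → s (-1 - k) = (x - k, y + 1)
  right_end : s l = (x + l - 1, y - 1)
  left_end : s (-1 - m) = (x - m + 1, y)
  left_end' : s (-2 - m) = (x - m, y)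

namespace IsBend

variable {s : ℤ → Cell} {n l m x y : ℤ} (H : IsBend s n l m x y)
include H

/-- Within one period the block to the right cannot overlap the upper block or the two cells after
its left end, as their coordinates disagree. -/
theorem le : l ≤ n - m - 2 := by
  have hl := H.hl
  have hm := H.hm
  have hn := H.lt
  have h1 : m ≤ n := by
    by_contra h
    have e1 := H.left n (by omega) (by omega)
    have e2 := H.left 0 le_rfl (by omega)
    rw [← H.period, sub_add_cancel] at e1
    rw [sub_zero, e1, Prod.mk.injEq] at e2
    omega
  have h2 : m ≠ n := by
    rintro rfl
    have e1 := H.left (m - 1) (by omega) (by omega)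
    have e2 := H.right 0 le_rfl (by omega)
    rw [← H.period, show -1 - (m - 1) + m = 0 by ring, e2, Prod.mk.injEq] at e1
    omega
  have e1 := H.left_end
  rw [← H.period] at e1
  have e2 := H.left_end'
  rw [← H.period] at e2
  by_contra h
  by_cases h3 : -1 - m + n < l
  · rw [H.right _ (by omega) h3, Prod.mk.injEq] at e1
    omega
  · rw [H.right _ (by omega) (by omega), Prod.mk.injEq] at e2
    omega

theorem last : s (n - m - 1) = (x - m + 1, y) := by
  rw [← H.left_end, ← H.period (-1 - m)]
  congr 1; ring

theorem last' : s (n - m - 2) = (x - m, y) := by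
  rw [← H.left_end', ← H.period (-2 - m)]
  congr 1; ring

theorem top {q : ℤ} (h1 : 0 ≤ q) (h2 : q < m) : s (n - m + q) = (x - m + 1 + q, y + 1) := by
  have := H.left (m - 1 - q) (by omega) (by omega)
  rw [← H.period, show -1 - (m - 1 - q) + n = n - m + q by ring] at this
  rw [this, Prod.mk.injEq]
  omega

/-- Along the cycle only the first two and the last two cells of the remaining path are close enough
to the upper block to touch it. -/
theorem near_top {k u v : ℤ} (hk : 0 ≤ k) (hk' : k ≤ n - m - 1) (hu : x - m + 1 ≤ u)
    (hu' : u ≤ x + 1) (hv : y + 1 ≤ v) (hv' : v ≤ y + 2) (h : (u, v) ∈ cellVertices (s k)) :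
    s k = (x, y) ∨ s k = (x + 1, y) ∨ s k = (x - m, y) ∨ s k = (x - m + 1, y) := by
  have hl := H.hl
  have hm := H.hm
  obtain ⟨i, hi, hi', h2⟩ : ∃ i, -m ≤ i ∧ i ≤ -1 ∧ (u, v) ∈ cellVertices (s i) := by
    by_cases hux : u ≤ x
    · refine ⟨-1 - (x - u), by omega, by omega, ?_⟩
      rw [H.left _ (by omega) (by omega), mem_cellVertices_iff_le]
      dsimp only; omega
    · refine ⟨-1 - 0, by omega, by omega, ?_⟩
      rw [H.left _ le_rfl (by omega), mem_cellVertices_iff_le]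
      dsimp only; omega
  have h3 := H.near h2 h
  rcases (by omega : k = 0 ∨ k = 1 ∨ k = n - m - 2 ∨ k = n - m - 1) with rfl | rfl | rfl | rfl
  · left; rw [H.right 0 le_rfl (by omega), add_zero]
  · right; left; rw [H.right 1 (by omega) (by omega)]
  · exact Or.inr (Or.inr (Or.inl H.last'))
  · exact Or.inr (Or.inr (Or.inr H.last))

theorem isHat : IsHat (seg s 0 (n - m - 1)) (x - m + 1) x (x + l - 1) y where
  cb := by have := H.hm; omega
  bd := by have := H.hl; omega
  left := mem_seg.2 ⟨n - m - 1, by have := H.le; have := H.hl; omega, le_rfl, H.last⟩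
  right u h1 h2 := mem_seg.2 ⟨u - x, by omega, by have := H.le; omega, by
    rw [H.right _ (by omega) (by omega), add_sub_cancel]⟩
  top := by
    intro D hD u h1 h2 h
    obtain ⟨k, h3, h4, rfl⟩ := mem_seg.1 hD
    have h5 := H.near_top h3 h4 h1 h2 (by omega) le_rfl h
    rw [mem_cellVertices_iff_le] at h
    rcases h5 with h5 | h5 | h5 | h5 <;> · rw [h5] at h; dsimp only at h; omega
  free := by
    intro D hD u h1 h2 h
    obtain ⟨k, h3, h4, rfl⟩ := mem_seg.1 hD
    have h5 := H.near_top h3 h4 (by omega) (by omega) le_rfl (by omega) h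
    rw [mem_cellVertices_iff_le] at h
    rcases h5 with h5 | h5 | h5 | h5 <;> · rw [h5] at h; dsimp only at h; omega
  colL := by
    intro D hD hne
    obtain ⟨k, h3, h4, rfl⟩ := mem_seg.1 hD
    have hle := H.le
    have hl := H.hl
    have hm := H.hm
    have key : ∀ v, y ≤ v → v ≤ y + 1 → (x - m + 1 + 1, v) ∉ cellVertices (s k) := by
      intro v h5 h6 h
      have h' : (x - m + 1 + 1, v) ∈ cellVertices (s (n - m - 1)) := by
        rw [H.last, mem_cellVertices_iff_le]; dsimp only; omega
      have h7 := H.near h h'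
      rw [mem_cellVertices_iff_le] at h
      rcases (by omega : k = n - m - 1 ∨ k = n - m - 2 ∨ k = n - m - 3) with rfl | rfl | rfl
      · exact hne H.last
      · rw [H.last'] at h; dsimp only at h; omega
      -- A neighbour of `(x - m, y)` reaching the column `x - m + 2` would have to be `(x - m + 1,
      -- y)`, which is already `s (n - m - 1)`.
      · have a1 := adj_cases (H.adj (n - m - 3)).symm
        have a2 := H.inj (n - m - 3) (n - m - 1) (by omega) (by omega)
        rw [show n - m - 3 + 1 = n - m - 2 by ring, H.last'] at a1
        rw [H.last] at a2
        generalize s (n - m - 3) = D at *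
        obtain ⟨p, q⟩ := D
        simp only [Prod.mk.injEq, ne_eq, not_and] at a1 a2 h
        omega
    exact ⟨key _ (by omega) le_rfl, key _ le_rfl (by omega)⟩
  colR := by
    intro D hD hne
    obtain ⟨k, h3, h4, rfl⟩ := mem_seg.1 hD
    have hl := H.hl
    have hm := H.hm
    have key : ∀ v, y ≤ v → v ≤ y + 1 → (x, v) ∉ cellVertices (s k) := by
      intro v h5 h6 h
      have e0 := H.right 0 le_rfl (by omega)
      have h' : (x, v) ∈ cellVertices (s 0) := by
        rw [e0, mem_cellVertices_iff_le]; dsimp only; omega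
      have h7 := H.near h' h
      rw [H.right k h3 (by omega), mem_cellVertices_iff_le] at h
      dsimp only at h
      obtain rfl : k = 0 := by omega
      rw [e0, add_zero] at hne
      exact hne rfl
    exact ⟨key _ (by omega) le_rfl, key _ le_rfl (by omega)⟩
  colR' := by
    intro D hD hne hne'
    obtain ⟨k, h3, h4, rfl⟩ := mem_seg.1 hD
    have hl := H.hl
    have hm := H.hm
    have key : ∀ v, y ≤ v → v ≤ y + 1 → (x + 1, v) ∉ cellVertices (s k) := by
      intro v h5 h6 h
      have e0 := H.right 0 le_rfl (by omega)
      have h' : (x + 1, v) ∈ cellVertices (s 0) := by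
        rw [e0, mem_cellVertices_iff_le]; dsimp only; omega
      have h7 := H.near h' h
      have e1 := H.right k h3 (by omega)
      rw [e1, mem_cellVertices_iff_le] at h
      dsimp only at h
      rcases (by omega : k = 0 ∨ k = 1) with rfl | rfl
      · rw [e0, add_zero] at hne; exact hne rfl
      · exact hne' e1
    exact ⟨key _ (by omega) le_rfl, key _ le_rfl (by omega)⟩
  line := by
    intro D hD hnot u h1 h2 h
    obtain ⟨k, h3, h4, rfl⟩ := mem_seg.1 hD
    have hl := H.hl
    have hm := H.hm
    have hle := H.le
    have hkl : l ≤ k := by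
      by_contra hk
      rw [H.right k h3 (by omega)] at hnot
      dsimp only at hnot
      omega
    obtain ⟨i, hi, hi', h'⟩ : ∃ i, 0 ≤ i ∧ i < l ∧ (u, y + 1) ∈ cellVertices (s i) := by
      by_cases hux : u ≤ x + l - 1
      · refine ⟨u - x, by omega, by omega, ?_⟩
        rw [H.right _ (by omega) (by omega), mem_cellVertices_iff_le]
        dsimp only; omega
      · refine ⟨l - 1, by omega, by omega, ?_⟩
        rw [H.right _ (by omega) (by omega), mem_cellVertices_iff_le]
        dsimp only; omega
    have h7 := H.near h' h
    rw [mem_cellVertices_iff_le] at h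
    rcases (by omega : k = l ∨ k = l + 1) with rfl | rfl
    · rw [H.right_end] at h; dsimp only at h; omega
    · have a1 := adj_cases (H.adj l)
      have a2 := H.inj (l - 1) (l + 1) (by omega) (by omega)
      rw [H.right_end] at a1
      rw [H.right (l - 1) (by omega) (by omega)] at a2
      generalize s (l + 1) = D at *
      obtain ⟨p, q⟩ := D
      simp only [Prod.mk.injEq, ne_eq, not_and] at a1 a2 h
      omega

/-- The cells of the upper block are appended from the left. The first one ends a vertical run of
two cells, whose removal leaves the path up to `n - m - 2`. Each of the next `m - 3` ends a
horizontal run starting at `n - m`. The index `n - 3` stops just before the two cells next to the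
lower block. -/
theorem rookSeries_last_row {i : ℤ} (h1 : 2 ≤ i) (h2 : i ≤ n - m - 2) :
    rookSeries (seg s i (n - 3)) = rookSeries (seg s i (n - m - 1)) +
      PowerSeries.X * rookSeries (seg s i (n - m - 2)) +
      ((m - 3 : ℤ) : ℤ⟦X⟧) * PowerSeries.X * rookSeries (seg s i (n - m - 1)) := by
  have hm := H.hm
  have key : ∀ q : ℕ, (q : ℤ) ≤ m - 3 → rookSeries (seg s i (n - m + q)) =
      rookSeries (seg s i (n - m - 1)) + PowerSeries.X * rookSeries (seg s i (n - m - 2)) +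
      (q : ℤ⟦X⟧) * PowerSeries.X * rookSeries (seg s i (n - m - 1)) := by
    intro q
    induction q with
    | zero =>
      intro _
      have e1 := H.top (q := 0) le_rfl (by omega)
      have := (H.isPath (lo := i) (hi := n - m) (by omega)).rookSeries_last (k := n - m - 1)
        (δ := (0, 1)) (by omega) (by omega) ?_ ?_
      · rw [Nat.cast_zero, Nat.cast_zero, zero_mul, zero_mul, add_zero, add_zero, this]
        ring_nf
      · intro p h3 h4
        obtain rfl : p = n - m - 1 := by omega
        rw [add_zero] at e1
        rw [sub_add_cancel, e1, H.last]
        simp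
      · intro _ h
        rw [show n - m - 1 - 1 = n - m - 2 by ring, H.last, H.last'] at h
        simp at h
    | succ q ih =>
      intro hq
      push_cast at hq ⊢
      have := (H.isPath (lo := i) (hi := n - m + (q + 1)) (by omega)).rookSeries_last
        (k := n - m) (δ := (1, 0)) (by omega) (by omega) ?_ ?_
      · rw [this, show n - m + ((q : ℤ) + 1) - 1 = n - m + q by ring, ih (by omega)]
        ring
      · intro p h3 h4
        have e1 := H.top (q := p - (n - m)) (by omega) (by omega)
        have e2 := H.top (q := p + 1 - (n - m)) (by omega) (by omega)
        rw [add_sub_cancel] at e1 e2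
        rw [e1, e2]
        ext
        · simp only [Prod.fst_add]; ring
        · simp
      · intro _ h
        have e1 := H.top (q := 0) le_rfl (by omega)
        rw [add_zero] at e1
        rw [e1, H.last] at h
        simp at h
  have := key (m - 3).toNat (by omega)
  rw [Int.toNat_of_nonneg (by omega), show n - m + (m - 3) = n - 3 by ring] at this
  rw [this, ← Int.cast_natCast, Int.toNat_of_nonneg (by omega)]

/-- Both `s 0` and `s 1` start a straight run ending at `s (l - 1)`; for `s 1` to have a successor
in it, the block needs three cells. -/
theorem rookSeries_first_row {j : ℤ} (h1 : l ≤ j) (h2 : j ≤ n - m - 1) :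
    rookSeries (seg s 0 j) = rookSeries (seg s 1 j) + PowerSeries.X * rookSeries (seg s l j) ∧
    rookSeries (seg s 1 j) = rookSeries (seg s 2 j) + PowerSeries.X * rookSeries (seg s l j) := by
  have hl := H.hl
  have hm := H.hm
  have key : ∀ i, 0 ≤ i → i < l - 1 → rookSeries (seg s i j) = rookSeries (seg s (i + 1) j) +
      PowerSeries.X * rookSeries (seg s l j) := by
    intro i h3 h4
    have := (H.isPath (lo := i) (hi := j) (by omega)).rookSeries_first (k := l - 1)
      (δ := (1, 0)) (by omega) (by omega) ?_ ?_
    · rwa [sub_add_cancel] at this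
    · intro p h5 h6
      rw [H.right p (by omega) (by omega), H.right (p + 1) (by omega) (by omega)]
      simp [add_assoc]
    · intro _ h
      rw [sub_add_cancel, H.right_end, H.right (l - 1) (by omega) (by omega)] at h
      simp at h
  exact ⟨key 0 le_rfl (by omega), key 1 (by omega) (by omega)⟩

theorem union_left : seg s 0 (n - m - 1) ∪ rowSegment (x - m + 1) (x - m + 1) (y + 1) =
    seg s 0 (n - m) := by
  have e1 := H.top (q := 0) le_rfl (by have := H.hm; omega)
  rw [add_zero] at e1
  have hle := H.le
  have hl := H.hl
  rw [← (H.isPath (lo := 0) (hi := n - m) (by have := H.hm; omega)).seg_erase (by omega), e1,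
    add_zero, show rowSegment (x - m + 1) (x - m + 1) (y + 1) = {(x - m + 1, y + 1)} by
      rw [rowSegment, Finset.Icc_self], Finset.union_comm, ← Finset.insert_eq,
    Finset.insert_erase]
  exact mem_seg.2 ⟨n - m, by omega, le_rfl, by rw [e1, add_zero]⟩

theorem union_right : seg s 0 (n - m - 1) ∪ rowSegment x x (y + 1) = seg s (-1) (n - m - 1) := by
  have e1 := H.left 0 le_rfl (by have := H.hm; omega)
  rw [sub_zero, sub_zero] at e1
  have hle := H.le
  have hl := H.hl
  ext C
  rw [Finset.mem_union, mem_seg, mem_seg, rowSegment, Finset.Icc_self, Finset.mem_singleton]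
  constructor
  · rintro (⟨k, h1, h2, rfl⟩ | rfl)
    · exact ⟨k, by omega, h2, rfl⟩
    · exact ⟨-1, le_rfl, by omega, e1⟩
  · rintro ⟨k, h1, h2, rfl⟩
    by_cases hk : k = -1
    · subst hk; exact Or.inr e1
    · exact Or.inl ⟨k, by omega, h2, rfl⟩

theorem union_all {P : Finset Cell} (hP : ∀ C, C ∈ P ↔ ∃ k, s k = C) :
    seg s 0 (n - m - 1) ∪ rowSegment (x - m + 1) x (y + 1) = P := by
  have hle := H.le
  have hl := H.hl
  have hm := H.hm
  ext C
  rw [Finset.mem_union, mem_seg, mem_rowSegment, hP]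
  constructor
  · rintro (⟨k, -, -, rfl⟩ | ⟨h1, h2, h3⟩)
    · exact ⟨k, rfl⟩
    · refine ⟨-1 - (x - C.1), ?_⟩
      rw [H.left _ (by omega) (by omega), ← h3, sub_sub_cancel]
  · rintro ⟨k, rfl⟩
    obtain ⟨j, h1, h2, h3⟩ := H.exists_window (-m) k
    rw [← h3]
    by_cases hj : 0 ≤ j
    · exact Or.inl ⟨j, hj, by omega, rfl⟩
    · right
      have := H.left (-1 - j) (by omega) (by omega)
      rw [show -1 - (-1 - j) = j by ring] at this
      rw [this]
      dsimp only
      omega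

/-- Put $a_i=r(s_i,\dots,s_{n-m-1})$ and $b_i=r(s_i,\dots,s_{n-m-2})$. The hat formula and the path
recursion at its end cells give $r(P)=a_0+t\,b_0+(m-3)\,t\,a_0+t\,a_0+t\,a_1$. The last two terms
belong to $\mathcal K_1$ and $\mathcal K_3$. Removing the first two cells gives $a_0=a_2+2t\,a_l$
and $b_0=b_2+2t\,b_l$, and the first three terms regroup by `rookSeries_last_row` into the term of
$\mathcal K_4$ and twice the term of $\mathcal K_2$. -/
theorem rookSeries_eq {P : Finset Cell} (hP : ∀ C, C ∈ P ↔ ∃ k, s k = C) :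
    rookSeries P = rookSeries (seg s 2 (n - 3)) + PowerSeries.X *
      (rookSeries (seg s 0 (n - m - 1)) + 2 * rookSeries (seg s l (n - 3)) +
        rookSeries (seg s 1 (n - m - 1))) := by
  have hle := H.le
  have hl := H.hl
  have hm := H.hm
  have hgood := (H.isPath (lo := 0) (hi := n - m - 1) (by omega)).isGood.1
  have e0 := H.isHat.rookSeries_eq hgood
  rw [H.union_left, H.union_right, H.union_all hP] at e0
  have e1 := (H.isPath (lo := 0) (hi := n - m) (by omega)).rookSeries_last (k := n - m - 1)
    (δ := (0, 1)) (by omega) (by omega) (by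
      intro p h3 h4
      obtain rfl : p = n - m - 1 := by omega
      have e1 := H.top (q := 0) le_rfl (by omega)
      rw [add_zero] at e1
      rw [sub_add_cancel, e1, H.last]
      simp) (by
      intro _ h
      rw [show n - m - 1 - 1 = n - m - 2 by ring, H.last, H.last'] at h
      simp at h)
  rw [show n - m - 1 - 1 = n - m - 2 by ring] at e1
  have e2 := (H.isPath (lo := -1) (hi := n - m - 1) (by omega)).rookSeries_first (k := 0)
    (δ := (0, -1)) (by omega) (by omega) (by
      intro p h3 h4
      obtain rfl : p = -1 := by omega
      have e1 := H.left 0 le_rfl (by omega)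
      rw [sub_zero, sub_zero] at e1
      rw [neg_add_cancel, e1, H.right 0 le_rfl (by omega)]
      simp) (by
      intro _ h
      rw [zero_add, H.right 0 le_rfl (by omega), H.right 1 (by omega) (by omega)] at h
      simp at h)
  rw [neg_add_cancel, zero_add] at e2
  obtain ⟨f1, f2⟩ := H.rookSeries_first_row (j := n - m - 1) (by omega) le_rfl
  obtain ⟨f3, f4⟩ := H.rookSeries_first_row (j := n - m - 2) (by omega) (by omega)
  have g1 := H.rookSeries_last_row (i := 2) le_rfl (by omega)
  have g2 := H.rookSeries_last_row (i := l) (by omega) hle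
  rw [e0, e1, e2, g1, g2, f1, f2, f3, f4]
  push_cast
  ring

end IsBend

end Polyomino

namespace Polyomino

/-! ### Ladders of horizontal blocks -/

/-- `S` is a maximal horizontal block of `P`. -/
def IsRowMax (P S : Finset Cell) : Prop :=
  ∃ x₀ x₁ y : ℤ, x₀ < x₁ ∧ S = rowSegment x₀ x₁ y ∧ S ⊆ P ∧ (x₀ - 1, y) ∉ P ∧ (x₁ + 1, y) ∉ P

/-- A ladder of three maximal horizontal blocks. -/
structure IsRowLadder (P X Y Z : Finset Cell) : Prop where
  fst : IsRowMax P X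
  snd : IsRowMax P Y
  trd : IsRowMax P Z
  card : (vertices X ∩ vertices Y).card = 2
  card' : (vertices Y ∩ vertices Z).card = 2
  rows : ¬ ∀ v ∈ vertices X ∩ vertices Y, ∀ w ∈ vertices Y ∩ vertices Z, v.2 = w.2

/-- The first blocks of a ladder of horizontal blocks that cannot be continued backwards. -/
structure IsRowStart (P X Y Z : Finset Cell) : Prop extends IsRowLadder P X Y Z where
  -- The two common vertices of `X` and `Y` are required to lie in one row; otherwise a vertical
  -- edge interval might contain both intersections and `Q, X, Y` need not be a ladder.
  first : ∀ Q, IsRowMax P Q → Q ≠ Y → Q ≠ Z →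
    (∃ v ∈ vertices X ∩ vertices Y, ∃ w ∈ vertices X ∩ vertices Y, v ≠ w ∧ v.2 = w.2) →
    ¬ IsRowLadder P Q X Y
  noL : ¬ HasLConfiguration P

theorem mem_vertices_rowSegment {x₀ x₁ y : ℤ} (h : x₀ ≤ x₁) {v : ℤ × ℤ} :
    v ∈ vertices (rowSegment x₀ x₁ y) ↔ x₀ ≤ v.1 ∧ v.1 ≤ x₁ + 1 ∧ y ≤ v.2 ∧ v.2 ≤ y + 1 := by
  obtain ⟨p, q⟩ := v
  rw [mem_vertices_iff]
  constructor
  · rintro ⟨D, hD, hv⟩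
    rw [mem_rowSegment] at hD
    rw [mem_cellVertices_iff_le] at hv
    dsimp only at hv ⊢
    omega
  · rintro ⟨h1, h2, h3, h4⟩
    dsimp only at h1 h2 h3 h4
    by_cases hp : p ≤ x₁
    · refine ⟨(p, y), mem_rowSegment.2 ⟨h1, hp, rfl⟩, ?_⟩
      rw [mem_cellVertices_iff_le]; dsimp only; omega
    · refine ⟨(x₁, y), mem_rowSegment.2 ⟨h, le_rfl, rfl⟩, ?_⟩
      rw [mem_cellVertices_iff_le]; dsimp only; omega

theorem card_cellVertices (C : Cell) : (cellVertices C).card = 4 := by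
  obtain ⟨p, q⟩ := C
  rw [cellVertices, Finset.card_insert_of_notMem, Finset.card_insert_of_notMem,
    Finset.card_insert_of_notMem, Finset.card_singleton] <;> simp

theorem four_le_card_inter {X Y : Finset Cell} {D : Cell} (hX : D ∈ X) (hY : D ∈ Y) :
    4 ≤ (vertices X ∩ vertices Y).card := by
  rw [← card_cellVertices D]
  refine Finset.card_le_card fun v hv => Finset.mem_inter.2 ⟨?_, ?_⟩
  exacts [mem_vertices_iff.2 ⟨D, hX, hv⟩, mem_vertices_iff.2 ⟨D, hY, hv⟩]

theorem exists_extension (P : Finset Cell) {a r d : ℤ} (hd : d ≠ 0) (ha : (a, r) ∈ P) :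
    ∃ n : ℕ, (∀ k : ℕ, k ≤ n → (a + d * k, r) ∈ P) ∧ (a + d * (n + 1), r) ∉ P := by
  by_contra! h
  have key : ∀ n : ℕ, ∀ k : ℕ, k ≤ n → (a + d * k, r) ∈ P := by
    intro n
    induction n with
    | zero =>
      intro k hk
      obtain rfl : k = 0 := by omega
      simpa using ha
    | succ n ih =>
      intro k hk
      rcases Nat.lt_or_ge n k with h1 | h1
      · obtain rfl : k = n + 1 := by omega
        have := h n ih
        push_cast
        exact this
      · exact ih k h1
  refine Set.infinite_of_injective_forall_mem (f := fun n : ℕ => ((a + d * n, r) : Cell)) ?_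
    (s := (P : Set Cell)) (fun n => key n n le_rfl) P.finite_toSet
  intro n k hnk
  simp only [Prod.mk.injEq, add_right_inj, and_true] at hnk
  exact_mod_cast mul_left_cancel₀ hd hnk

theorem exists_isRowMax {P : Finset Cell} {a r : ℤ} (h1 : (a, r) ∈ P) (h2 : (a + 1, r) ∈ P) :
    ∃ x₀ x₁, x₀ ≤ a ∧ a + 1 ≤ x₁ ∧ IsRowMax P (rowSegment x₀ x₁ r) := by
  obtain ⟨n, hn, hn'⟩ := exists_extension P (d := -1) (by omega) h1
  obtain ⟨m, hm, hm'⟩ := exists_extension P (d := 1) (by omega) h2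
  refine ⟨a - n, a + 1 + m, by omega, by omega, a - n, a + 1 + m, r, by omega, rfl, ?_, ?_, ?_⟩
  · rintro ⟨p, q⟩ hD
    rw [mem_rowSegment] at hD
    dsimp only at hD
    obtain ⟨h3, h4, rfl⟩ := hD
    by_cases hp : p ≤ a
    · have := hn (a - p).toNat (by omega)
      rwa [Int.toNat_of_nonneg (by omega), show a + -1 * (a - p) = p by ring] at this
    · have := hm (p - a - 1).toNat (by omega)
      rwa [Int.toNat_of_nonneg (by omega), show a + 1 + 1 * (p - a - 1) = p by ring] at this
  · rwa [show a - (n : ℤ) - 1 = a + -1 * (n + 1) by ring]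
  · rwa [show a + 1 + (m : ℤ) + 1 = a + 1 + 1 * (m + 1) by ring]

namespace IsCycle

variable {s : ℤ → Cell} {n : ℤ} (hs : IsCycle s n)
include hs

theorem frame {δ η : ℤ × ℤ} (F : IsFrame δ η) : IsCycle (frameCell δ η ∘ s) n where
  lt := hs.lt
  adj k := F.adj_cell.2 (hs.adj k)
  period k := congrArg (frameCell δ η) (hs.period k)
  inj i j h1 h2 h := hs.inj i j h1 h2 (F.cell_injective h)
  disj i j h1 h2 := by
    simp only [Function.comp_apply]
    rw [F.cellVertices_cell, F.cellVertices_cell, Finset.disjoint_image F.vert_injective]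
    exact hs.disj i j h1 h2

theorem shift (i : ℤ) : IsCycle (fun k => s (i + k)) n where
  lt := hs.lt
  adj k := by rw [← add_assoc]; exact hs.adj _
  period k := by rw [← add_assoc]; exact hs.period _
  inj a b h1 h2 := hs.inj _ _ (by omega) (by omega)
  disj a b h1 h2 := hs.disj _ _ (by omega) (by omega)

theorem reverse (i : ℤ) : IsCycle (fun k => s (i - k)) n where
  lt := hs.lt
  adj k := by
    have := (hs.adj (i - (k + 1))).symm
    rwa [show i - (k + 1) + 1 = i - k by ring] at this
  period k := by
    rw [← hs.period (i - (k + n))]; congr 1; ring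
  inj a b h1 h2 := (hs.inj _ _ (by omega) (by omega)).symm
  disj a b h1 h2 := (hs.disj _ _ (by omega) (by omega)).symm

theorem ne_of_lt {i j : ℤ} (h1 : i < j) (h2 : j ≤ i + 5) : s i ≠ s j :=
  hs.inj i j h1 (by have := hs.lt; omega)

theorem eq_seg {P : Finset Cell} (hP : ∀ C, C ∈ P ↔ ∃ k, s k = C) (i : ℤ) :
    P = seg s i (i + n - 1) := by
  ext C
  rw [hP, mem_seg]
  constructor
  · rintro ⟨k, rfl⟩
    obtain ⟨j, h1, h2, h3⟩ := hs.exists_window i k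
    exact ⟨j, h1, by omega, h3⟩
  · rintro ⟨k, -, -, h⟩
    exact ⟨k, h⟩

theorem sdiff_seg {P : Finset Cell} (hP : ∀ C, C ∈ P ↔ ∃ k, s k = C) {i j : ℤ} (hij : i ≤ j + 1) :
    P \ seg s i j = seg s (j + 1) (i + n - 1) := by
  rw [hs.eq_seg hP i]
  ext C
  rw [Finset.mem_sdiff, mem_seg, mem_seg, mem_seg]
  constructor
  · rintro ⟨⟨k, h1, h2, rfl⟩, h3⟩
    refine ⟨k, ?_, h2, rfl⟩
    by_contra h
    exact h3 ⟨k, h1, by omega, rfl⟩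
  · rintro ⟨k, h1, h2, rfl⟩
    refine ⟨⟨k, by omega, h2, rfl⟩, ?_⟩
    rintro ⟨p, h3, h4, h5⟩
    exact hs.inj p k (by omega) (by omega) h5

/-- A cyclic sequence follows a row as long as the cells of the row belong to it. -/
theorem follow_row {x y l ε : ℤ} (hε : ε = 1 ∨ ε = -1) (h0 : s 0 = (x, y))
    (h1 : s 1 = (x + ε, y)) (h : ∀ k, 0 ≤ k → k < l → ∃ i, s i = (x + ε * k, y)) {k : ℤ}
    (hk : 0 ≤ k) (hkl : k < l) : s k = (x + ε * k, y) := by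
  suffices key : ∀ k : ℕ, (k : ℤ) + 1 < l → s k = (x + ε * k, y) ∧
      s (k + 1) = (x + ε * (k + 1), y) by
    rcases eq_or_ne k 0 with rfl | hk0
    · rw [h0]; simp
    · have := (key (k - 1).toNat (by omega)).2
      rwa [Int.toNat_of_nonneg (by omega), sub_add_cancel] at this
  intro k
  induction k with
  | zero => intro _; simp [h0, h1]
  | succ k ih =>
    intro hk
    push_cast at hk ⊢
    obtain ⟨i1, i2⟩ := ih (by omega)
    refine ⟨i2, ?_⟩
    have hadj : Adj (s (k + 1)) (x + ε * (k + 1 + 1), y) := by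
      rw [i2, adj_iff]
      rcases hε with rfl | rfl <;> simp [IsStep]
    rcases hs.eq_of_adj (h (k + 1 + 1) (by omega) (by omega)) hadj with h2 | h2
    · exact h2.symm
    · rw [add_sub_cancel_right, i1, Prod.mk.injEq] at h2
      rcases hε with rfl | rfl <;> omega

end IsCycle

/-- The data that give the recursion for the numerator of the series of a closed path. -/
def HasBend (P B₁ B₂ : Finset Cell) (A A' B B' : Cell) : Prop :=
  ∃ (s : ℤ → Cell) (n l m : ℤ), IsCycle s n ∧ 3 ≤ l ∧ 3 ≤ m ∧ l ≤ n - m - 2 ∧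
    (∀ C, C ∈ P ↔ ∃ k, s k = C) ∧ B₁ = seg s (-m) (-1) ∧ B₂ = seg s 0 (l - 1) ∧
    s 0 = A ∧ s 1 = A' ∧ s (-1) = B ∧ s (-2) = B' ∧
    rookSeries P = rookSeries (seg s 2 (n - 3)) + PowerSeries.X *
      (rookSeries (seg s 0 (n - m - 1)) + 2 * rookSeries (seg s l (n - 3)) +
        rookSeries (seg s 1 (n - m - 1)))

theorem IsBend.hasBend {s : ℤ → Cell} {n l m x y : ℤ} (H : IsBend s n l m x y) {P : Finset Cell}
    (hP : ∀ C, C ∈ P ↔ ∃ k, s k = C) : HasBend P (rowSegment (x - m + 1) x (y + 1))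
      (rowSegment x (x + l - 1) y) (s 0) (s 1) (s (-1)) (s (-2)) := by
  refine ⟨s, n, l, m, H.toIsCycle, H.hl, H.hm, H.le, hP, ?_, ?_, rfl, rfl, rfl, rfl,
    H.rookSeries_eq hP⟩
  · ext ⟨p, q⟩
    rw [mem_rowSegment, mem_seg]
    constructor
    · rintro ⟨h1, h2, h3⟩
      dsimp only at h1 h2 h3
      refine ⟨-1 - (x - p), by omega, by omega, ?_⟩
      rw [H.left _ (by omega) (by omega), h3, sub_sub_cancel]
    · rintro ⟨k, h1, h2, h3⟩
      have := H.left (-1 - k) (by omega) (by omega)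
      rw [show -1 - (-1 - k) = k by ring, h3, Prod.mk.injEq] at this
      dsimp only
      omega
  · ext ⟨p, q⟩
    rw [mem_rowSegment, mem_seg]
    constructor
    · rintro ⟨h1, h2, h3⟩
      dsimp only at h1 h2 h3
      refine ⟨p - x, by omega, by omega, ?_⟩
      rw [H.right _ (by omega) (by omega), h3, add_sub_cancel]
    · rintro ⟨k, h1, h2, h3⟩
      have := H.right k (by omega) (by omega)
      rw [h3, Prod.mk.injEq] at this
      dsimp only
      omega

theorem IsFrame.hasBend {δ η : ℤ × ℤ} (F : IsFrame δ η) {P B₁ B₂ : Finset Cell}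
    {A A' B B' : Cell} (h : HasBend (P.image (frameCell δ η)) (B₁.image (frameCell δ η))
      (B₂.image (frameCell δ η)) (frameCell δ η A) (frameCell δ η A') (frameCell δ η B)
      (frameCell δ η B')) : HasBend P B₁ B₂ A A' B B' := by
  obtain ⟨s, n, l, m, hs, hl, hm, hle, hP, h1, h2, h3, h4, h5, h6, h7⟩ := h
  have hB : ∀ {S : Finset Cell} {i j : ℤ}, S.image (frameCell δ η) = seg s i j →
      S = seg (frameCell (δ.1, η.1) (δ.2, η.2) ∘ s) i j := by
    intro S i j h
    rw [seg_comp, ← h, F.image_image]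
  have hA : ∀ {C : Cell} {k : ℤ}, s k = frameCell δ η C →
      (frameCell (δ.1, η.1) (δ.2, η.2) ∘ s) k = C := by
    intro C k h
    rw [Function.comp_apply, h, F.cell_cell]
  refine ⟨frameCell (δ.1, η.1) (δ.2, η.2) ∘ s, n, l, m, hs.frame F.symm, hl, hm, hle, ?_, hB h1,
    hB h2, hA h3, hA h4, hA h5, hA h6, ?_⟩
  · intro C
    rw [← F.cell_mem_image (C := C), hP]
    refine exists_congr fun k => ?_
    rw [Function.comp_apply]
    constructor
    · intro h; rw [h, F.cell_cell]
    · intro h; rw [← h, F.cell_cell']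
  · rw [F.rookSeries_image] at h7
    rw [h7, seg_comp, seg_comp, seg_comp, seg_comp, F.symm.rookSeries_image,
      F.symm.rookSeries_image, F.symm.rookSeries_image, F.symm.rookSeries_image]

end Polyomino

namespace Polyomino

/-! ### The start of a ladder in a closed path -/

section Start

variable {P B₁ B₂ B₃ : Finset Cell} {s : ℤ → Cell} {n x y : ℤ}

theorem lConfiguration_of_cycle (hs : IsCycle s n) (hP : ∀ C, C ∈ P ↔ ∃ k, s k = C) (i : ℤ)
    (h1 : s (i + 1) - s i = s (i + 2) - s (i + 1)) (h2 : s (i + 3) - s (i + 2) = s (i + 4) - s (i + 3))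
    (h3 : (s (i + 1) - s i).1 * (s (i + 3) - s (i + 2)).1 +
      (s (i + 1) - s i).2 * (s (i + 3) - s (i + 2)).2 = 0) : HasLConfiguration P := by
  have hm : ∀ k, s k ∈ P := fun k => (hP _).2 ⟨k, rfl⟩
  refine ⟨s i, hm _, s (i + 1), hm _, s (i + 2), hm _, s (i + 3), hm _, s (i + 4), hm _, ?_,
    hs.adj i, ?_, ?_, ?_, h1, h2, h3⟩
  · have hne : ∀ a b : ℤ, a < b → b ≤ a + 5 → s a ≠ s b := fun a b => hs.ne_of_lt
    simp only [List.nodup_cons, List.mem_cons, List.not_mem_nil, or_false, not_or, not_false_eq_true,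
      List.nodup_nil, and_true]
    refine ⟨⟨?_, ?_, ?_, ?_⟩, ⟨?_, ?_, ?_⟩, ⟨?_, ?_⟩, ?_⟩ <;> exact hne _ _ (by omega) (by omega)
  · have := hs.adj (i + 1); rwa [add_assoc] at this
  · have := hs.adj (i + 2); rwa [add_assoc] at this
  · have := hs.adj (i + 3); rwa [add_assoc] at this

/-- The next cell of a cyclic sequence, given by coordinates. -/
theorem IsCycle.next_cases (hs : IsCycle s n) {k p q : ℤ} (hk : s k = (p, q)) :
    (s (k + 1) = (p + 1, q) ∨ s (k + 1) = (p - 1, q) ∨ s (k + 1) = (p, q + 1) ∨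
      s (k + 1) = (p, q - 1)) ∧ (s (k - 1) = (p + 1, q) ∨ s (k - 1) = (p - 1, q) ∨
        s (k - 1) = (p, q + 1) ∨ s (k - 1) = (p, q - 1)) := by
  have h1 := adj_cases (hs.adj k)
  have h2 := adj_cases (hs.adj (k - 1)).symm
  rw [sub_add_cancel] at h2
  rw [hk] at h1 h2
  exact ⟨h1, h2⟩

variable (hs : IsCycle s n) (hP : ∀ C, C ∈ P ↔ ∃ k, s k = C) (R : IsRowStart P B₁ B₂ B₃)
  (hB₁ : 3 ≤ B₁.card) (hB₂ : 3 ≤ B₂.card) (h0 : s 0 = (x, y)) (h1 : s 1 = (x + 1, y))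
  (h2 : s (-1) = (x, y + 1)) (hm0 : s 0 ∈ B₂) (hm1 : s 1 ∈ B₂) (hm2 : s (-1) ∈ B₁)
  (hm3 : s (-2) ∈ B₁)
include hs hP R hB₁ hB₂ h0 h1 h2 hm0 hm1 hm2 hm3

/-- The geometric heart: the hypotheses on the ladder and the absence of an $L$-configuration
determine how the path leaves both blocks at their far ends, which is the shape `IsBend`. -/
theorem hasBend_normal : HasBend P B₁ B₂ (s 0) (s 1) (s (-1)) (s (-2)) := by
  have mem : ∀ k, s k ∈ P := fun k => (hP _).2 ⟨k, rfl⟩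
  have adjP : ∀ {k p q p' q' : ℤ}, s k = (p, q) → (p', q') ∈ P → IsStep (p' - p, q' - q) →
      (p', q') = s (k + 1) ∨ (p', q') = s (k - 1) := fun h h' h'' =>
    hs.eq_of_adj ((hP _).1 h') (by rw [h, adj_iff]; exact h'')
  have notP : ∀ {k p q p' q' : ℤ}, s k = (p, q) → IsStep (p' - p, q' - q) → (p', q') ≠ s (k + 1) →
      (p', q') ≠ s (k - 1) → (p', q') ∉ P := fun h h'' n1 n2 h' =>
    (adjP h h' h'').elim n1 n2
  have r0 : IsStep (1, 0) := by simp [IsStep]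
  have l0 : IsStep (-1, 0) := by simp [IsStep]
  have u0 : IsStep (0, 1) := by simp [IsStep]
  obtain ⟨a₁, a₂, y', ha, rfl, hsub₂, haP, haP'⟩ := R.snd
  obtain ⟨b₁, b₂, y'', hb, rfl, hsub₁, hbP, hbP'⟩ := R.fst
  obtain ⟨c₁, c₂, z, hc, rfl, hsub₃, hcP, hcP'⟩ := R.trd
  rw [h0, mem_rowSegment] at hm0
  rw [h1, mem_rowSegment] at hm1
  rw [h2, mem_rowSegment] at hm2
  dsimp only at hm0 hm1 hm2
  obtain ⟨g1, g2, rfl⟩ := hm0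
  obtain ⟨g3, g4, g5⟩ := hm2
  subst g5
  have mem₂ : ∀ u, a₁ ≤ u → u ≤ a₂ → (u, y) ∈ P := fun u k1 k2 =>
    hsub₂ (mem_rowSegment.2 ⟨k1, k2, rfl⟩)
  have mem₁ : ∀ u, b₁ ≤ u → u ≤ b₂ → (u, y + 1) ∈ P := fun u k1 k2 =>
    hsub₁ (mem_rowSegment.2 ⟨k1, k2, rfl⟩)
  have ca := card_rowSegment (x₀ := a₁) (x₁ := a₂) (y := y) (by omega)
  have cb := card_rowSegment (x₀ := b₁) (x₁ := b₂) (y := y + 1) (by omega)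
  -- the position of `s (-2)`
  have h3 : s (-2) = (x - 1, y + 1) := by
    rw [mem_rowSegment] at hm3
    have := (hs.next_cases h2).2
    rw [show (-1 : ℤ) - 1 = -2 by norm_num] at this
    have hne : s (-2) ≠ (x + 1, y + 1) := by
      intro h
      rcases adjP h1 (h ▸ mem (-2)) (by simpa using u0) with h' | h' <;> rw [← h] at h'
      · exact hs.ne_of_lt (by omega) (by omega) h'
      · exact hs.ne_of_lt (by omega) (by omega) h'
    generalize s (-2) = D at *
    obtain ⟨p, q⟩ := D
    simp only [Prod.mk.injEq, ne_eq] at *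
    omega
  -- the two blocks
  have ea : a₁ = x := by
    by_contra hne
    refine notP (p' := x - 1) (q' := y) h0 (by simpa using l0) ?_ ?_ (mem₂ _ (by omega) (by omega))
    · rw [zero_add, h1, ne_eq, Prod.mk.injEq]; omega
    · rw [zero_sub, h2, ne_eq, Prod.mk.injEq]; omega
  subst ea
  have eb : b₂ = a₁ := by
    by_contra hne
    refine notP (p' := a₁ + 1) (q' := y + 1) h2 (by simpa using r0) ?_ ?_
      (mem₁ _ (by omega) (by omega))
    · rw [neg_add_cancel, h0, ne_eq, Prod.mk.injEq]; omega
    · rw [show (-1 : ℤ) - 1 = -2 by norm_num, h3, ne_eq, Prod.mk.injEq]; omega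
  subst eb
  obtain ⟨l, rfl⟩ : ∃ l, a₂ = b₂ + l - 1 := ⟨a₂ - b₂ + 1, by ring⟩
  obtain ⟨m, rfl⟩ : ∃ m, b₁ = b₂ - m + 1 := ⟨b₂ - b₁ + 1, by ring⟩
  have hl : 3 ≤ l := by omega
  have hm : 3 ≤ m := by omega
  have right : ∀ k, 0 ≤ k → k < l → s k = (b₂ + k, y) := by
    intro k k1 k2
    have := hs.follow_row (l := l) (Or.inl rfl) h0 h1 (fun k k1 k2 =>
      (hP _).1 (mem₂ (b₂ + 1 * k) (by omega) (by omega))) k1 k2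
    rwa [one_mul] at this
  have left : ∀ k, 0 ≤ k → k < m → s (-1 - k) = (b₂ - k, y + 1) := by
    intro k k1 k2
    have := (hs.reverse (-1)).follow_row (x := b₂) (y := y + 1) (l := m) (Or.inr rfl)
      (by simpa using h2) (by rw [show (-1 : ℤ) - 1 = -2 by norm_num, h3]; rfl)
      (fun k k1 k2 => by
        obtain ⟨i, hi⟩ := (hP _).1 (mem₁ (b₂ + -1 * k) (by omega) (by omega))
        exact ⟨-1 - i, by rw [sub_sub_cancel]; exact hi⟩) k1 k2
    rw [this, Prod.mk.injEq]
    omega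
  have V12 : ∀ v, v ∈ vertices (rowSegment (b₂ - m + 1) b₂ (y + 1)) ∩
      vertices (rowSegment b₂ (b₂ + l - 1) y) ↔ b₂ ≤ v.1 ∧ v.1 ≤ b₂ + 1 ∧ v.2 = y + 1 := by
    intro v
    rw [Finset.mem_inter, mem_vertices_rowSegment (by omega), mem_vertices_rowSegment (by omega)]
    omega
  -- the third block
  obtain ⟨w, hw⟩ : (vertices (rowSegment b₂ (b₂ + l - 1) y) ∩
      vertices (rowSegment c₁ c₂ z)).Nonempty := by
    rw [← Finset.card_pos, R.card']; norm_num
  have hw' := Finset.mem_inter.1 hw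
  rw [mem_vertices_rowSegment (by omega), mem_vertices_rowSegment hc.le] at hw'
  -- Otherwise both intersections of consecutive blocks would lie on the line `y + 1`, which a
  -- ladder forbids.
  have hz : z ≠ y + 1 := by
    intro hz
    refine R.rows fun v hv u hu => ?_
    rw [V12] at hv
    rw [Finset.mem_inter, mem_vertices_rowSegment (by omega), mem_vertices_rowSegment hc.le] at hu
    omega
  have e_l : s l = (b₂ + l - 1, y - 1) := by
    have k1 := right (l - 1) (by omega) (by omega)
    have k2 := right (l - 2) (by omega) (by omega)
    have k3 := (hs.next_cases k1).1
    have k4 := hs.ne_of_lt (i := l - 2) (j := l) (by omega) (by omega)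
    rw [sub_add_cancel] at k3
    have k5 : s l ≠ (b₂ + l - 1 + 1, y) := fun h => haP' (h ▸ mem l)
    -- If the path left the lower block upwards, a cell `D` of the third block touching it would be
    -- within two steps of that block. Every such cell lies in the row `y + 1`, in the lower block
    -- itself, or too high to touch it.
    have k6 : s l ≠ (b₂ + l - 1, y + 1) := by
      intro k6
      obtain ⟨D, hD, hwD⟩ := mem_vertices_iff.1 (Finset.mem_inter.1 hw).2
      obtain ⟨E, hE, hwE⟩ := mem_vertices_iff.1 (Finset.mem_inter.1 hw).1
      have hD' := mem_rowSegment.1 hD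
      have hE' := mem_rowSegment.1 hE
      have hEs : s (E.1 - b₂) = E := by
        rw [right _ (by omega) (by omega)]
        exact Prod.ext (by dsimp only; omega) hE'.2.2.symm
      obtain ⟨j, hj⟩ := (hP D).1 (hsub₃ hD)
      rw [← hEs] at hwE
      rw [← hj] at hwD
      obtain ⟨e, he1, he2, he3⟩ := hs.exists_near hwE hwD
      rw [hj] at he3
      by_cases c1 : E.1 - b₂ + e < 0
      · have := left (-1 - (E.1 - b₂ + e)) (by omega) (by omega)
        rw [sub_sub_cancel, ← he3] at this
        rw [this] at hD'
        exact hz hD'.2.2.symm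
      by_cases c2 : E.1 - b₂ + e < l
      · have hr := right _ (by omega) c2
        have hD2 : D ∈ rowSegment b₂ (b₂ + l - 1) y := by
          rw [he3, hr, mem_rowSegment]; dsimp only; omega
        have := four_le_card_inter hD2 hD
        have := R.card'
        omega
      by_cases c3 : E.1 - b₂ + e = l
      · rw [he3, c3, k6] at hD'
        exact hz hD'.2.2.symm
      · obtain c4 : E.1 - b₂ + e = l + 1 := by omega
        rw [c4] at he3
        have k7 := (hs.next_cases k6).1
        have k8 := hs.ne_of_lt (i := l - 1) (j := l + 1) (by omega) (by omega)
        rw [k1] at k8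
        rw [← he3] at k7 k8
        obtain ⟨p, q⟩ := D
        simp only [Prod.mk.injEq, ne_eq] at k7 k8 hD'
        omega
    rw [k2] at k4
    generalize s l = D at *
    obtain ⟨p, q⟩ := D
    simp only [Prod.mk.injEq, ne_eq] at k3 k4 k5 k6 ⊢
    omega
  -- the left end
  have k1 := left (m - 1) (by omega) (by omega)
  have k2 := left (m - 2) (by omega) (by omega)
  have k3 := left (m - 3) (by omega) (by omega)
  rw [show -1 - (m - 1) = -m by ring] at k1
  rw [show -1 - (m - 2) = -m + 1 by ring] at k2
  rw [show -1 - (m - 3) = -m + 2 by ring] at k3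
  have hE : s (-1 - m) = (b₂ - m + 1, y) ∨ s (-1 - m) = (b₂ - m + 1, y + 2) := by
    have k4 := (hs.next_cases k1).2
    have k5 := hs.ne_of_lt (i := -m - 1) (j := -m + 1) (by omega) (by omega)
    have k6 : s (-m - 1) ≠ (b₂ - m + 1 - 1, y + 1) := fun h => hbP (h ▸ mem _)
    rw [show -1 - m = -m - 1 by ring]
    rw [k2] at k5
    generalize s (-m - 1) = D at *
    obtain ⟨p, q⟩ := D
    simp only [Prod.mk.injEq, ne_eq] at k4 k5 k6 ⊢
    omega
  -- After the turn the path continues to the left: to the right it would touch the second cell of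
  -- the upper block, and straight on it would form an L-configuration with the three end cells of
  -- that block.
  have hE' : s (-2 - m) = (b₂ - m, (s (-1 - m)).2) := by
    obtain ⟨σ, hσ, hEσ⟩ : ∃ σ, (σ = 1 ∨ σ = -1) ∧ s (-1 - m) = (b₂ - m + 1, y + 1 + σ) := by
      rcases hE with h | h
      · exact ⟨-1, Or.inr rfl, by rw [h, Prod.mk.injEq]; omega⟩
      · exact ⟨1, Or.inl rfl, by rw [h, Prod.mk.injEq]; omega⟩
    have k4 := (hs.next_cases hEσ).2
    rw [show -1 - m - 1 = -2 - m by ring] at k4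
    have k5 := hs.ne_of_lt (i := -2 - m) (j := -m) (by omega) (by omega)
    rw [k1] at k5
    have k6 : s (-2 - m) ≠ (b₂ - m + 2, y + 1 + σ) := by
      intro k6
      have hadj : IsStep (b₂ - m + 2 - (b₂ - (m - 2)), y + 1 + σ - (y + 1)) := by
        rcases hσ with rfl | rfl <;> simp [IsStep] <;> omega
      rcases adjP k2 (k6 ▸ mem (-2 - m)) hadj with h | h <;> rw [← k6] at h
      · exact hs.ne_of_lt (by omega) (by omega) h
      · exact hs.ne_of_lt (by omega) (by omega) h
    have k7 : s (-2 - m) ≠ (b₂ - m + 1, y + 1 + σ + σ) := by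
      intro k7
      refine R.noL (lConfiguration_of_cycle hs hP (-2 - m) ?_ ?_ ?_)
      · rw [show -2 - m + 1 = -1 - m by ring, show -2 - m + 2 = -m by ring, k7, hEσ, k1]
        ext
        · simp only [Prod.fst_sub]; ring
        · simp
      · rw [show -2 - m + 3 = -m + 1 by ring, show -2 - m + 2 = -m by ring,
          show -2 - m + 4 = -m + 2 by ring, k1, k2, k3]
        ext
        · simp only [Prod.fst_sub]; ring
        · simp
      · rw [show -2 - m + 3 = -m + 1 by ring, show -2 - m + 2 = -m by ring,
          show -2 - m + 1 = -1 - m by ring, k7, hEσ, k1, k2]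
        simp
    rw [hEσ]
    generalize s (-2 - m) = D at *
    obtain ⟨p, q⟩ := D
    simp only [Prod.mk.injEq, ne_eq] at k4 k5 k6 k7 ⊢
    omega
  -- If the turn were upwards, the maximal block in the row `y + 2` through the two cells after the
  -- turn would precede `B₁` in a ladder of three steps, against the assumption on the start of the
  -- ladder.
  have hE1 : s (-1 - m) = (b₂ - m + 1, y) := by
    refine hE.resolve_right fun hE2 => ?_
    rw [hE2] at hE'
    dsimp only at hE'
    obtain ⟨q₀, q₁, hq0, hq1, hQ⟩ := exists_isRowMax (P := P) (a := b₂ - m) (r := y + 2)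
      (hE' ▸ mem _) (hE2 ▸ mem _)
    have hQP : rowSegment q₀ q₁ (y + 2) ⊆ P := by
      obtain ⟨_, _, _, -, -, h, -⟩ := hQ; exact h
    have hq1' : q₁ = b₂ - m + 1 := by
      by_contra hne
      refine notP (p' := b₂ - m + 2) (q' := y + 2) hE2 ?_ ?_ ?_ (hQP (mem_rowSegment.2 ?_))
      · rw [show b₂ - m + 2 - (b₂ - m + 1) = 1 by ring, sub_self]; exact r0
      · rw [show -1 - m + 1 = -m by ring, k1, ne_eq, Prod.mk.injEq]; omega
      · rw [show -1 - m - 1 = -2 - m by ring, hE', ne_eq, Prod.mk.injEq]; omega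
      · dsimp only; omega
    subst hq1'
    refine R.first _ hQ ?_ ?_ ⟨(b₂, y + 1), (V12 _).2 (by dsimp only; omega), (b₂ + 1, y + 1),
      (V12 _).2 (by dsimp only; omega), by simp, rfl⟩ ⟨hQ, R.fst, R.snd, ?_, R.card, ?_⟩
    · intro h
      have : (b₂, y) ∈ rowSegment b₂ (b₂ + l - 1) y :=
        mem_rowSegment.2 (by dsimp only; omega)
      rw [← h, mem_rowSegment] at this
      dsimp only at this; omega
    · intro h
      have : (c₁, z) ∈ rowSegment c₁ c₂ z := mem_rowSegment.2 (by dsimp only; omega)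
      rw [← h, mem_rowSegment] at this
      dsimp only at this; omega
    · have : vertices (rowSegment q₀ (b₂ - m + 1) (y + 2)) ∩
          vertices (rowSegment (b₂ - m + 1) b₂ (y + 1)) =
          {(b₂ - m + 1, y + 2), (b₂ - m + 2, y + 2)} := by
        ext ⟨p, q⟩
        rw [Finset.mem_inter, mem_vertices_rowSegment (by omega),
          mem_vertices_rowSegment (by omega), Finset.mem_insert, Finset.mem_singleton,
          Prod.mk.injEq, Prod.mk.injEq]
        dsimp only
        omega
      rw [this, Finset.card_pair (by simp)]
    · intro h
      have := h (b₂ - m + 1, y + 2) (by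
        rw [Finset.mem_inter, mem_vertices_rowSegment (by omega),
          mem_vertices_rowSegment (by omega)]
        dsimp only; omega) (b₂, y + 1) ((V12 _).2 (by dsimp only; omega))
      dsimp only at this; omega
  have H : IsBend s n l m b₂ y :=
    { hs with
      hl := hl
      hm := hm
      right := right
      left := left
      right_end := e_l
      left_end := hE1
      left_end' := by rw [hE', hE1] }
  exact H.hasBend hP

end Start

end Polyomino

namespace Polyomino

variable {P S X Y Z B₁ B₂ B₃ : Finset Cell}

/-! ### Reflections -/

theorem frameCell_sub (δ η v w : ℤ × ℤ) : frameCell δ η v - frameCell δ η w = frameVert δ η (v - w) := by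
  have := frameCell_add δ η (v - w) w
  rw [add_sub_cancel] at this
  rw [this, add_sub_cancel_left]

namespace IsFrame

variable {δ η : ℤ × ℤ} (F : IsFrame δ η)
include F

theorem row_cases (hδ : δ.2 = 0) : (δ = (1, 0) ∨ δ = (-1, 0)) ∧ (η = (0, 1) ∨ η = (0, -1)) := by
  rcases F.cases with h | ⟨rfl | rfl, -⟩
  · exact h
  · simp at hδ
  · simp at hδ

theorem row_symm (hδ : δ.2 = 0) : (δ.1, η.1).2 = 0 := by
  rcases F.row_cases hδ with ⟨-, rfl | rfl⟩ <;> rfl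

theorem isRowMax (hδ : δ.2 = 0) (h : IsRowMax P S) :
    IsRowMax (P.image (frameCell δ η)) (S.image (frameCell δ η)) := by
  obtain ⟨x₀, x₁, y, h1, rfl, h2, h3, h4⟩ := h
  have key : ∃ x₀' x₁' y', x₀' < x₁' ∧ (∀ D, frameCell (δ.1, η.1) (δ.2, η.2) D ∈
      rowSegment x₀ x₁ y ↔ D ∈ rowSegment x₀' x₁' y') ∧
      ((x₀' - 1, y') = frameCell δ η (x₀ - 1, y) ∧ (x₁' + 1, y') = frameCell δ η (x₁ + 1, y) ∨
      (x₀' - 1, y') = frameCell δ η (x₁ + 1, y) ∧ (x₁' + 1, y') = frameCell δ η (x₀ - 1, y)) := by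
    simp only [mem_rowSegment]
    rcases F.row_cases hδ with ⟨rfl | rfl, rfl | rfl⟩
    · refine ⟨x₀, x₁, y, h1, fun D => ?_, Or.inl ?_⟩
      · simp [frameCell, frameVert]
      · simp [frameCell, frameVert]
    · refine ⟨x₀, x₁, -y - 1, h1, fun D => ?_, Or.inl ?_⟩
      · simp [frameCell, frameVert]; omega
      · simp [frameCell, frameVert]; omega
    · refine ⟨-x₁ - 1, -x₀ - 1, y, by omega, fun D => ?_, Or.inr ?_⟩
      · simp [frameCell, frameVert]; omega
      · simp [frameCell, frameVert]; omega
    · refine ⟨-x₁ - 1, -x₀ - 1, -y - 1, by omega, fun D => ?_, Or.inr ?_⟩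
      · simp [frameCell, frameVert]; omega
      · simp [frameCell, frameVert]; omega
  obtain ⟨x₀', x₁', y', k1, k2, k3⟩ := key
  refine ⟨x₀', x₁', y', k1, ?_, Finset.image_subset_image h2, ?_, ?_⟩
  · ext D
    rw [F.mem_image_cell, k2]
  · rcases k3 with ⟨k3, -⟩ | ⟨k3, -⟩ <;> rwa [k3, F.cell_mem_image]
  · rcases k3 with ⟨-, k3⟩ | ⟨-, k3⟩ <;> rwa [k3, F.cell_mem_image]

theorem vertices_inter : vertices (X.image (frameCell δ η)) ∩ vertices (Y.image (frameCell δ η)) =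
    (vertices X ∩ vertices Y).image (frameVert δ η) := by
  rw [F.vertices_image, F.vertices_image, Finset.image_inter _ _ F.vert_injective]

theorem snd_eq_iff (hδ : δ.2 = 0) (v w : ℤ × ℤ) :
    (frameVert δ η v).2 = (frameVert δ η w).2 ↔ v.2 = w.2 := by
  rcases F.row_cases hδ with ⟨-, rfl | rfl⟩ <;> simp [frameVert]

theorem isRowLadder (hδ : δ.2 = 0) (h : IsRowLadder P X Y Z) :
    IsRowLadder (P.image (frameCell δ η)) (X.image (frameCell δ η)) (Y.image (frameCell δ η))
      (Z.image (frameCell δ η)) where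
  fst := F.isRowMax hδ h.fst
  snd := F.isRowMax hδ h.snd
  trd := F.isRowMax hδ h.trd
  card := by rw [F.vertices_inter, Finset.card_image_of_injective _ F.vert_injective, h.card]
  card' := by rw [F.vertices_inter, Finset.card_image_of_injective _ F.vert_injective, h.card']
  rows := by
    intro h'
    refine h.rows fun v hv w hw => ?_
    rw [F.vertices_inter, F.vertices_inter] at h'
    exact (F.snd_eq_iff hδ v w).1 (h' _ (Finset.mem_image_of_mem _ hv) _
      (Finset.mem_image_of_mem _ hw))

theorem dot (v w : ℤ × ℤ) : (frameVert δ η v).1 * (frameVert δ η w).1 +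
    (frameVert δ η v).2 * (frameVert δ η w).2 = v.1 * w.1 + v.2 * w.2 := by
  rcases F.cases with ⟨rfl | rfl, rfl | rfl⟩ | ⟨rfl | rfl, rfl | rfl⟩ <;> simp [frameVert] <;> ring

theorem hasLConfiguration (h : HasLConfiguration P) :
    HasLConfiguration (P.image (frameCell δ η)) := by
  obtain ⟨C₁, h1, C₂, h2, C₃, h3, C₄, h4, C₅, h5, hn, a1, a2, a3, a4, e1, e2, e3⟩ := h
  have hm : ∀ {C}, C ∈ P → frameCell δ η C ∈ P.image (frameCell δ η) := fun h =>
    Finset.mem_image_of_mem _ h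
  refine ⟨_, hm h1, _, hm h2, _, hm h3, _, hm h4, _, hm h5, ?_, F.adj_cell.2 a1, F.adj_cell.2 a2,
    F.adj_cell.2 a3, F.adj_cell.2 a4, ?_, ?_, ?_⟩
  · have := hn.map F.cell_injective
    simpa using this
  · rw [frameCell_sub, frameCell_sub, e1]
  · rw [frameCell_sub, frameCell_sub, e2]
  · rw [frameCell_sub, frameCell_sub, F.dot, e3]

theorem hasLConfiguration_iff :
    HasLConfiguration (P.image (frameCell δ η)) ↔ HasLConfiguration P := by
  refine ⟨fun h => ?_, F.hasLConfiguration⟩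
  have := F.symm.hasLConfiguration h
  rwa [F.image_image] at this

theorem image_image' :
    (S.image (frameCell (δ.1, η.1) (δ.2, η.2))).image (frameCell δ η) = S := F.symm.image_image

theorem isRowStart (hδ : δ.2 = 0) (h : IsRowStart P X Y Z) :
    IsRowStart (P.image (frameCell δ η)) (X.image (frameCell δ η)) (Y.image (frameCell δ η))
      (Z.image (frameCell δ η)) where
  toIsRowLadder := F.isRowLadder hδ h.toIsRowLadder
  noL := by rw [F.hasLConfiguration_iff]; exact h.noL
  first := by
    intro Q hQ hY hZ hvw hlad
    have hδ' := F.row_symm hδ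
    have h1 := F.symm.isRowMax hδ' hQ
    have h2 := F.symm.isRowLadder hδ' hlad
    rw [F.image_image] at h1
    rw [F.image_image, F.image_image, F.image_image] at h2
    refine h.first _ h1 ?_ ?_ ?_ h2
    · rintro rfl; exact hY F.image_image'.symm
    · rintro rfl; exact hZ F.image_image'.symm
    · obtain ⟨v, hv, w, hw, hne, he⟩ := hvw
      rw [F.vertices_inter] at hv hw
      obtain ⟨v', hv', rfl⟩ := Finset.mem_image.1 hv
      obtain ⟨w', hw', rfl⟩ := Finset.mem_image.1 hw
      exact ⟨v', hv', w', hw', fun h => hne (h ▸ rfl), (F.snd_eq_iff hδ v' w').1 he⟩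

end IsFrame

/-- The frame `(A' - A, B - A)` makes the second block run to the right with the first block above
it. The cycle is shifted and oriented so that `A, A'` are its cells `0, 1`; as a cell has only two
neighbours in the path, `B, B'` are then the cells `-1, -2`. -/
theorem hasBend_of_isRowStart {s : ℤ → Cell} {n : ℤ} {A A' B B' : Cell} (hs : IsCycle s n)
    (hP : ∀ C, C ∈ P ↔ ∃ k, s k = C) (R : IsRowStart P B₁ B₂ B₃) (hB₁ : 3 ≤ B₁.card)
    (hB₂ : 3 ≤ B₂.card) (hA : A ∈ B₂) (hB : B ∈ B₁) (hAB : Adj A B) (hA' : A' ∈ B₂)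
    (hAA' : Adj A A') (hB' : B' ∈ B₁) (hBB' : Adj B B') : HasBend P B₁ B₂ A A' B B' := by
  obtain ⟨a₁, a₂, y₂, ha, rfl, hsub₂, haP, haP'⟩ := R.snd
  obtain ⟨b₁, b₂, y₁, hb, rfl, hsub₁, hbP, hbP'⟩ := R.fst
  have hdisj : ∀ D ∈ rowSegment b₁ b₂ y₁, D ∉ rowSegment a₁ a₂ y₂ := by
    intro D h1 h2
    have := four_le_card_inter h1 h2
    rw [R.card] at this
    omega
  have hrow : ∀ x, (x, y₂) ∈ P → a₁ - 1 ≤ x → x ≤ a₂ + 1 → (x, y₂) ∈ rowSegment a₁ a₂ y₂ := by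
    intro x h1 h2 h3
    rw [mem_rowSegment]
    refine ⟨?_, ?_, rfl⟩
    · by_contra h4
      obtain rfl : x = a₁ - 1 := by dsimp only at h4; omega
      exact haP h1
    · by_contra h4
      obtain rfl : x = a₂ + 1 := by dsimp only at h4; omega
      exact haP' h1
  have mA := mem_rowSegment.1 hA
  have mA' := mem_rowSegment.1 hA'
  have mB := mem_rowSegment.1 hB
  have mB' := mem_rowSegment.1 hB'
  have hBP := hsub₁ hB
  -- If they were in one row, `B` would belong to the maximal block `B₂`; but blocks with a common
  -- cell have at least four common vertices.
  have hAB2 : A.2 ≠ B.2 := by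
    intro h
    refine hdisj B hB ?_
    have hBe : B = (B.1, y₂) := Prod.ext rfl (by dsimp only; omega)
    rw [hBe]
    have hc := adj_cases hAB
    simp only [Prod.ext_iff] at hc
    exact hrow _ (hBe ▸ hBP) (by omega) (by omega)
  have hne : A ≠ B' := fun h => hdisj B' hB' (h ▸ hA)
  have hne' : A' ≠ B := fun h => hdisj B hB (h ▸ hA')
  obtain ⟨t, ht, htP, t0, t1⟩ : ∃ t, IsCycle t n ∧ (∀ C, C ∈ P ↔ ∃ k, t k = C) ∧ t 0 = A ∧
      t 1 = A' := by
    obtain ⟨i, hi⟩ := (hP A).1 (hsub₂ hA)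
    rcases hs.eq_of_adj ((hP A').1 (hsub₂ hA')) (hi ▸ hAA') with h | h
    · refine ⟨_, hs.shift i, fun C => ?_, by simpa using hi, h.symm⟩
      rw [hP]
      exact ⟨fun ⟨k, hk⟩ => ⟨k - i, by rw [add_sub_cancel, hk]⟩, fun ⟨k, hk⟩ => ⟨_, hk⟩⟩
    · refine ⟨_, hs.reverse i, fun C => ?_, by simpa using hi, h.symm⟩
      rw [hP]
      exact ⟨fun ⟨k, hk⟩ => ⟨i - k, by rw [sub_sub_cancel, hk]⟩, fun ⟨k, hk⟩ => ⟨_, hk⟩⟩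
  have t2 : t (-1) = B := by
    rcases ht.eq_of_adj (i := 0) ((htP B).1 hBP) (t0 ▸ hAB) with h | h
    · exact absurd (h ▸ t1).symm hne'
    · exact h.symm
  have t3 : t (-2) = B' := by
    rcases ht.eq_of_adj (i := -1) ((htP B').1 (hsub₁ hB')) (t2 ▸ hBB') with h | h
    · exact absurd (h ▸ t0).symm hne
    · exact h.symm
  have hδ : A' - A = (1, 0) ∨ A' - A = (-1, 0) := by
    have := adj_iff.1 hAA'
    simp only [IsStep, Prod.ext_iff, Prod.fst_sub, Prod.snd_sub] at this ⊢
    omega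
  have hη : B - A = (0, 1) ∨ B - A = (0, -1) := by
    have := adj_iff.1 hAB
    simp only [IsStep, Prod.ext_iff, Prod.fst_sub, Prod.snd_sub] at this ⊢
    omega
  have F : IsFrame (A' - A) (B - A) := by
    rcases hδ with h | h <;> rcases hη with h' | h' <;> rw [h, h'] <;> simp [IsFrame, IsStep]
  have hδ2 : (A' - A).2 = 0 := by rcases hδ with h | h <;> rw [h]
  refine F.hasBend ?_
  have key := hasBend_normal (ht.frame F) (P := P.image (frameCell (A' - A) (B - A))) ?_
    (F.isRowStart hδ2 R) ?_ ?_ (x := (frameCell (A' - A) (B - A) A).1)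
    (y := (frameCell (A' - A) (B - A) A).2) ?_ ?_ ?_ ?_ ?_ ?_ ?_
  · simpa only [Function.comp_apply, t0, t1, t2, t3] using key
  · intro C
    rw [F.mem_image_cell, htP]
    refine exists_congr fun k => ?_
    rw [Function.comp_apply]
    constructor
    · intro h; rw [h, F.cell_cell']
    · intro h; rw [← h, F.cell_cell]
  · rwa [Finset.card_image_of_injective _ F.cell_injective]
  · rwa [Finset.card_image_of_injective _ F.cell_injective]
  · rw [Function.comp_apply, t0]
  · rw [Function.comp_apply, t1]
    have := frameCell_add (A' - A) (B - A) (A' - A) A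
    rw [F.vert_left, add_sub_cancel] at this
    rw [this]
    ext <;> simp
  · rw [Function.comp_apply, t2]
    have := frameCell_add (A' - A) (B - A) (B - A) A
    rw [F.vert_right, add_sub_cancel] at this
    rw [this]
    ext <;> simp
  · rw [Function.comp_apply, t0]; exact Finset.mem_image_of_mem _ hA
  · rw [Function.comp_apply, t1]; exact Finset.mem_image_of_mem _ hA'
  · rw [Function.comp_apply, t2]; exact Finset.mem_image_of_mem _ hB
  · rw [Function.comp_apply, t3]; exact Finset.mem_image_of_mem _ hB'

/-! ### Horizontal blocks -/

theorem isHorizontalBlock_iff : IsHorizontalBlock P S ↔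
    ∃ x₀ x₁ y : ℤ, x₀ < x₁ ∧ S = rowSegment x₀ x₁ y ∧ S ⊆ P := by
  constructor
  · rintro ⟨⟨x₀, y⟩, -, ⟨x₁, y'⟩, -, h1, h2, rfl, h3, h4⟩
    dsimp only at h1 h2
    subst h2
    refine ⟨x₀, x₁, y, lt_of_le_of_ne h1 ?_, rfl, h4⟩
    rintro rfl
    rw [Finset.Icc_self, Finset.card_singleton] at h3
    omega
  · rintro ⟨x₀, x₁, y, h1, rfl, h2⟩
    refine ⟨(x₀, y), h2 (mem_rowSegment.2 ⟨le_rfl, h1.le, rfl⟩), (x₁, y),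
      h2 (mem_rowSegment.2 ⟨h1.le, le_rfl, rfl⟩), h1.le, rfl, rfl, ?_, h2⟩
    have := card_rowSegment (x₀ := x₀) (x₁ := x₁) (y := y) (by omega)
    change 1 < (rowSegment x₀ x₁ y).card
    omega

theorem IsVerticalBlock.fst_eq (h : IsVerticalBlock P S) {C D : Cell} (hC : C ∈ S) (hD : D ∈ S) :
    C.1 = D.1 := by
  obtain ⟨⟨a, b⟩, -, ⟨a', b'⟩, -, h1, -, rfl, -⟩ := h
  dsimp only at h1
  subst h1
  rw [Finset.mem_Icc] at hC hD
  have e1 : a ≤ C.1 := hC.1.1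
  have e2 : C.1 ≤ a := hC.2.1
  have e3 : a ≤ D.1 := hD.1.1
  have e4 : D.1 ≤ a := hD.2.1
  omega

/-- A row of at least two cells fits into no vertical block, so maximality only concerns the two
cells next to its ends. -/
theorem isRowMax_iff : IsRowMax P S ↔ IsHorizontalBlock P S ∧ IsMaximalBlock P S := by
  constructor
  · rintro ⟨x₀, x₁, y, h1, rfl, h2, h3, h4⟩
    have hb : IsHorizontalBlock P (rowSegment x₀ x₁ y) :=
      isHorizontalBlock_iff.2 ⟨x₀, x₁, y, h1, rfl, h2⟩
    refine ⟨hb, Or.inl hb, fun T hT hST => ?_⟩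
    have m1 := hST (mem_rowSegment.2 ⟨le_rfl, h1.le, rfl⟩ : (x₀, y) ∈ _)
    have m2 := hST (mem_rowSegment.2 ⟨h1.le, le_rfl, rfl⟩ : (x₁, y) ∈ _)
    rcases hT with hT | hT
    · obtain ⟨a, b, y', h5, rfl, h6⟩ := isHorizontalBlock_iff.1 hT
      rw [mem_rowSegment] at m1 m2
      dsimp only at m1 m2
      obtain ⟨k1, k2, rfl⟩ := m1
      have ea : a = x₀ := by
        by_contra hne
        exact h3 (h6 (mem_rowSegment.2 (by dsimp only; omega)))
      have eb : b = x₁ := by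
        by_contra hne
        exact h4 (h6 (mem_rowSegment.2 (by dsimp only; omega)))
      rw [ea, eb]
    · have := hT.fst_eq m1 m2
      dsimp only at this
      omega
  · rintro ⟨h, -, hmax⟩
    obtain ⟨x₀, x₁, y, h1, rfl, h2⟩ := isHorizontalBlock_iff.1 h
    refine ⟨x₀, x₁, y, h1, rfl, h2, fun h3 => ?_, fun h3 => ?_⟩
    · have := hmax (rowSegment (x₀ - 1) x₁ y) (Or.inl (isHorizontalBlock_iff.2
        ⟨x₀ - 1, x₁, y, by omega, rfl, fun D hD => ?_⟩)) fun D hD => ?_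
      · have m : (x₀ - 1, y) ∈ rowSegment (x₀ - 1) x₁ y :=
          mem_rowSegment.2 (by dsimp only; omega)
        rw [← this, mem_rowSegment] at m
        dsimp only at m
        omega
      · rw [mem_rowSegment] at hD
        by_cases hD1 : D.1 = x₀ - 1
        · rwa [show D = (x₀ - 1, y) from Prod.ext hD1 hD.2.2]
        · exact h2 (mem_rowSegment.2 (by omega))
      · rw [mem_rowSegment] at hD ⊢
        omega
    · have := hmax (rowSegment x₀ (x₁ + 1) y) (Or.inl (isHorizontalBlock_iff.2
        ⟨x₀, x₁ + 1, y, by omega, rfl, fun D hD => ?_⟩)) fun D hD => ?_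
      · have m : (x₁ + 1, y) ∈ rowSegment x₀ (x₁ + 1) y :=
          mem_rowSegment.2 (by dsimp only; omega)
        rw [← this, mem_rowSegment] at m
        dsimp only at m
        omega
      · rw [mem_rowSegment] at hD
        by_cases hD1 : D.1 = x₁ + 1
        · rwa [show D = (x₁ + 1, y) from Prod.ext hD1 hD.2.2]
        · exact h2 (mem_rowSegment.2 (by omega))
      · rw [mem_rowSegment] at hD ⊢
        omega

theorem mem_edges_row {C : Cell} (hC : C ∈ P) :
    {(C.1, C.2), (C.1 + 1, C.2)} ∈ edges P ∧ {(C.1, C.2 + 1), (C.1 + 1, C.2 + 1)} ∈ edges P :=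
  ⟨Finset.mem_biUnion.2 ⟨C, hC, by simp [cellEdges]⟩,
    Finset.mem_biUnion.2 ⟨C, hC, by simp [cellEdges]⟩⟩

theorem isLadder_three : IsLadder P [X, Y, Z] ↔
    ((IsHorizontalBlock P X ∧ IsHorizontalBlock P Y ∧ IsHorizontalBlock P Z) ∨
      (IsVerticalBlock P X ∧ IsVerticalBlock P Y ∧ IsVerticalBlock P Z)) ∧
    (IsMaximalBlock P X ∧ IsMaximalBlock P Y ∧ IsMaximalBlock P Z) ∧
    ((vertices X ∩ vertices Y).card = 2 ∧ (vertices Y ∩ vertices Z).card = 2) ∧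
    ¬ ∃ I, IsEdgeInterval P I ∧ vertices X ∩ vertices Y ⊆ I ∧ vertices Y ∩ vertices Z ⊆ I := by
  unfold IsLadder
  refine and_congr ?_ (and_congr ?_ (and_congr ?_ ?_))
  · simp
  · simp
  · constructor
    · intro h
      exact ⟨h 0 (by simp), h 1 (by simp)⟩
    · rintro ⟨h1, h2⟩ i hi
      have : i = 0 ∨ i = 1 := by simp at hi; omega
      rcases this with rfl | rfl
      exacts [h1, h2]
  · constructor
    · intro h
      exact h 0 (by simp)
    · intro h i hi
      obtain rfl : i = 0 := by simp at hi; omega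
      exact h

theorem IsLadder.take_three {L : List (Finset Cell)} (h : IsLadder P (X :: Y :: Z :: L)) :
    IsLadder P [X, Y, Z] := by
  obtain ⟨h1, h2, h3, h4⟩ := h
  rw [isLadder_three]
  refine ⟨h1.imp (fun h => ?_) fun h => ?_, ?_, ⟨h3 0 (by simp), h3 1 (by simp)⟩, h4 0 (by simp)⟩
  · exact ⟨h _ (by simp), h _ (by simp), h _ (by simp)⟩
  · exact ⟨h _ (by simp), h _ (by simp), h _ (by simp)⟩
  · exact ⟨h2 _ (by simp), h2 _ (by simp), h2 _ (by simp)⟩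

/-- If all the common vertices were in one row, the lower or upper side of the middle block would be
an edge interval containing both intersections. -/
theorem IsLadder.isRowLadder (h : IsLadder P [X, Y, Z])
    (hh : IsHorizontalBlock P X ∧ IsHorizontalBlock P Y ∧ IsHorizontalBlock P Z) :
    IsRowLadder P X Y Z := by
  obtain ⟨-, h2, h3, h4⟩ := isLadder_three.1 h
  refine ⟨isRowMax_iff.2 ⟨hh.1, h2.1⟩, isRowMax_iff.2 ⟨hh.2.1, h2.2.1⟩,
    isRowMax_iff.2 ⟨hh.2.2, h2.2.2⟩, h3.1, h3.2, fun hrow => h4 ?_⟩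
  obtain ⟨x₀, x₁, y, k1, rfl, k2⟩ := isHorizontalBlock_iff.1 hh.2.1
  obtain ⟨v, hv⟩ : (vertices X ∩ vertices (rowSegment x₀ x₁ y)).Nonempty := by
    rw [← Finset.card_pos, h3.1]; norm_num
  obtain ⟨w, hw⟩ : (vertices (rowSegment x₀ x₁ y) ∩ vertices Z).Nonempty := by
    rw [← Finset.card_pos, h3.2]; norm_num
  have hvY := (mem_vertices_rowSegment k1.le).1 (Finset.mem_inter.1 hv).2
  refine ⟨Finset.Icc (x₀, v.2) (x₁ + 1, v.2), Or.inl ⟨x₀, x₁ + 1, v.2, by omega, rfl, ?_⟩,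
    fun u hu => ?_, fun u hu => ?_⟩
  · intro k h5 h6
    have := mem_edges_row (k2 (mem_rowSegment.2 ⟨h5, by dsimp only; omega, rfl⟩ : (k, y) ∈ _))
    rcases (by omega : v.2 = y ∨ v.2 = y + 1) with h7 | h7 <;> rw [h7]
    exacts [this.1, this.2]
  · change u ∈ rowSegment _ _ _
    have := (mem_vertices_rowSegment k1.le).1 (Finset.mem_inter.1 hu).2
    exact mem_rowSegment.2 ⟨this.1, this.2.1, (hrow u hu w hw).trans (hrow v hv w hw).symm⟩
  · change u ∈ rowSegment _ _ _
    have := (mem_vertices_rowSegment k1.le).1 (Finset.mem_inter.1 hu).1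
    exact mem_rowSegment.2 ⟨this.1, this.2.1, (hrow v hv u hu).symm⟩

/-- A horizontal edge interval containing both intersections would put them in one row, and a
vertical one cannot contain two distinct vertices of a row. -/
theorem IsRowLadder.isLadder (h : IsRowLadder P X Y Z)
    (hrow : ∃ v ∈ vertices Y ∩ vertices Z, ∃ w ∈ vertices Y ∩ vertices Z, v ≠ w ∧ v.2 = w.2) :
    IsLadder P [X, Y, Z] := by
  obtain ⟨h1, h1'⟩ := isRowMax_iff.1 h.fst
  obtain ⟨h2, h2'⟩ := isRowMax_iff.1 h.snd
  obtain ⟨h3, h3'⟩ := isRowMax_iff.1 h.trd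
  rw [isLadder_three]
  refine ⟨Or.inl ⟨h1, h2, h3⟩, ⟨h1', h2', h3'⟩, ⟨h.card, h.card'⟩, ?_⟩
  rintro ⟨I, hI | hI, k1, k2⟩
  · obtain ⟨i, k, j, -, rfl, -⟩ := hI
    refine h.rows fun v hv w hw => ?_
    have e1 := (mem_rowSegment.1 (k1 hv)).2.2
    have e2 := (mem_rowSegment.1 (k2 hw)).2.2
    rw [e1, e2]
  · obtain ⟨i, k, j, -, rfl, -⟩ := hI
    obtain ⟨v, hv, w, hw, hne, he⟩ := hrow
    have e1 := Finset.mem_Icc.1 (k2 hv)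
    have e2 := Finset.mem_Icc.1 (k2 hw)
    have a1 : j ≤ v.1 := e1.1.1
    have a2 : v.1 ≤ j := e1.2.1
    have a3 : j ≤ w.1 := e2.1.1
    have a4 : w.1 ≤ j := e2.2.1
    exact hne (Prod.ext (by omega) he)

end Polyomino

namespace Polyomino

variable {P S X Y Z B₁ B₂ B₃ : Finset Cell}

/-! ### The reflection in the diagonal -/

theorem isFrame_swap : IsFrame (0, 1) (1, 0) := by simp [IsFrame, IsStep]

theorem frameVert_swap : frameVert (0, 1) (1, 0) = Prod.swap := by
  funext v; simp [frameVert, Prod.swap]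

theorem frameCell_swap : frameCell (0, 1) (1, 0) = Prod.swap := by
  funext C; simp [frameCell, frameVert, Prod.swap]

/-- The reflection of a finite set of lattice points, or of cells, in the diagonal. -/
def transpose (S : Finset (ℤ × ℤ)) : Finset (ℤ × ℤ) := S.image Prod.swap

theorem mem_transpose {S : Finset (ℤ × ℤ)} {C : ℤ × ℤ} : C ∈ transpose S ↔ C.swap ∈ S := by
  simp only [transpose, Finset.mem_image]
  exact ⟨fun ⟨D, h, e⟩ => by rwa [← e, Prod.swap_swap], fun h => ⟨_, h, C.swap_swap⟩⟩

theorem transpose_transpose (S : Finset (ℤ × ℤ)) : transpose (transpose S) = S := by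
  ext C; rw [mem_transpose, mem_transpose, Prod.swap_swap]

theorem transpose_subset {S T : Finset (ℤ × ℤ)} : transpose S ⊆ transpose T ↔ S ⊆ T := by
  refine ⟨fun h C hC => ?_, fun h => Finset.image_subset_image h⟩
  have := mem_transpose.1 (h (mem_transpose.2 (by rwa [C.swap_swap] : C.swap.swap ∈ S)))
  rwa [C.swap_swap] at this

theorem card_transpose (S : Finset (ℤ × ℤ)) : (transpose S).card = S.card :=
  Finset.card_image_of_injective _ Prod.swap_injective

theorem transpose_Icc (a b : ℤ × ℤ) : transpose (Finset.Icc a b) = Finset.Icc a.swap b.swap := by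
  ext C
  rw [mem_transpose, Finset.mem_Icc, Finset.mem_Icc, Prod.le_def, Prod.le_def, Prod.le_def,
    Prod.le_def]
  simp only [Prod.fst_swap, Prod.snd_swap]
  tauto

theorem vertices_inter_transpose (X Y : Finset Cell) :
    vertices (transpose X) ∩ vertices (transpose Y) = transpose (vertices X ∩ vertices Y) := by
  have := isFrame_swap.vertices_inter (X := X) (Y := Y)
  rwa [frameCell_swap, frameVert_swap] at this

theorem hasLConfiguration_transpose : HasLConfiguration (transpose P) ↔ HasLConfiguration P := by
  have := isFrame_swap.hasLConfiguration_iff (P := P)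
  rwa [frameCell_swap] at this

theorem IsVerticalBlock.transpose (h : IsVerticalBlock P S) :
    IsHorizontalBlock (transpose P) (transpose S) := by
  obtain ⟨A, hA, B, hB, h1, h2, rfl, h3, h4⟩ := h
  exact ⟨A.swap, mem_transpose.2 (by rwa [A.swap_swap]), B.swap,
    mem_transpose.2 (by rwa [B.swap_swap]), h2, h1, transpose_Icc A B, by rwa [card_transpose],
    transpose_subset.2 h4⟩

theorem IsHorizontalBlock.transpose (h : IsHorizontalBlock P S) :
    IsVerticalBlock (transpose P) (transpose S) := by
  obtain ⟨A, hA, B, hB, h1, h2, rfl, h3, h4⟩ := h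
  exact ⟨A.swap, mem_transpose.2 (by rwa [A.swap_swap]), B.swap,
    mem_transpose.2 (by rwa [B.swap_swap]), h2, h1, transpose_Icc A B, by rwa [card_transpose],
    transpose_subset.2 h4⟩

theorem IsBlock.transpose (h : IsBlock P S) : IsBlock (transpose P) (transpose S) :=
  h.elim (fun h => Or.inr h.transpose) fun h => Or.inl h.transpose

theorem IsMaximalBlock.transpose (h : IsMaximalBlock P S) :
    IsMaximalBlock (transpose P) (transpose S) := by
  refine ⟨h.1.transpose, fun T hT hST => ?_⟩
  have hT' := hT.transpose
  rw [transpose_transpose] at hT'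
  rw [h.2 _ hT' (by rwa [← transpose_subset, transpose_transpose]), transpose_transpose]

theorem transpose_mem_edges {e : Finset (ℤ × ℤ)} (h : e ∈ edges P) :
    transpose e ∈ edges (transpose P) := by
  obtain ⟨C, hC, he⟩ := Finset.mem_biUnion.1 h
  refine Finset.mem_biUnion.2 ⟨C.swap, mem_transpose.2 (by rwa [C.swap_swap]), ?_⟩
  simp only [cellEdges, Finset.mem_insert, Finset.mem_singleton] at he ⊢
  obtain ⟨p, q⟩ := C
  rcases he with rfl | rfl | rfl | rfl <;>
    simp [Polyomino.transpose, Finset.image_insert, Finset.image_singleton]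

theorem IsEdgeInterval.transpose {I : Finset (ℤ × ℤ)} (h : IsEdgeInterval P I) :
    IsEdgeInterval (transpose P) (transpose I) := by
  rcases h with ⟨i, k, j, h1, rfl, h2⟩ | ⟨i, k, j, h1, rfl, h2⟩
  · refine Or.inr ⟨i, k, j, h1, transpose_Icc _ _, fun l h3 h4 => ?_⟩
    have := transpose_mem_edges (h2 l h3 h4)
    simpa [Polyomino.transpose, Finset.image_insert, Finset.image_singleton] using this
  · refine Or.inl ⟨i, k, j, h1, transpose_Icc _ _, fun l h3 h4 => ?_⟩
    have := transpose_mem_edges (h2 l h3 h4)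
    simpa [Polyomino.transpose, Finset.image_insert, Finset.image_singleton] using this

theorem IsLadder.transpose (h : IsLadder P [X, Y, Z]) :
    IsLadder (transpose P) [transpose X, transpose Y, transpose Z] := by
  obtain ⟨h1, h2, h3, h4⟩ := isLadder_three.1 h
  refine isLadder_three.2 ⟨?_, ⟨h2.1.transpose, h2.2.1.transpose, h2.2.2.transpose⟩, ?_, ?_⟩
  · rcases h1 with h1 | h1
    · exact Or.inr ⟨h1.1.transpose, h1.2.1.transpose, h1.2.2.transpose⟩
    · exact Or.inl ⟨h1.1.transpose, h1.2.1.transpose, h1.2.2.transpose⟩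
  · simpa only [vertices_inter_transpose, card_transpose] using h3
  · rintro ⟨I, hI, k1, k2⟩
    have := hI.transpose
    rw [transpose_transpose] at this
    refine h4 ⟨_, this, ?_, ?_⟩
    · rw [← transpose_subset, transpose_transpose, ← vertices_inter_transpose]; exact k1
    · rw [← transpose_subset, transpose_transpose, ← vertices_inter_transpose]; exact k2

/-! ### The bend between the first two blocks of a ladder -/

theorem IsLadder.isRowStart (hlad : IsLadder P [B₁, B₂, B₃])
    (hh : IsHorizontalBlock P B₁ ∧ IsHorizontalBlock P B₂ ∧ IsHorizontalBlock P B₃)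
    (hfirst : ∀ Q, IsMaximalBlock P Q → Q ≠ B₂ → Q ≠ B₃ → ¬ IsLadder P [Q, B₁, B₂])
    (hL : ¬ HasLConfiguration P) : IsRowStart P B₁ B₂ B₃ where
  toIsRowLadder := hlad.isRowLadder hh
  first Q hQ h2 h3 hrow hl := hfirst Q (isRowMax_iff.1 hQ).2 h2 h3 (hl.isLadder hrow)
  noL := hL

/-- Indices are lifted from `ZMod n` to `ℤ`, where being more than two steps apart cyclically
becomes `i + 2 < j < i + n - 2`. -/
theorem IsClosedPath.exists_isCycle (hP : IsClosedPath P) :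
    ∃ s n, IsCycle s n ∧ ∀ C, C ∈ P ↔ ∃ k, s k = C := by
  obtain ⟨-, n, hn, A, hinj, hmem, hadj, hdisj⟩ := hP
  have hne : ∀ i j : ℤ, i < j → j < i + n → (i : ZMod n) ≠ (j : ZMod n) := by
    intro i j h1 h2 h
    rw [ZMod.intCast_eq_intCast_iff_dvd_sub] at h
    have := Int.le_of_dvd (by omega) h
    omega
  refine ⟨fun k => A k, n, ?_, fun C => ?_⟩
  · refine { lt := by exact_mod_cast hn, adj := fun k => ?_, period := fun k => ?_,
             inj := fun {i j} h1 h2 h => hne i j h1 h2 (hinj h), disj := fun {i j} h1 h2 => ?_ }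
    · have := hadj k
      push_cast
      exact this
    · simp
    · refine hdisj _ _ ?_ ?_ ?_ ?_ ?_
      · have := hne j (i - 2 + n) (by omega) (by omega)
        push_cast at this
        simpa using this
      · have := hne j (i - 1 + n) (by omega) (by omega)
        push_cast at this
        simpa using this
      · exact (hne i j (by omega) (by omega)).symm
      · have := (hne (i + 1) j (by omega) (by omega)).symm
        push_cast at this
        exact this
      · have := (hne (i + 2) j (by omega) (by omega)).symm
        push_cast at this
        exact this
  · rw [hmem]
    constructor
    · rintro ⟨i, rfl⟩
      obtain ⟨k, rfl⟩ := ZMod.intCast_surjective i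
      exact ⟨k, rfl⟩
    · rintro ⟨k, rfl⟩
      exact ⟨_, rfl⟩

theorem IsClosedPath.hasBend {A A' B B' : Cell} (hP : IsClosedPath P)
    (hL : ¬ HasLConfiguration P) (hlad : IsLadder P [B₁, B₂, B₃])
    (hfirst : ∀ Q, IsMaximalBlock P Q → Q ≠ B₂ → Q ≠ B₃ → ¬ IsLadder P [Q, B₁, B₂])
    (hB₁ : 3 ≤ B₁.card) (hB₂ : 3 ≤ B₂.card) (hA : A ∈ B₂) (hB : B ∈ B₁) (hAB : Adj A B)
    (hA' : A' ∈ B₂) (hAA' : Adj A A') (hB' : B' ∈ B₁) (hBB' : Adj B B') :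
    HasBend P B₁ B₂ A A' B B' := by
  obtain ⟨s, n, hs, hsP⟩ := hP.exists_isCycle
  rcases (isLadder_three.1 hlad).1 with hh | hh
  · exact hasBend_of_isRowStart hs hsP (hlad.isRowStart hh hfirst hL) hB₁ hB₂ hA hB hAB hA' hAA'
      hB' hBB'
  -- A ladder of vertical blocks is reflected in the diagonal.
  have R : IsRowStart (transpose P) (transpose B₁) (transpose B₂) (transpose B₃) := by
    refine hlad.transpose.isRowStart ⟨hh.1.transpose, hh.2.1.transpose, hh.2.2.transpose⟩
      (fun Q hQ h2 h3 hl => ?_) (by rwa [hasLConfiguration_transpose])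
    have hQ' := hQ.transpose
    have hl' := hl.transpose
    rw [transpose_transpose] at hQ'
    rw [transpose_transpose, transpose_transpose, transpose_transpose] at hl'
    refine hfirst _ hQ' ?_ ?_ hl'
    · rintro rfl; exact h2 (transpose_transpose Q).symm
    · rintro rfl; exact h3 (transpose_transpose Q).symm
  have F := isFrame_swap
  refine F.hasBend ?_
  have hm : ∀ {S : Finset Cell} {C}, C ∈ S →
      frameCell (0, 1) (1, 0) C ∈ S.image (frameCell (0, 1) (1, 0)) :=
    fun h => Finset.mem_image_of_mem _ h
  have ht : ∀ S : Finset Cell, S.image (frameCell (0, 1) (1, 0)) = transpose S := fun S => by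
    rw [frameCell_swap]; rfl
  refine hasBend_of_isRowStart (B₃ := transpose B₃) (hs.frame F) ?_ ?_ ?_ ?_ (hm hA) (hm hB)
    (F.adj_cell.2 hAB) (hm hA') (F.adj_cell.2 hAA') (hm hB') (F.adj_cell.2 hBB')
  · intro C
    rw [F.mem_image_cell, hsP]
    refine exists_congr fun k => ?_
    rw [Function.comp_apply]
    constructor
    · intro h; rw [h, F.cell_cell']
    · intro h; rw [← h, F.cell_cell]
  · rwa [ht, ht, ht]
  · rwa [ht, card_transpose]
  · rwa [ht, card_transpose]

end Polyomino

namespace Polyomino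

variable {S : Finset Cell} {s : ℤ → Cell} {n : ℤ}

/-! ### From rook series to h-polynomials -/

/-- A cell is its own lower left corner, so `S` is a subset of `vertices S`. -/
theorem rank_le_card_vertices (S : Finset Cell) : rank S ≤ (vertices S).card :=
  Finset.card_le_card fun C hC => Finset.mem_biUnion.2 ⟨C, hC, by simp [cellVertices]⟩

theorem one_sub_X_pow_mul_hilbertSeries (K : Type*) [Field K] (S : Finset Cell) :
    (1 - PowerSeries.X) ^ ((vertices S).card - rank S) * hilbertSeries K S = rookSeries S := by
  have h : ((vertices S).card : ℤ) - S.card = ((vertices S).card - rank S : ℕ) := by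
    have := rank_le_card_vertices S
    unfold rank at this ⊢
    omega
  rw [rookSeries, numer, h, zpow_natCast, Units.val_pow_eq_pow_val, oneSubX_val, hilbertSeries_eq]

theorem isHPolynomial_of_rookSeries (K : Type*) [Field K] {h : ℤ[X]}
    (hS : rookSeries S = (h : ℤ⟦X⟧)) (h1 : 0 < h.eval 1) : IsHPolynomial K S h := by
  have := (one_sub_X_pow_mul_hilbertSeries K S).trans hS
  exact ⟨h1.ne', _, ringKrullDim_eq_of_hilbertSeries K S h1.ne' this, this⟩

theorem IsCycle.exists_hPolynomial (hs : IsCycle s n) (K : Type*) [Field K] {i j : ℤ}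
    (hij : j < i + n - 2) :
    ∃ h : ℤ[X], IsHPolynomial K (seg s i j) h ∧ rookSeries (seg s i j) = (h : ℤ⟦X⟧) ∧
      0 < h.eval 1 := by
  obtain ⟨h, h1, h2⟩ := (hs.isPath hij).isGood.2
  exact ⟨h, isHPolynomial_of_rookSeries K h1 h2, h1, h2⟩

end Polyomino

/-! ### Proof of the theorem -/

theorem mainTheorem6 (K : Type*) [Field K] (P : Finset Polyomino.Cell)
    (hP : Polyomino.IsClosedPath P) (hL : ¬ Polyomino.HasLConfiguration P)
    (B₁ B₂ B₃ : Finset Polyomino.Cell) (rest : List (Finset Polyomino.Cell))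
    (hlad : Polyomino.IsLadder P (B₁ :: B₂ :: B₃ :: rest))
    (hfirst : ∀ Q, Polyomino.IsMaximalBlock P Q → Q ≠ B₂ → Q ≠ B₃ →
      ¬ Polyomino.IsLadder P [Q, B₁, B₂])
    (hB₁ : 3 ≤ B₁.card) (hB₂ : 3 ≤ B₂.card)
    (A A' B B' : Polyomino.Cell)
    (hA : A ∈ B₂) (hB : B ∈ B₁) (hAB : Polyomino.Adj A B)
    (hA' : A' ∈ B₂) (hAA' : Polyomino.Adj A A')
    (hB' : B' ∈ B₁) (hBB' : Polyomino.Adj B B')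
    (K₁ K₂ K₃ K₄ : Finset Polyomino.Cell)
    (hK₁ : K₁ = P \ B₁) (hK₂ : K₂ = P \ (B₂ ∪ {B, B'}))
    (hK₃ : K₃ = P \ (B₁ ∪ {A})) (hK₄ : K₄ = P \ {A, B, A', B'}) :
    (Polyomino.IsSimplePolyomino K₁ ∧ Polyomino.IsSimplePolyomino K₂ ∧
      Polyomino.IsSimplePolyomino K₃ ∧ Polyomino.IsSimplePolyomino K₄) ∧
    Polyomino.rank P ≤ (Polyomino.vertices P).card ∧
    (∃ h₁ h₂ h₃ h₄ : Polynomial ℤ,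
      Polyomino.IsHPolynomial K K₁ h₁ ∧ Polyomino.IsHPolynomial K K₂ h₂ ∧
      Polyomino.IsHPolynomial K K₃ h₃ ∧ Polyomino.IsHPolynomial K K₄ h₄ ∧
      (1 - PowerSeries.X) ^ ((Polyomino.vertices P).card - Polyomino.rank P) *
          Polyomino.hilbertSeries K P =
        ((h₄ + Polynomial.X * (h₁ + 2 * h₂ + h₃) : Polynomial ℤ) : PowerSeries ℤ)) ∧
    ringKrullDim (Polyomino.coordinateRing K P) =
      (((Polyomino.vertices P).card - Polyomino.rank P : ℕ) : WithBot ℕ∞) := by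
  obtain ⟨s, n, l, m, hs, hl, hm, hlm, hsP, rfl, rfl, rfl, rfl, rfl, rfl, hrook⟩ :=
    hP.hasBend hL hlad.take_three hfirst hB₁ hB₂ hA hB hAB hA' hAA' hB' hBB'
  have hn := hs.lt
  -- Each of the four sets is an arc of the cycle that omits at least three cells, hence a path to
  -- which the recursion and the simplicity of paths apply.
  have e₁ : K₁ = Polyomino.seg s 0 (n - m - 1) := by
    rw [hK₁, hs.sdiff_seg hsP (by omega)]
    congr 1; omega
  have e₂ : K₂ = Polyomino.seg s l (n - 3) := by
    have : Polyomino.seg s 0 (l - 1) ∪ {s (-1), s (-2)} = Polyomino.seg s (-2) (l - 1) := by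
      ext C
      simp only [Finset.mem_union, Finset.mem_insert, Finset.mem_singleton, Polyomino.mem_seg]
      constructor
      · rintro (⟨k, h1, h2, h3⟩ | rfl | rfl)
        exacts [⟨k, by omega, h2, h3⟩, ⟨-1, by omega, by omega, rfl⟩,
          ⟨-2, by omega, by omega, rfl⟩]
      · rintro ⟨k, h1, h2, rfl⟩
        rcases (by omega : 0 ≤ k ∨ k = -1 ∨ k = -2) with h | rfl | rfl
        exacts [Or.inl ⟨k, h, h2, rfl⟩, Or.inr (Or.inl rfl), Or.inr (Or.inr rfl)]
    rw [hK₂, this, hs.sdiff_seg hsP (by omega)]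
    congr 1 <;> omega
  have e₃ : K₃ = Polyomino.seg s 1 (n - m - 1) := by
    have : Polyomino.seg s (-m) (-1) ∪ {s 0} = Polyomino.seg s (-m) 0 := by
      ext C
      simp only [Finset.mem_union, Finset.mem_singleton, Polyomino.mem_seg]
      constructor
      · rintro (⟨k, h1, h2, h3⟩ | rfl)
        exacts [⟨k, h1, by omega, h3⟩, ⟨0, by omega, le_rfl, rfl⟩]
      · rintro ⟨k, h1, h2, rfl⟩
        rcases (by omega : k ≤ -1 ∨ k = 0) with h | rfl
        exacts [Or.inl ⟨k, h1, h, rfl⟩, Or.inr rfl]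
    rw [hK₃, this, hs.sdiff_seg hsP (by omega)]
    congr 1; omega
  have e₄ : K₄ = Polyomino.seg s 2 (n - 3) := by
    have : ({s 0, s (-1), s 1, s (-2)} : Finset Polyomino.Cell) = Polyomino.seg s (-2) 1 := by
      ext C
      simp only [Finset.mem_insert, Finset.mem_singleton, Polyomino.mem_seg]
      constructor
      · rintro (rfl | rfl | rfl | rfl)
        exacts [⟨0, by omega, by omega, rfl⟩, ⟨-1, by omega, by omega, rfl⟩,
          ⟨1, by omega, by omega, rfl⟩, ⟨-2, by omega, by omega, rfl⟩]
      · rintro ⟨k, h1, h2, rfl⟩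
        rcases (by omega : k = 0 ∨ k = -1 ∨ k = 1 ∨ k = -2) with rfl | rfl | rfl | rfl <;> simp
    rw [hK₄, this, hs.sdiff_seg hsP (by omega)]
    congr 1; omega
  obtain ⟨h₁, p₁, r₁, q₁⟩ := hs.exists_hPolynomial K (i := 0) (j := n - m - 1) (by omega)
  obtain ⟨h₂, p₂, r₂, q₂⟩ := hs.exists_hPolynomial K (i := l) (j := n - 3) (by omega)
  obtain ⟨h₃, p₃, r₃, q₃⟩ := hs.exists_hPolynomial K (i := 1) (j := n - m - 1) (by omega)
  obtain ⟨h₄, p₄, r₄, q₄⟩ := hs.exists_hPolynomial K (i := 2) (j := n - 3) (by omega)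
  have hH : (1 - PowerSeries.X) ^ ((Polyomino.vertices P).card - Polyomino.rank P) *
      Polyomino.hilbertSeries K P =
        ((h₄ + Polynomial.X * (h₁ + 2 * h₂ + h₃) : Polynomial ℤ) : PowerSeries ℤ) := by
    rw [Polyomino.one_sub_X_pow_mul_hilbertSeries, hrook, r₁, r₂, r₃, r₄]
    simp only [two_mul, Polynomial.coe_add, Polynomial.coe_mul, Polynomial.coe_X]
  -- The four h-polynomials are positive at `1`, so nothing cancels.
  have hpos : (h₄ + Polynomial.X * (h₁ + 2 * h₂ + h₃)).eval 1 ≠ 0 := by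
    simp only [two_mul, Polynomial.eval_add, Polynomial.eval_mul, Polynomial.eval_X, one_mul]
    omega
  subst e₁ e₂ e₃ e₄
  exact ⟨⟨(hs.isPath (by omega)).isSimplePolyomino (by omega),
    (hs.isPath (by omega)).isSimplePolyomino (by omega),
    (hs.isPath (by omega)).isSimplePolyomino (by omega),
    (hs.isPath (by omega)).isSimplePolyomino (by omega)⟩,
    Polyomino.rank_le_card_vertices P, ⟨h₁, h₂, h₃, h₄, p₁, p₂, p₃, p₄, hH⟩,
    Polyomino.ringKrullDim_eq_of_hilbertSeries K P hpos hH⟩
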